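/- Let $D\subset\mathbb R^2$ be a bounded domain with $\mathcal C^{1,\eta}$ boundary, $0<\eta<1$, such that $\mathbb R^2\setminus\overline D$ is connected, and let $\nu$ be the unit normal on $\partial D$ pointing out of $D$. Let $H^{1/2}(\partial D)$ be the space of traces on $\partial D$ of functions in $H^1(D)$, with the norm $\|f\|=\inf\{\|U\|_{H^1(D)}:U|_{\partial D}=f\}$, let $H^{1/2}_0(\partial D)$ be its subspace of functions with $\int_{\partial D}f\,ds=0$, let $H^{-1/2}(\partial D)$ be the dual of $H^{1/2}(\partial D)$, and let $H^{-1/2}_0(\partial D)=\{g\in H^{-1/2}(\partial D):\langle g,1\rangle=0\}$. Let $c>1$. A conductivity is a measurable function $\sigma$ on $D$ with $c^{-1}\le\sigma\le c$ almost everywhere. The Neumann-to-Dirichlet map $\Lambda_\sigma:H^{-1/2}_0(\partial D)\to H^{1/2}_0(\partial D)$ is $\Lambda_\sigma[g]=u|_{\partial D}$, where $u\in H^1(D)$ is the weak solution of $$\nabla\cdot\sigma\nabla u=0\ \text{ in }D,\qquad \sigma\frac{\partial u}{\partial\nu}=g\ \text{ on }\partial D,\qquad \int_{\partial D}u\,ds=0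 ,$$ and $\Lambda_1$ is this map for $\sigma\equiv1$. The exterior Neumann-to-Dirichlet map $\Lambda^e:H^{-1/2}_0(\partial D)\to H^{1/2}_0(\partial D)$ is $\Lambda^e[g]=u|_{\partial D}-\frac1{|\partial D|}\int_{\partial D}u\,ds$, where $u$ is the weak solution, in $H^1$ on bounded parts of the exterior, of $$\Delta u=0\ \text{ in }\mathbb R^2\setminus\overline D,\qquad \frac{\partial u}{\partial\nu}\Big|_+=g\ \text{ on }\partial D,\qquad u(x)=O(|x|^{-1})\ \text{ as }|x|\to\infty .$$ Then $\Lambda^e$ and all $\Lambda_\sigma$ are well-defined bounded operators, $\Lambda_1$ is boundedly invertible, and for every conductivity $\sigma$ the operator $\Lambda_\sigma-\Lambda^e:H^{-1/2}_0(\partial D)\to H^{1/2}_0(\partial D)$ is boundedly invertible. Put $$M_\sigma=\Lambda_1^{-1}(\Lambda_1-\Lambda_\sigma)(\Lambda_\sigma-\Lambda^e)^{-1}(\Lambda_1-\Lambda^e):H^{-1/2}_0(\partial D)\to H^{-1/2}_0(\partial D).$$ There are constants $C_1,C_2>0$, depending only on $D$ and $c$, such that for all conductivities $\sigma_1,\sigma_2$,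 in the operator norms, $$C_2\,\|M_{\sigma_1}-M_{\sigma_2}\|\le\|\Lambda_{\sigma_1}-\Lambda_{\sigma_2}\|\le C_1\,\|M_{\sigma_1}-M_{\sigma_2}\| .$$ -/

import Mathlib

set_option maxSynthPendingDepth 3

open MeasureTheory Set Filter Topology Bornology
open scoped ContDiff NNReal

noncomputable section

/-- The Euclidean plane. -/
abbrev Plane : Type := EuclideanSpace ℝ (Fin 2)

/-- Smooth compactly supported real functions on the plane. -/
def IsTestFun (φ : Plane → ℝ) : Prop := ContDiff ℝ ∞ φ ∧ HasCompactSupport φ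

theorem IsTestFun.continuous {φ : Plane → ℝ} (h : IsTestFun φ) : Continuous φ :=
  h.1.continuous

theorem IsTestFun.memLp {φ : Plane → ℝ} (h : IsTestFun φ) (μ : Measure Plane)
    [IsFiniteMeasureOnCompacts μ] : MemLp φ 2 μ :=
  h.continuous.memLp_of_hasCompactSupport h.2

theorem IsTestFun.memLp_fderiv {φ : Plane → ℝ} (h : IsTestFun φ) (w : Plane)
    (μ : Measure Plane) [IsFiniteMeasureOnCompacts μ] :
    MemLp (fun x => fderiv ℝ φ x w) 2 μ := by
  refine Continuous.memLp_of_hasCompactSupport ?_ ?_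
  · exact (h.1.continuous_fderiv (by simp)).clm_apply continuous_const
  · exact h.2.fderiv_apply (𝕜 := ℝ) w

/-! ### Domains -/

/-- `D` is a bounded domain whose boundary is of class `C^{1,η}`: near each boundary point, in
suitable Cartesian coordinates, `D` is the region above the graph of a `C¹` function whose
derivative is Hölder continuous of exponent `η`. -/
structure IsHolderDomain (η : ℝ≥0) (D : Set Plane) : Prop where
  isOpen : IsOpen D
  isConnected : IsConnected D
  isBounded : IsBounded D
  boundary : ∀ p ∈ frontier D, ∃ r > 0, ∃ (L : Plane ≃ₗᵢ[ℝ] Plane) (γ : ℝ → ℝ) (K : ℝ≥0),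
    ContDiff ℝ 1 γ ∧ HolderWith K η (deriv γ) ∧
    ∀ x ∈ Metric.ball p r, x ∈ D ↔ γ (L x 0) < L x 1

/-- A conductivity on `D`: a measurable function with `c⁻¹ ≤ σ ≤ c` almost everywhere in `D`. -/
def IsConductivity (c : ℝ) (D : Set Plane) (σ : Plane → ℝ) : Prop :=
  AEMeasurable σ (volume.restrict D) ∧ ∀ᵐ x ∂(volume.restrict D), c⁻¹ ≤ σ x ∧ σ x ≤ c

/-! ### The Sobolev space `H¹(Ω)` -/

/-- `L²(Ω) × L²(Ω; ℝ²)` with its Hilbert space norm. -/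
abbrev L2Pair (Ω : Set Plane) : Type :=
  WithLp 2 (Lp ℝ 2 (volume.restrict Ω) × Lp Plane 2 (volume.restrict Ω))

/-- `H¹(Ω)`, as the space of the pairs `(u, ∇u)` with `u ∈ L²(Ω)` having the weak gradient
`∇u ∈ L²(Ω; ℝ²)`; the norm is `(‖u‖² + ‖∇u‖²)^{1/2}`. -/
def H1 (Ω : Set Plane) : Submodule ℝ (L2Pair Ω) where
  carrier := {U | ∀ φ : Plane → ℝ, IsTestFun φ → tsupport φ ⊆ Ω → ∀ w : Plane,
    ∫ x in Ω, U.fst x * fderiv ℝ φ x w = - ∫ x in Ω, φ x * inner ℝ (U.snd x) w}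
  zero_mem' := by
    intro φ _ _ w
    have h1 : ∫ x in Ω, (0 : L2Pair Ω).fst x * fderiv ℝ φ x w = 0 := by
      refine integral_eq_zero_of_ae ?_
      filter_upwards [Lp.coeFn_zero ℝ 2 (volume.restrict Ω)] with x hx
      have hx' : (0 : L2Pair Ω).fst x = 0 := hx
      simp only [hx', zero_mul, Pi.zero_apply]
    have h2 : ∫ x in Ω, φ x * inner ℝ ((0 : L2Pair Ω).snd x) w = 0 := by
      refine integral_eq_zero_of_ae ?_
      filter_upwards [Lp.coeFn_zero Plane 2 (volume.restrict Ω)] with x hx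
      have hx' : (0 : L2Pair Ω).snd x = 0 := hx
      simp only [hx', inner_zero_left, mul_zero, Pi.zero_apply]
    rw [h1, h2, neg_zero]
  add_mem' := by
    intro U V hU hV φ hφ hs w
    have i1 : ∀ W : L2Pair Ω,
        Integrable (fun x => W.fst x * fderiv ℝ φ x w) (volume.restrict Ω) := fun W =>
      (Lp.memLp W.fst).integrable_mul (hφ.memLp_fderiv w _)
    have i2 : ∀ W : L2Pair Ω,
        Integrable (fun x => φ x * inner ℝ (W.snd x) w) (volume.restrict Ω) := fun W =>
      (hφ.memLp _).integrable_mul ((Lp.memLp W.snd).inner_const w)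
    have h1 : ∫ x in Ω, (U + V).fst x * fderiv ℝ φ x w
        = ∫ x in Ω, (U.fst x * fderiv ℝ φ x w + V.fst x * fderiv ℝ φ x w) := by
      refine integral_congr_ae ?_
      filter_upwards [Lp.coeFn_add U.fst V.fst] with x hx
      simp only [WithLp.add_fst, hx, Pi.add_apply, add_mul]
    have h2 : ∫ x in Ω, φ x * inner ℝ ((U + V).snd x) w
        = ∫ x in Ω, (φ x * inner ℝ (U.snd x) w + φ x * inner ℝ (V.snd x) w) := by
      refine integral_congr_ae ?_
      filter_upwards [Lp.coeFn_add U.snd V.snd] with x hx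
      simp only [WithLp.add_snd, hx, Pi.add_apply, inner_add_left, mul_add]
    rw [h1, h2, integral_add (i1 U) (i1 V), integral_add (i2 U) (i2 V), hU φ hφ hs w,
      hV φ hφ hs w, neg_add]
  smul_mem' := by
    intro a U hU φ hφ hs w
    have h1 : ∫ x in Ω, (a • U).fst x * fderiv ℝ φ x w
        = ∫ x in Ω, a * (U.fst x * fderiv ℝ φ x w) := by
      refine integral_congr_ae ?_
      filter_upwards [Lp.coeFn_smul a U.fst] with x hx
      simp only [WithLp.smul_fst, hx, Pi.smul_apply, smul_eq_mul, mul_assoc]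
    have h2 : ∫ x in Ω, φ x * inner ℝ ((a • U).snd x) w
        = ∫ x in Ω, a * (φ x * inner ℝ (U.snd x) w) := by
      refine integral_congr_ae ?_
      filter_upwards [Lp.coeFn_smul a U.snd] with x hx
      simp only [WithLp.smul_snd, hx, Pi.smul_apply, real_inner_smul_left]
      ring
    rw [h1, h2, integral_const_mul, integral_const_mul, hU φ hφ hs w, mul_neg]

/-- The function underlying an element of `H¹(Ω)`. -/
def fnOf {Ω : Set Plane} (U : H1 Ω) : Lp ℝ 2 (volume.restrict Ω) := (U : L2Pair Ω).fst

/-- The weak gradient of an element of `H¹(Ω)`. -/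
def gradOf {Ω : Set Plane} (U : H1 Ω) : Lp Plane 2 (volume.restrict Ω) := (U : L2Pair Ω).snd

/-! ### Traces on the boundary -/

/-- Arc length on the curve `Γ`: one-dimensional Hausdorff measure restricted to `Γ`. -/
def arcLength (Γ : Set Plane) : Measure Plane := (Measure.hausdorffMeasure 1).restrict Γ

/-- The pairs `(φ|_Ω, φ|_Γ)` with `φ` smooth and compactly supported in the plane. -/
def smoothTracePairs (Ω Γ : Set Plane) : Submodule ℝ (H1 Ω × Lp ℝ 2 (arcLength Γ)) where
  carrier := {P | ∃ φ : Plane → ℝ, IsTestFun φ ∧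
    fnOf P.1 =ᵐ[volume.restrict Ω] φ ∧ P.2 =ᵐ[arcLength Γ] φ}
  zero_mem' := ⟨0, ⟨contDiff_const, HasCompactSupport.zero⟩,
    Lp.coeFn_zero ℝ 2 (volume.restrict Ω), Lp.coeFn_zero ℝ 2 (arcLength Γ)⟩
  add_mem' := by
    rintro P Q ⟨φ, hφ, hP1, hP2⟩ ⟨ψ, hψ, hQ1, hQ2⟩
    refine ⟨φ + ψ, ⟨hφ.1.add hψ.1, hφ.2.add hψ.2⟩, ?_, ?_⟩
    · exact (Lp.coeFn_add (fnOf P.1) (fnOf Q.1)).trans (hP1.add hQ1)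
    · exact (Lp.coeFn_add P.2 Q.2).trans (hP2.add hQ2)
  smul_mem' := by
    rintro a P ⟨φ, hφ, hP1, hP2⟩
    refine ⟨a • φ, ⟨hφ.1.const_smul a, hφ.2.smul_left (f := fun _ => a)⟩, ?_, ?_⟩
    · exact (Lp.coeFn_smul a (fnOf P.1)).trans (hP1.const_smul a)
    · exact (Lp.coeFn_smul a P.2).trans (hP2.const_smul a)

/-- The graph of the trace operator `H¹(Ω) → L²(Γ)`, for a part `Γ` of the boundary of `Ω`: the
closure of restriction to `Γ` on smooth functions. Thus `(U, f) ∈ traceGraph Ω Γ` says that `f` is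
the trace of `U` on `Γ`. -/
def traceGraph (Ω Γ : Set Plane) : Submodule ℝ (H1 Ω × Lp ℝ 2 (arcLength Γ)) :=
  (smoothTracePairs Ω Γ).topologicalClosure

/-- The functions in `H¹(D)` with zero trace on `∂D`. -/
def traceKer (D : Set Plane) : Submodule ℝ (H1 D) :=
  (traceGraph D (frontier D)).comap (LinearMap.inl ℝ (H1 D) (Lp ℝ 2 (arcLength (frontier D))))

instance traceKer_isClosed (D : Set Plane) : IsClosed (traceKer D : Set (H1 D)) :=
  (Submodule.isClosed_topologicalClosure _).preimage (Continuous.prodMk_left 0)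

/-- `H^{1/2}(∂D)`, the trace space of `H¹(D)`: a boundary function is represented by the class of
the functions of `H¹(D)` whose trace it is, and its norm is the least `H¹(D)` norm of such a
function. -/
def HHalf (D : Set Plane) : Type := H1 D ⧸ traceKer D

instance (D : Set Plane) : NormedAddCommGroup (HHalf D) :=
  inferInstanceAs (NormedAddCommGroup (H1 D ⧸ traceKer D))

instance (D : Set Plane) : NormedSpace ℝ (HHalf D) :=
  inferInstanceAs (NormedSpace ℝ (H1 D ⧸ traceKer D))

/-- The map that takes `U ∈ H¹(D)` to its boundary values, as an element of `H^{1/2}(∂D)`. -/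
def boundaryValue {D : Set Plane} : H1 D →ₗ[ℝ] HHalf D := (traceKer D).mkQ

/-- `H^{1/2}_0(∂D)`: the elements of `H^{1/2}(∂D)` of zero integral over `∂D`. The trace is in
`L²(∂D)`, hence integrable when `∂D` has finite length. -/
def HHalf0 (D : Set Plane) : Submodule ℝ (HHalf D) where
  carrier := {q | ∃ (U : H1 D) (f : Lp ℝ 2 (arcLength (frontier D))), boundaryValue U = q ∧
    (U, f) ∈ traceGraph D (frontier D) ∧ Integrable f (arcLength (frontier D)) ∧
    ∫ y, f y ∂(arcLength (frontier D)) = 0}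
  zero_mem' := by
    refine ⟨0, 0, map_zero _, zero_mem _, ?_, ?_⟩
    · exact (integrable_congr (Lp.coeFn_zero _ _ _)).2 (integrable_zero _ _ _)
    · exact integral_eq_zero_of_ae (Lp.coeFn_zero _ _ _)
  add_mem' := by
    rintro p q ⟨U, f, rfl, hf, hi, h0⟩ ⟨V, g, rfl, hg, hj, h1⟩
    refine ⟨U + V, f + g, map_add _ _ _, add_mem hf hg, ?_, ?_⟩
    · exact (integrable_congr (Lp.coeFn_add f g)).2 (hi.add hj)
    · rw [integral_congr_ae (Lp.coeFn_add f g), integral_add' hi hj, h0, h1, add_zero]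
  smul_mem' := by
    rintro a q ⟨U, f, rfl, hf, hi, h0⟩
    refine ⟨a • U, a • f, map_smul _ _ _, Submodule.smul_mem _ a hf, ?_, ?_⟩
    · exact (integrable_congr (Lp.coeFn_smul a f)).2 (hi.smul a)
    · rw [integral_congr_ae (Lp.coeFn_smul a f)]
      simp only [Pi.smul_apply]
      rw [integral_smul, h0, smul_zero]

/-- `H^{-1/2}_0(∂D)`: the elements `g` of the dual `H^{-1/2}(∂D)` of `H^{1/2}(∂D)` with
`⟨g, 1⟩ = 0`, with the dual norm. -/
def HNegHalf0 (D : Set Plane) : Submodule ℝ (StrongDual ℝ (HHalf D)) where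
  carrier := {g | ∀ V : H1 D, (fnOf V =ᵐ[volume.restrict D] fun _ => (1 : ℝ)) →
    g (boundaryValue V) = 0}
  zero_mem' := fun _ _ => rfl
  add_mem' := fun {g h} hg hh V hV => by
    rw [add_apply, hg V hV, hh V hV, add_zero]
  smul_mem' := fun a g hg V hV => by
    rw [smul_apply, hg V hV, smul_zero]

/-! ### Neumann-to-Dirichlet maps -/

/-- `U ∈ H¹(D)` is a weak solution of `∇ · σ∇u = 0` in `D`, `σ ∂u/∂ν = g` on `∂D`. -/
def IsInteriorSolution (D : Set Plane) (σ : Plane → ℝ) (g : StrongDual ℝ (HHalf D))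
    (U : H1 D) : Prop :=
  ∀ V : H1 D, ∫ x in D, σ x * inner ℝ (gradOf U x) (gradOf V x) = g (boundaryValue V)

/-- The bounded operator `Λ : H^{-1/2}_0(∂D) → H^{1/2}_0(∂D)` is the Neumann-to-Dirichlet map of
`σ`: for every `g`, the boundary value of zero mean of a solution with Neumann data `g` exists, is
unique, and is `Λ g`. -/
def IsNtD (D : Set Plane) (σ : Plane → ℝ) (Λ : HNegHalf0 D →L[ℝ] HHalf0 D) : Prop :=
  ∀ (g : HNegHalf0 D) (q : HHalf0 D),
    Λ g = q ↔ ∃ U : H1 D, IsInteriorSolution D σ g U ∧ boundaryValue U = q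

/-- `u` is a weak solution, with gradient `G` and trace `f` on `∂D`, of the exterior problem
`Δu = 0` in `ℝ² ∖ closure D`, `∂u/∂ν|₊ = g` on `∂D`, `u(x) = O(|x|⁻¹)` as `|x| → ∞`. The normal
`ν` points out of `D`, so the boundary term in Green's formula for the exterior carries a minus
sign. Both `u` and `G` are square integrable on bounded parts of the exterior. -/
structure IsExteriorSolution (D : Set Plane) (g : StrongDual ℝ (HHalf D)) (u : Plane → ℝ)
    (G : Plane → Plane) (f : Lp ℝ 2 (arcLength (frontier D))) : Prop where
  locallyH1 : ∀ R : ℝ, closure D ⊆ Metric.ball 0 R →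
    ∃ U : H1 (Metric.ball 0 R \ closure D),
      fnOf U =ᵐ[volume.restrict (Metric.ball 0 R \ closure D)] u ∧
      gradOf U =ᵐ[volume.restrict (Metric.ball 0 R \ closure D)] G ∧
      (U, f) ∈ traceGraph (Metric.ball 0 R \ closure D) (frontier D)
  weak : ∀ φ : Plane → ℝ, IsTestFun φ → ∀ V : H1 D, fnOf V =ᵐ[volume.restrict D] φ →
    ∫ x in (closure D)ᶜ, inner ℝ (G x) (gradient φ x) = - g (boundaryValue V)
  decay : u =O[cobounded Plane] fun x => ‖x‖⁻¹

/-- The bounded operator `Λ : H^{-1/2}_0(∂D) → H^{1/2}_0(∂D)` is the exterior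
Neumann-to-Dirichlet map: for every `g`, the boundary value on `∂D` of a solution of the exterior
problem with data `g`, less its average over `∂D`, exists, is unique, and is `Λ g`. -/
def IsExteriorNtD (D : Set Plane) (Λ : HNegHalf0 D →L[ℝ] HHalf0 D) : Prop :=
  ∀ (g : HNegHalf0 D) (q : HHalf0 D), Λ g = q ↔
    ∃ (u : Plane → ℝ) (G : Plane → Plane) (f f₀ : Lp ℝ 2 (arcLength (frontier D))) (V : H1 D),
      IsExteriorSolution D g u G f ∧
      f₀ =ᵐ[arcLength (frontier D)] (fun x => f x - ⨍ y, f y ∂(arcLength (frontier D))) ∧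
      (V, f₀) ∈ traceGraph D (frontier D) ∧ boundaryValue V = q

open Classical in
/-- The Neumann-to-Dirichlet map `Λ_σ` (zero if there is none). -/
def ntd (D : Set Plane) (σ : Plane → ℝ) : HNegHalf0 D →L[ℝ] HHalf0 D :=
  if h : ∃ Λ, IsNtD D σ Λ then h.choose else 0

open Classical in
/-- The exterior Neumann-to-Dirichlet map `Λᵉ` (zero if there is none). -/
def exteriorNtd (D : Set Plane) : HNegHalf0 D →L[ℝ] HHalf0 D :=
  if h : ∃ Λ, IsExteriorNtD D Λ then h.choose else 0

/-- The operator of generalized polarization tensors,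
`M_σ = Λ₁⁻¹ (Λ₁ - Λ_σ) (Λ_σ - Λᵉ)⁻¹ (Λ₁ - Λᵉ)`. -/
def gptOp (D : Set Plane) (σ : Plane → ℝ) : HNegHalf0 D →L[ℝ] HNegHalf0 D :=
  (ntd D fun _ => 1).inverse ∘L (ntd D (fun _ => 1) - ntd D σ) ∘L
    (ntd D σ - exteriorNtd D).inverse ∘L (ntd D (fun _ => 1) - exteriorNtd D)

end

/-!
The theorem is a statement about three operators `Λ_σ`, `Λ₁`, `Λᵉ` between dual Hilbert spaces, and
it follows from two facts: the operators exist and are bounded, `Λ_σ` with a bound that depends on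
`D` and `c` only; and, in the pairing of `H^{-1/2}_0(∂D)` with `H^{1/2}_0(∂D)`, the map `Λ_σ` is
coercive, uniformly in `σ`, while `Λᵉ` is nonpositive. Indeed `⟨g, Λ_σ g⟩` and `-⟨g, Λᵉ g⟩` are the
energies of the solutions. Hence `Λ_σ` and `A_σ = Λ_σ - Λᵉ` are coercive with a constant
`κ = c⁻³`, so they are invertible with inverses of norm at most `κ⁻¹` (`exists_equiv_of_coercive`,
a form of the Lax–Milgram lemma). Since `Λ₁ - Λ_σ = A₁ - A_σ`, one has
`M_σ = Λ₁⁻¹ A₁ A_σ⁻¹ A₁ - Λ₁⁻¹ A₁`, and the resolvent identity turns a difference of two `M_σ` into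
a difference of two `Λ_σ` composed with invertible operators that are bounded uniformly, in both
directions (`inverse_comp_sub_eq`, `sub_eq_comp_comp`).

The work lies in the existence of the operators. The boundary is only used through the fact that
near each of its points `D` is the region above the graph of a `C¹` function.

* Traces. The trace inequality on test functions, proved in graph coordinates
  (`exists_trace_inequality`), and the density of test functions in `H¹(D)` (`dense_testSubspace`)
  show that the closure of the pairs of a test function and its boundary values is the graph of a
  bounded operator on `H¹(D)`. Density is proved by a partition of unity: near a boundary point
  where the cone condition holds, a function is translated along the axis of the cone and mollified
  at a smaller scale, so that only its values in `D` are used (`exists_isTestFun_near`).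
* Poincaré inequalities. The inequality holds on sets that are star-shaped with respect to a ball
  (`PoincareIn.of_star`), and the cone condition provides such sets near every point
  (`ConeAt.poincareIn`). It passes to unions of two sets that meet (`PoincareIn.union`), hence to
  bounded parts of a connected set (`exists_poincareIn`). This serves both `D` and its exterior.
* Interior problem. By the Poincaré inequality, the energy plus the square of the boundary mean is
  coercive on `H¹(D)`, which gives the solution and its bound (`exists_neumann_solution`,
  `exists_isNtD`).
* Exterior problem. A reflection across the graphs extends functions from the exterior into `D`, so
  boundary values, in the norm of `H^{1/2}(∂D)`, are controlled by the exterior `H¹` norm and, up to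
  constants, by the exterior energy (`exists_exterior_poincare`). The Riesz representation theorem,
  in the closure of the gradients of test functions, gives a solution of finite energy, determined
  up to a constant (`exists_finite_energy_solution`).
* Behaviour at infinity. The mollifications `h` of a finite energy solution are harmonic near
  infinity, so that `f = ∂₁h - i∂₂h` is holomorphic there and square integrable. The mean value
  inequality on discs then shows that `|z||f(z)|` is bounded by the energy and tends to zero.
  Therefore `f(1/w)/w` has a removable singularity at the origin and vanishes there, and Schwarz's
  lemma gives `f(z) = O(|z|⁻²)` with a constant that only involves the energy
  (`norm_le_div_sq_of_lintegral_le`). Integrating along the curves `1/z`, `z` in a segment, one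
  finds a constant `c∞` with `u - c∞ = O(|x|⁻¹)` (`exists_abs_sub_le_mul_inv_norm`), and `u - c∞` is
  the solution sought.
* Uniqueness in the exterior. For a solution `u` of the homogeneous problem and cutoff functions `χ`
  at scale `R`, testing with `χ²u` bounds the energy of `χu` by `∫ u²|∇χ|² = O(R⁻²)`. As the energy
  of `χu` controls the trace up to constants, the trace is constant
  (`trace_eq_of_isExteriorSolution_zero`).
-/

open scoped ENNReal

noncomputable section

theorem enorm_sq_eq_lintegral {α E : Type*} [MeasurableSpace α] [NormedAddCommGroup E]
    {μ : Measure α} (f : Lp E 2 μ) : ‖f‖ₑ ^ 2 = ∫⁻ x, ‖f x‖ₑ ^ 2 ∂μ := by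
  rw [Lp.enorm_def, eLpNorm_eq_lintegral_rpow_enorm_toReal (by norm_num) (by norm_num)]
  simp only [ENNReal.toReal_ofNat, ENNReal.rpow_ofNat, one_div]
  rw [← ENNReal.rpow_natCast, ← ENNReal.rpow_mul]
  norm_num

theorem H1.enorm_sq {Ω : Set Plane} (U : H1 Ω) :
    ‖U‖ₑ ^ 2 = (∫⁻ x in Ω, ‖fnOf U x‖ₑ ^ 2) + ∫⁻ x in Ω, ‖gradOf U x‖ₑ ^ 2 := by
  rw [← enorm_sq_eq_lintegral, ← enorm_sq_eq_lintegral]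
  have h := WithLp.prod_norm_sq_eq_of_L2 (U : L2Pair Ω)
  have e : ∀ {E : Type} [NormedAddCommGroup E] (x : E), ‖x‖ₑ ^ 2 = ENNReal.ofReal (‖x‖ ^ 2) := by
    intro E _ x
    rw [← ofReal_norm, ENNReal.ofReal_pow (norm_nonneg _)]
  rw [e, e, e, ← ENNReal.ofReal_add (by positivity) (by positivity)]
  exact congrArg _ h

theorem H1.norm_sq {Ω : Set Plane} (U : H1 Ω) : ‖U‖ ^ 2 = ‖fnOf U‖ ^ 2 + ‖gradOf U‖ ^ 2 :=
  WithLp.prod_norm_sq_eq_of_L2 (U : L2Pair Ω)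

theorem H1.norm_fnOf_le {Ω : Set Plane} (U : H1 Ω) : ‖fnOf U‖ ≤ ‖U‖ := by
  have := H1.norm_sq U
  nlinarith [norm_nonneg U, norm_nonneg (fnOf U), sq_nonneg ‖gradOf U‖]

theorem H1.norm_gradOf_le {Ω : Set Plane} (U : H1 Ω) : ‖gradOf U‖ ≤ ‖U‖ := by
  have := H1.norm_sq U
  nlinarith [norm_nonneg U, norm_nonneg (gradOf U), sq_nonneg ‖fnOf U‖]

/-- `U ↦ u` as a bounded operator. -/
def fnOfL (Ω : Set Plane) : H1 Ω →L[ℝ] Lp ℝ 2 (volume.restrict Ω) :=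
  LinearMap.mkContinuous
    { toFun := fnOf, map_add' := fun _ _ => rfl, map_smul' := fun _ _ => rfl } 1
    (fun U => (H1.norm_fnOf_le U).trans_eq (one_mul _).symm)

/-- `U ↦ ∇u` as a bounded operator. -/
def gradOfL (Ω : Set Plane) : H1 Ω →L[ℝ] Lp Plane 2 (volume.restrict Ω) :=
  LinearMap.mkContinuous
    { toFun := gradOf, map_add' := fun _ _ => rfl, map_smul' := fun _ _ => rfl } 1
    (fun U => (H1.norm_gradOf_le U).trans_eq (one_mul _).symm)

@[simp] theorem gradOfL_apply {Ω : Set Plane} (U : H1 Ω) : gradOfL Ω U = gradOf U := rfl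

theorem integral_mul_eq_inner {Ω : Set Plane} {ψ : Plane → ℝ}
    (hψ : MemLp ψ 2 (volume.restrict Ω)) (f : Lp ℝ 2 (volume.restrict Ω)) :
    ∫ x in Ω, f x * ψ x = inner ℝ (hψ.toLp ψ) f := by
  rw [L2.inner_def]
  refine integral_congr_ae ?_
  filter_upwards [hψ.coeFn_toLp] with x hx
  simp [hx]

theorem integral_inner_eq_inner {Ω : Set Plane} {F : Plane → Plane}
    (hF : MemLp F 2 (volume.restrict Ω)) (f : Lp Plane 2 (volume.restrict Ω)) :
    ∫ x in Ω, inner ℝ (f x) (F x) = inner ℝ f (hF.toLp F) := by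
  rw [L2.inner_def]
  refine integral_congr_ae ?_
  filter_upwards [hF.coeFn_toLp] with x hx
  simp [hx]

theorem IsTestFun.memLp_smul_const {φ : Plane → ℝ} (h : IsTestFun φ) (w : Plane)
    (μ : Measure Plane) [IsFiniteMeasureOnCompacts μ] : MemLp (fun x => φ x • w) 2 μ :=
  (h.continuous.smul continuous_const).memLp_of_hasCompactSupport h.2.smul_right

theorem isClosed_H1 (Ω : Set Plane) : IsClosed (H1 Ω : Set (L2Pair Ω)) := by
  have : (H1 Ω : Set (L2Pair Ω)) = ⋂ (φ : Plane → ℝ) (_ : IsTestFun φ) (_ : tsupport φ ⊆ Ω)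
      (w : Plane), {U | ∫ x in Ω, U.fst x * fderiv ℝ φ x w
        = - ∫ x in Ω, φ x * inner ℝ (U.snd x) w} := by
    ext U; simp [H1]
  rw [this]
  refine isClosed_iInter fun φ => isClosed_iInter fun hφ => isClosed_iInter fun _ =>
    isClosed_iInter fun w => ?_
  have e2 : ∀ U : L2Pair Ω, ∫ x in Ω, φ x * inner ℝ (U.snd x) w
      = inner ℝ U.snd ((hφ.memLp_smul_const w (volume.restrict Ω)).toLp _) := by
    intro U
    rw [← integral_inner_eq_inner]
    simp only [inner_smul_right]
  simp only [integral_mul_eq_inner (hφ.memLp_fderiv w _), e2]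
  refine isClosed_eq ?_ ?_
  · exact continuous_const.inner (WithLp.prod_continuous_ofLp _ _ _).fst
  · exact ((WithLp.prod_continuous_ofLp _ _ _).snd.inner continuous_const).neg

instance (Ω : Set Plane) : CompleteSpace (H1 Ω) := (isClosed_H1 Ω).completeSpace_coe

/-- Continuously differentiable compactly supported real functions on the plane. -/
def IsC1Fun (φ : Plane → ℝ) : Prop := ContDiff ℝ 1 φ ∧ HasCompactSupport φ

theorem IsTestFun.isC1Fun {φ : Plane → ℝ} (h : IsTestFun φ) : IsC1Fun φ :=
  ⟨h.1.of_le (by simp), h.2⟩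

namespace IsC1Fun

variable {φ ψ : Plane → ℝ}

theorem continuous (h : IsC1Fun φ) : Continuous φ := h.1.continuous

theorem differentiable (h : IsC1Fun φ) : Differentiable ℝ φ := h.1.differentiable (by simp)

theorem memLp (h : IsC1Fun φ) (μ : Measure Plane) [IsFiniteMeasureOnCompacts μ] : MemLp φ 2 μ :=
  h.continuous.memLp_of_hasCompactSupport h.2

theorem continuous_gradient (h : IsC1Fun φ) : Continuous (gradient φ) :=
  (InnerProductSpace.toDual ℝ Plane).symm.continuous.comp (h.1.continuous_fderiv (by simp))

theorem hasCompactSupport_gradient (h : IsC1Fun φ) : HasCompactSupport (gradient φ) :=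
  (h.2.fderiv (𝕜 := ℝ)).comp_left (map_zero (InnerProductSpace.toDual ℝ Plane).symm)

theorem memLp_gradient (h : IsC1Fun φ) (μ : Measure Plane) [IsFiniteMeasureOnCompacts μ] :
    MemLp (gradient φ) 2 μ :=
  h.continuous_gradient.memLp_of_hasCompactSupport h.hasCompactSupport_gradient

theorem add (h : IsC1Fun φ) (h' : IsC1Fun ψ) : IsC1Fun (φ + ψ) := ⟨h.1.add h'.1, h.2.add h'.2⟩
theorem sub (h : IsC1Fun φ) (h' : IsC1Fun ψ) : IsC1Fun (φ - ψ) :=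
  ⟨h.1.sub h'.1, h.2.sub h'.2⟩
theorem smul (a : ℝ) (h : IsC1Fun φ) : IsC1Fun (a • φ) :=
  ⟨h.1.const_smul a, h.2.smul_left (f := fun _ => a)⟩
end IsC1Fun

theorem inner_gradient (φ : Plane → ℝ) (x w : Plane) :
    inner ℝ (gradient φ x) w = fderiv ℝ φ x w := by
  simp [gradient]

theorem enorm_gradient (φ : Plane → ℝ) (x : Plane) : ‖gradient φ x‖ₑ = ‖fderiv ℝ φ x‖ₑ := by
  rw [← ofReal_norm, ← ofReal_norm, gradient, LinearIsometryEquiv.norm_map]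

/-- Integration by parts for a `C¹` function against a test function supported in `Ω`. -/
theorem integral_mul_fderiv_of_tsupport_subset {Ω : Set Plane} {φ ψ : Plane → ℝ} (h : IsC1Fun φ)
    (hψ : IsTestFun ψ) (hs : tsupport ψ ⊆ Ω) (w : Plane) :
    ∫ x in Ω, φ x * fderiv ℝ ψ x w = - ∫ x in Ω, ψ x * fderiv ℝ φ x w := by
  rw [setIntegral_eq_integral_of_forall_compl_eq_zero,
    setIntegral_eq_integral_of_forall_compl_eq_zero]
  · have hc : Continuous fun x => fderiv ℝ ψ x w :=
      (hψ.1.continuous_fderiv (by simp)).clm_apply continuous_const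
    have hc' : Continuous fun x => fderiv ℝ φ x w :=
      (h.1.continuous_fderiv (by simp)).clm_apply continuous_const
    rw [integral_mul_fderiv_eq_neg_fderiv_mul_of_integrable (μ := volume) _ _ _
      (fun x _ => h.differentiable x) (fun x _ => hψ.1.differentiable (by simp) x)]
    · simp only [mul_comm]
    · exact (hc'.mul hψ.continuous).integrable_of_hasCompactSupport hψ.2.mul_left
    · exact (h.continuous.mul hc).integrable_of_hasCompactSupport h.2.mul_right
    · exact (h.continuous.mul hψ.continuous).integrable_of_hasCompactSupport h.2.mul_right
  · intro x hx
    rw [image_eq_zero_of_notMem_tsupport (fun h' => hx (hs h')), zero_mul]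
  · intro x hx
    rw [image_eq_zero_of_notMem_tsupport
      (fun h' => hx (hs (tsupport_fderiv_subset (𝕜 := ℝ) h'))), zero_apply,
      mul_zero]

/-- A compactly supported `C¹` function as an element of `H¹(Ω)`. -/
def H1.ofC1 (Ω : Set Plane) {φ : Plane → ℝ} (h : IsC1Fun φ) : H1 Ω :=
  ⟨WithLp.toLp 2 ((h.memLp _).toLp φ, (h.memLp_gradient _).toLp (gradient φ)), by
    intro ψ hψ hs w
    have e1 := (h.memLp (volume.restrict Ω)).coeFn_toLp
    have e2 := (h.memLp_gradient (volume.restrict Ω)).coeFn_toLp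
    calc _ = ∫ x in Ω, φ x * fderiv ℝ ψ x w := by
          refine integral_congr_ae ?_
          filter_upwards [e1] with x hx
          simp [hx]
      _ = - ∫ x in Ω, ψ x * fderiv ℝ φ x w := integral_mul_fderiv_of_tsupport_subset h hψ hs w
      _ = _ := by
          congr 1
          refine integral_congr_ae ?_
          filter_upwards [e2] with x hx
          simp [hx]⟩

theorem fnOf_ofC1 (Ω : Set Plane) {φ : Plane → ℝ} (h : IsC1Fun φ) :
    fnOf (H1.ofC1 Ω h) =ᵐ[volume.restrict Ω] φ := (h.memLp (volume.restrict Ω)).coeFn_toLp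

theorem gradOf_ofC1 (Ω : Set Plane) {φ : Plane → ℝ} (h : IsC1Fun φ) :
    gradOf (H1.ofC1 Ω h) =ᵐ[volume.restrict Ω] gradient φ :=
  (h.memLp_gradient (volume.restrict Ω)).coeFn_toLp

theorem enorm_ofC1_sq (Ω : Set Plane) {φ : Plane → ℝ} (h : IsC1Fun φ) :
    ‖H1.ofC1 Ω h‖ₑ ^ 2 = (∫⁻ x in Ω, ‖φ x‖ₑ ^ 2) + ∫⁻ x in Ω, ‖fderiv ℝ φ x‖ₑ ^ 2 := by
  rw [H1.enorm_sq]
  congr 1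
  · refine lintegral_congr_ae ?_
    filter_upwards [fnOf_ofC1 Ω h] with x hx
    rw [hx]
  · refine lintegral_congr_ae ?_
    filter_upwards [gradOf_ofC1 Ω h] with x hx
    rw [hx, enorm_gradient]

/-- A weak gradient is determined by the function. -/
theorem H1.ext_fnOf {Ω : Set Plane} (hΩ : IsOpen Ω) {U V : H1 Ω}
    (h : fnOf U =ᵐ[volume.restrict Ω] fnOf V) : U = V := by
  suffices hz : ∀ W : H1 Ω, fnOf W =ᵐ[volume.restrict Ω] 0 → W = 0 by
    refine sub_eq_zero.1 (hz (U - V) ?_)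
    have := Lp.coeFn_sub (fnOf U) (fnOf V)
    refine (this.trans ?_ : fnOf (U - V) =ᵐ[volume.restrict Ω] 0)
    filter_upwards [h] with x hx
    simp [hx]
  intro W hW
  have hf : fnOf W = 0 := (Lp.eq_zero_iff_ae_eq_zero).2 hW
  have hcoord : ∀ w : Plane, ∀ᵐ x, x ∈ Ω → inner ℝ (gradOf W x) w = 0 := by
    intro w
    refine IsOpen.ae_eq_zero_of_integral_contDiff_smul_eq_zero hΩ ?_ ?_
    · refine locallyIntegrableOn_of_locallyIntegrable_restrict ?_
      exact (((Lp.memLp (gradOf W)).inner_const w).locallyIntegrable (by norm_num))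
    · intro φ hφ hc hs
      have h1 := W.2 φ ⟨hφ, hc⟩ hs w
      have h2 : ∫ x in Ω, (W : L2Pair Ω).fst x * fderiv ℝ φ x w = 0 := by
        refine integral_eq_zero_of_ae ?_
        filter_upwards [hW] with x hx
        have : (W : L2Pair Ω).fst x = 0 := hx
        simp [this]
      rw [h2] at h1
      have h3 : ∫ x in Ω, φ x * inner ℝ (gradOf W x) w = 0 := by
        have : ∫ x in Ω, φ x * inner ℝ ((W : L2Pair Ω).snd x) w = 0 := by linarith
        exact this
      rw [← h3]
      symm
      refine setIntegral_eq_integral_of_forall_compl_eq_zero ?_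
      intro x hx
      rw [image_eq_zero_of_notMem_tsupport (fun h' => hx (hs h')), zero_mul]
  have hg : gradOf W = 0 := by
    refine (Lp.eq_zero_iff_ae_eq_zero).2 ?_
    refine (ae_restrict_iff' hΩ.measurableSet).2 ?_
    filter_upwards [hcoord (EuclideanSpace.single 0 1), hcoord (EuclideanSpace.single 1 1)]
      with x h0 h1 hx
    ext i
    fin_cases i
    · simpa [EuclideanSpace.inner_single_right] using h0 hx
    · simpa [EuclideanSpace.inner_single_right] using h1 hx
  refine norm_eq_zero.1 ?_
  have := H1.norm_sq W
  rw [hf, hg] at this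
  simpa using this

theorem H1.eq_ofC1 {Ω : Set Plane} (hΩ : IsOpen Ω) {U : H1 Ω} {φ : Plane → ℝ} (h : IsC1Fun φ)
    (hU : fnOf U =ᵐ[volume.restrict Ω] φ) : U = H1.ofC1 Ω h :=
  H1.ext_fnOf hΩ (hU.trans (fnOf_ofC1 Ω h).symm)

/-- A smooth cutoff function equal to one near a given bounded set. -/
theorem exists_isTestFun_eq_one (R : ℝ) : ∃ χ : Plane → ℝ, IsTestFun χ ∧
    (∀ x, ‖x‖ ≤ R → χ x = 1) ∧ (∀ x, χ x ∈ Icc (0 : ℝ) 1) := by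
  let b : ContDiffBump (0 : Plane) := ⟨|R| + 1, |R| + 2, by positivity, by linarith⟩
  refine ⟨b, ⟨b.contDiff, b.hasCompactSupport⟩, fun x hx => ?_, fun x => ⟨b.nonneg, b.le_one⟩⟩
  refine b.one_of_mem_closedBall ?_
  simp only [Metric.mem_closedBall, dist_zero_right]
  exact hx.trans ((le_abs_self R).trans (by simp [b]))

/-! ### Graph coordinates at the boundary -/

/-- The upward unit vector of the plane. -/
def up : Plane := EuclideanSpace.single 1 1

@[simp] theorem up_zero : up 0 = 0 := by simp [up]
@[simp] theorem up_one : up 1 = 1 := by simp [up]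
@[simp] theorem norm_up : ‖up‖ = 1 := by simp [up]

/-- In the ball `B(p, r)`, and in the Cartesian coordinates `L`, the set `Γ` is the graph of the
`C¹` function `γ`, which is Lipschitz there, and `Ω` is the region above it. -/
structure IsGraphAt (Ω Γ : Set Plane) (p : Plane) (r : ℝ) (L : Plane ≃ₗᵢ[ℝ] Plane) (γ : ℝ → ℝ)
    (K : ℝ≥0) : Prop where
  pos : 0 < r
  smooth : ContDiff ℝ 1 γ
  lip : LipschitzOnWith K γ (Metric.ball (L p 0) r)
  mem_iff : ∀ x ∈ Metric.ball p r, x ∈ Ω ↔ γ (L x 0) < L x 1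
  mem_bdry_iff : ∀ x ∈ Metric.ball p r, x ∈ Γ ↔ L x 1 = γ (L x 0)

theorem abs_coord_sub_le (L : Plane ≃ₗᵢ[ℝ] Plane) (x y : Plane) (i : Fin 2) :
    |L x i - L y i| ≤ ‖x - y‖ := by
  have h : ‖(L (x - y)) i‖ ≤ ‖L (x - y)‖ := PiLp.norm_apply_le _ i
  rw [LinearIsometryEquiv.norm_map, map_sub] at h
  simpa using h

theorem norm_le_abs_add_abs (x : Plane) : ‖x‖ ≤ |x 0| + |x 1| := by
  rw [EuclideanSpace.norm_eq, Fin.sum_univ_two]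
  refine Real.sqrt_le_iff.2 ⟨by positivity, ?_⟩
  simp only [Real.norm_eq_abs]
  nlinarith [abs_nonneg (x 0), abs_nonneg (x 1)]

theorem continuous_coord (L : Plane ≃ₗᵢ[ℝ] Plane) (i : Fin 2) : Continuous fun x => L x i := by
  fun_prop

/-- Reflection of the plane in the first coordinate axis. -/
def flip2 : Plane ≃ₗᵢ[ℝ] Plane :=
  LinearIsometryEquiv.piLpCongrRight 2
    (fun i => if i = 0 then LinearIsometryEquiv.refl ℝ ℝ else LinearIsometryEquiv.neg ℝ)

@[simp] theorem flip2_zero (x : Plane) : flip2 x 0 = x 0 := by simp [flip2]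
@[simp] theorem flip2_one (x : Plane) : flip2 x 1 = - x 1 := by simp [flip2]

section Sides

variable {η : ℝ≥0} {D : Set Plane}

/-- A set that lies strictly above a graph near `p` has, near `p`, the points on or above the graph as
its closure. -/
theorem mem_closure_iff_of_graph {D : Set Plane} {p : Plane} {r : ℝ}
    (L : Plane ≃ₗᵢ[ℝ] Plane) {γ : ℝ → ℝ} (hγ : ContDiff ℝ 1 γ)
    (hD : ∀ x ∈ Metric.ball p r, x ∈ D ↔ γ (L x 0) < L x 1) :
    ∀ x ∈ Metric.ball p r, x ∈ closure D ↔ γ (L x 0) ≤ L x 1 := by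
  intro x hx
  constructor
  · intro hc
    by_contra hlt
    push Not at hlt
    have hopen : IsOpen {y : Plane | L y 1 < γ (L y 0)} :=
      isOpen_lt (continuous_coord L 1) (hγ.continuous.comp (continuous_coord L 0))
    obtain ⟨y, ⟨hy1, hy2⟩, hy3⟩ :=
      mem_closure_iff.1 hc _ (hopen.inter Metric.isOpen_ball) ⟨hlt, hx⟩
    exact absurd ((hD y hy2).1 hy3) (not_lt.2 (le_of_lt hy1))
  · intro hle
    have hcont : Continuous fun t : ℝ => x + t • L.symm up := by fun_prop
    have ht : Tendsto (fun t : ℝ => x + t • L.symm up) (𝓝[>] 0) (𝓝 x) := by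
      have := hcont.tendsto 0
      simp only [zero_smul, add_zero] at this
      exact this.mono_left nhdsWithin_le_nhds
    refine mem_closure_of_tendsto ht ?_
    filter_upwards [ht (Metric.isOpen_ball.mem_nhds hx), self_mem_nhdsWithin] with t h1 h2
    refine (hD _ h1).2 ?_
    have h2' : (0 : ℝ) < t := h2
    simp
    linarith

/-- Near a boundary point, the domain and its exterior lie on the two sides of one graph. -/
theorem IsHolderDomain.exists_isGraphAt (hD : IsHolderDomain η D) {p : Plane}
    (hp : p ∈ frontier D) : ∃ r L γ K, IsGraphAt D (frontier D) p r L γ K ∧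
      IsGraphAt (closure D)ᶜ (frontier D) p r (L.trans flip2) (-γ) K := by
  obtain ⟨r, hr, L, γ, _, hγ, -, h⟩ := hD.boundary p hp
  have hcl := mem_closure_iff_of_graph L hγ h
  obtain ⟨K, t, ht, hK⟩ := (hγ.contDiffAt (x := L p 0)).exists_lipschitzOnWith
  obtain ⟨ρ, hρ, hρt⟩ := Metric.mem_nhds_iff.1 ht
  have hb : Metric.ball p (min r ρ) ⊆ Metric.ball p r := Metric.ball_subset_ball (min_le_left _ _)
  have hl : LipschitzOnWith K γ (Metric.ball (L p 0) (min r ρ)) :=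
    hK.mono ((Metric.ball_subset_ball (min_le_right _ _)).trans hρt)
  have hfr : ∀ x ∈ Metric.ball p (min r ρ), x ∈ frontier D ↔ L x 1 = γ (L x 0) := by
    intro x hx
    rw [hD.isOpen.frontier_eq, Set.mem_sdiff, hcl x (hb hx), h x (hb hx)]
    constructor
    · rintro ⟨h1, h2⟩; linarith
    · intro h; rw [h]; simp
  refine ⟨min r ρ, L, γ, K, ⟨lt_min hr hρ, hγ, hl, fun x hx => h x (hb hx), hfr⟩,
    ⟨lt_min hr hρ, hγ.neg, ?_, ?_, ?_⟩⟩
  · have := hl.neg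
    simpa using this
  · intro x hx
    rw [mem_compl_iff, hcl x (hb hx)]
    simp
  · intro x hx
    rw [hfr x hx]
    simp

theorem isCompact_frontier (hD : IsHolderDomain η D) : IsCompact (frontier D) :=
  Metric.isCompact_of_isClosed_isBounded isClosed_frontier
    (hD.isBounded.closure.subset frontier_subset_closure)

theorem frontier_nonempty (hD : IsHolderDomain η D) : (frontier D).Nonempty := by
  rw [nonempty_iff_ne_empty, Ne, frontier_eq_empty_iff]
  rintro (h | h)
  · exact hD.isConnected.nonempty.ne_empty h
  · have := hD.isBounded
    rw [h] at this
    exact NormedSpace.unbounded_univ ℝ Plane this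

end Sides

/-! ### The cone condition -/

/-- `Ω` satisfies a uniform interior cone condition near `p`. -/
def ConeAt (Ω : Set Plane) (p : Plane) : Prop :=
  ∃ δ > 0, ∃ t₀ > 0, ∃ θ > 0, ∃ v : Plane, ∀ x ∈ Ω ∩ Metric.ball p δ, ∀ t ∈ Ioo (0 : ℝ) t₀,
    ∀ w : Plane, ‖w‖ < θ → x + t • (v + w) ∈ Ω

theorem coneAt_of_mem {Ω : Set Plane} (hΩ : IsOpen Ω) {p : Plane} (hp : p ∈ Ω) : ConeAt Ω p := by
  obtain ⟨r, hr, h⟩ := Metric.isOpen_iff.1 hΩ p hp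
  refine ⟨r / 2, by positivity, r / 2, by positivity, 1, one_pos, 0, ?_⟩
  rintro x ⟨-, hx⟩ t ht w hw
  refine h ?_
  rw [Metric.mem_ball, dist_eq_norm] at hx ⊢
  have h1 : ‖t • w‖ ≤ r / 2 := by
    rw [norm_smul, Real.norm_eq_abs, abs_of_pos ht.1]
    nlinarith [ht.1, ht.2, norm_nonneg w]
  calc ‖x + t • (0 + w) - p‖ = ‖(x - p) + t • w‖ := by congr 1; rw [zero_add]; abel
    _ ≤ ‖x - p‖ + ‖t • w‖ := norm_add_le _ _
    _ < r := by linarith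

/-- The cone about the upward axis with opening `1 / (K + 1)` stays above a `K`-Lipschitz graph. -/
theorem IsGraphAt.coneAt {Ω Γ : Set Plane} {p : Plane} {r : ℝ} {L : Plane ≃ₗᵢ[ℝ] Plane}
    {γ : ℝ → ℝ} {K : ℝ≥0} (h : IsGraphAt Ω Γ p r L γ K) : ConeAt Ω p := by
  have hr := h.pos
  have hK : (0 : ℝ) ≤ K := K.2
  refine ⟨r / 3, by positivity, r / 4, by positivity, 1 / (K + 1), by positivity, L.symm up, ?_⟩
  rintro x ⟨hxΩ, hx⟩ t ht w hw
  have hw1 : ‖w‖ * (K + 1) < 1 := by rwa [lt_div_iff₀ (by positivity)] at hw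
  have hw2 : ‖w‖ < 1 := by nlinarith [norm_nonneg w]
  have ht0 := ht.1
  have hd : ‖t • (L.symm up + w)‖ ≤ t * (1 + ‖w‖) := by
    rw [norm_smul, Real.norm_eq_abs, abs_of_pos ht0]
    have := norm_add_le (L.symm up) w
    rw [LinearIsometryEquiv.norm_map, norm_up] at this
    gcongr
  have hxr : x ∈ Metric.ball p r := Metric.ball_subset_ball (by linarith) hx
  have hyr : x + t • (L.symm up + w) ∈ Metric.ball p r := by
    rw [Metric.mem_ball, dist_eq_norm] at hx ⊢
    calc ‖x + t • (L.symm up + w) - p‖ = ‖(x - p) + t • (L.symm up + w)‖ := by congr 1; abel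
      _ ≤ ‖x - p‖ + ‖t • (L.symm up + w)‖ := norm_add_le _ _
      _ < r := by nlinarith [ht.2]
  have hball : ∀ y ∈ Metric.ball p r, L y 0 ∈ Metric.ball (L p 0) r := by
    intro y hy
    rw [Metric.mem_ball, dist_eq_norm] at hy ⊢
    exact (abs_coord_sub_le L y p 0).trans_lt hy
  have hlt := (h.mem_iff x hxr).1 hxΩ
  refine (h.mem_iff _ hyr).2 ?_
  have e0 : L (x + t • (L.symm up + w)) 0 = L x 0 + t * L w 0 := by simp
  have e1 : L (x + t • (L.symm up + w)) 1 = L x 1 + t * (1 + L w 1) := by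
    simp [mul_add]
  have hlip := h.lip.dist_le_mul _ (hball _ hyr) _ (hball _ hxr)
  rw [Real.dist_eq, Real.dist_eq, e0] at hlip
  have hw0 : |L w 0| ≤ ‖w‖ := by simpa using abs_coord_sub_le L w 0 0
  have hw1' : |L w 1| ≤ ‖w‖ := by simpa using abs_coord_sub_le L w 0 1
  have e2 : |L x 0 + t * L w 0 - L x 0| ≤ t * ‖w‖ := by
    rw [add_sub_cancel_left, abs_mul, abs_of_pos ht0]
    gcongr
  rw [e0, e1]
  have h3 := (abs_le.1 (hlip.trans (mul_le_mul_of_nonneg_left e2 hK))).2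
  have h4 := (abs_le.1 hw1').1
  nlinarith

theorem IsHolderDomain.coneAt {η : ℝ≥0} {D : Set Plane} (hD : IsHolderDomain η D) {p : Plane}
    (hp : p ∈ closure D) : ConeAt D p := by
  by_cases h : p ∈ D
  · exact coneAt_of_mem hD.isOpen h
  · obtain ⟨r, L, γ, K, h1, -⟩ := hD.exists_isGraphAt
      (p := p) (by rw [hD.isOpen.frontier_eq]; exact ⟨hp, h⟩)
    exact h1.coneAt

theorem IsHolderDomain.coneAt_ext {η : ℝ≥0} {D : Set Plane} (hD : IsHolderDomain η D) {p : Plane}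
    (hp : p ∈ closure (closure D)ᶜ) : ConeAt (closure D)ᶜ p := by
  by_cases h : p ∈ (closure D)ᶜ
  · exact coneAt_of_mem isClosed_closure.isOpen_compl h
  · have hpf : p ∈ frontier D := by
      refine frontier_closure_subset ?_
      rw [frontier_eq_closure_inter_closure]
      exact ⟨subset_closure (not_not.1 h), hp⟩
    obtain ⟨r, L, γ, K, -, h1⟩ := hD.exists_isGraphAt hpf
    exact h1.coneAt

/-! ### Arc length in graph coordinates -/

/-- The point with coordinates `(s, γ s + t)` in the Cartesian coordinates `L`. -/
def graphMap (L : Plane ≃ₗᵢ[ℝ] Plane) (γ : ℝ → ℝ) (s t : ℝ) : Plane := L.symm !₂[s, γ s + t]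

@[simp] theorem graphMap_zero (L : Plane ≃ₗᵢ[ℝ] Plane) (γ : ℝ → ℝ) (s t : ℝ) :
    L (graphMap L γ s t) 0 = s := by simp [graphMap]

@[simp] theorem graphMap_one (L : Plane ≃ₗᵢ[ℝ] Plane) (γ : ℝ → ℝ) (s t : ℝ) :
    L (graphMap L γ s t) 1 = γ s + t := by simp [graphMap]

theorem plane_ext (L : Plane ≃ₗᵢ[ℝ] Plane) {x y : Plane} (h0 : L x 0 = L y 0)
    (h1 : L x 1 = L y 1) : x = y := by
  apply L.injective
  ext i
  fin_cases i
  · exact h0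
  · exact h1

theorem graphMap_add (L : Plane ≃ₗᵢ[ℝ] Plane) (γ : ℝ → ℝ) (s t : ℝ) :
    graphMap L γ s 0 + t • L.symm up = graphMap L γ s t := by
  apply plane_ext L <;> simp

theorem continuous_graphMap (L : Plane ≃ₗᵢ[ℝ] Plane) {γ : ℝ → ℝ} (hγ : Continuous γ) :
    Continuous fun q : ℝ × ℝ => graphMap L γ q.1 q.2 := by
  unfold graphMap
  refine L.symm.continuous.comp ((PiLp.continuous_toLp 2 _).comp (continuous_pi fun i => ?_))
  fin_cases i
  · exact continuous_fst
  · exact (hγ.comp continuous_fst).add continuous_snd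

theorem measurePreserving_graphMap (L : Plane ≃ₗᵢ[ℝ] Plane) {γ : ℝ → ℝ} (hγ : Continuous γ) :
    MeasurePreserving (fun q : ℝ × ℝ => graphMap L γ q.1 q.2) volume volume := by
  have h1 : MeasurePreserving (fun q : ℝ × ℝ => (q.1, γ q.1 + q.2)) volume volume := by
    refine (MeasurePreserving.id (volume : Measure ℝ)).skew_product
      (g := fun s t => γ s + t) (μc := volume) (μd := volume) ?_ ?_
    · exact ((hγ.comp continuous_fst).add continuous_snd).measurable
    · exact ae_of_all _ fun s => map_add_left_eq_self volume (γ s)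
  have h2 := (volume_preserving_finTwoArrow ℝ).symm.comp h1
  have h3 := (PiLp.volume_preserving_toLp (Fin 2)).comp h2
  have h4 := L.symm.measurePreserving.comp h3
  have h5 : (fun q : ℝ × ℝ => graphMap L γ q.1 q.2) = L.symm ∘ WithLp.toLp 2 ∘
      MeasurableEquiv.finTwoArrow.symm ∘ fun q : ℝ × ℝ => (q.1, γ q.1 + q.2) := by
    funext q
    change L.symm !₂[q.1, γ q.1 + q.2] =
      L.symm (WithLp.toLp 2 (MeasurableEquiv.finTwoArrow.symm (q.1, γ q.1 + q.2)))
    congr 1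
  rw [h5]
  exact h4

theorem lipschitzOnWith_graphMap (L : Plane ≃ₗᵢ[ℝ] Plane) {γ : ℝ → ℝ} {K : ℝ≥0} {s : Set ℝ}
    (h : LipschitzOnWith K γ s) : LipschitzOnWith (1 + K) (fun x => graphMap L γ x 0) s := by
  refine LipschitzOnWith.of_dist_le_mul fun x hx y hy => ?_
  have h1 := h.dist_le_mul x hx y hy
  rw [Real.dist_eq, Real.dist_eq] at h1
  rw [dist_eq_norm, ← L.norm_map]
  refine (norm_le_abs_add_abs _).trans ?_
  rw [map_sub, PiLp.sub_apply, PiLp.sub_apply, graphMap_zero, graphMap_zero, graphMap_one,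
    graphMap_one, Real.dist_eq]
  simp only [add_zero, NNReal.coe_add, NNReal.coe_one]
  linarith

theorem arcLength_def (Γ : Set Plane) :
    arcLength Γ = (Measure.hausdorffMeasure 1 : Measure Plane).restrict Γ := rfl

/-- On a graph, arc length is at most a constant times the Lebesgue measure of the parameter. -/
theorem IsGraphAt.arcLength_le {Ω Γ : Set Plane} {p : Plane} {r : ℝ} {L : Plane ≃ₗᵢ[ℝ] Plane}
    {γ : ℝ → ℝ} {K : ℝ≥0} (h : IsGraphAt Ω Γ p r L γ K) :
    (arcLength Γ).restrict (Metric.ball p r) ≤ ((1 + K : ℝ≥0) : ℝ≥0∞) •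
      (volume.restrict (Metric.ball (L p 0) r)).map (fun s => graphMap L γ s 0) := by
  have hm : Measurable (fun s => graphMap L γ s 0) :=
    ((continuous_graphMap L h.smooth.continuous).comp (Continuous.prodMk_left 0)).measurable
  rw [Measure.le_iff]
  intro A hA
  rw [Measure.smul_apply, Measure.map_apply hm hA, Measure.restrict_apply (hm hA),
    Measure.restrict_apply hA, arcLength_def,
    Measure.restrict_apply (hA.inter Metric.isOpen_ball.measurableSet)]
  have hsub : A ∩ Metric.ball p r ∩ Γ ⊆ (fun s => graphMap L γ s 0) ''
      ((fun s => graphMap L γ s 0) ⁻¹' A ∩ Metric.ball (L p 0) r) := by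
    rintro x ⟨⟨hxA, hxb⟩, hxΓ⟩
    have hx := (h.mem_bdry_iff x hxb).1 hxΓ
    have he : graphMap L γ (L x 0) 0 = x := by
      apply plane_ext L <;> simp [hx]
    refine ⟨L x 0, ⟨?_, ?_⟩, he⟩
    · change graphMap L γ (L x 0) 0 ∈ A
      rwa [he]
    · rw [Metric.mem_ball, dist_eq_norm] at hxb ⊢
      exact (abs_coord_sub_le L x p 0).trans_lt hxb
  have hl := (lipschitzOnWith_graphMap L h.lip).mono
    (inter_subset_right (s := (fun s => graphMap L γ s 0) ⁻¹' A))
  have := hl.hausdorffMeasure_image_le (d := 1) zero_le_one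
  rw [ENNReal.rpow_one, hausdorffMeasure_real] at this
  exact (measure_mono hsub).trans this

theorem IsHolderDomain.arcLength_lt_top {η : ℝ≥0} {D : Set Plane} (hD : IsHolderDomain η D) :
    arcLength (frontier D) univ < ⊤ := by
  rw [arcLength_def, Measure.restrict_apply_univ]
  refine (isCompact_frontier hD).measure_lt_top_of_nhdsWithin fun p hp => ?_
  obtain ⟨r, L, γ, K, h, -⟩ := hD.exists_isGraphAt hp
  refine ⟨frontier D ∩ Metric.ball p r,
    inter_mem_nhdsWithin _ (Metric.ball_mem_nhds p h.pos), ?_⟩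
  have := (Measure.le_iff'.1 h.arcLength_le) univ
  rw [Measure.restrict_apply_univ, arcLength_def,
    Measure.restrict_apply Metric.isOpen_ball.measurableSet, inter_comm] at this
  refine this.trans_lt ?_
  rw [Measure.smul_apply]
  refine ENNReal.mul_lt_top ENNReal.coe_lt_top ?_
  have : IsFiniteMeasure (volume.restrict (Metric.ball (L p 0) r)) :=
    ⟨by rw [Measure.restrict_apply_univ]; exact measure_ball_lt_top⟩
  exact measure_lt_top (Measure.map _ _) univ

theorem IsHolderDomain.arcLength_pos {η : ℝ≥0} {D : Set Plane} (hD : IsHolderDomain η D) :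
    0 < arcLength (frontier D) univ := by
  rw [arcLength_def, Measure.restrict_apply_univ]
  obtain ⟨p, hp⟩ := frontier_nonempty hD
  obtain ⟨r, L, γ, K, h, -⟩ := hD.exists_isGraphAt hp
  have hc : Continuous fun s => graphMap L γ s 0 :=
    (continuous_graphMap L h.smooth.continuous).comp (Continuous.prodMk_left 0)
  have hpp : graphMap L γ (L p 0) 0 = p := by
    have := (h.mem_bdry_iff p (Metric.mem_ball_self h.pos)).1 hp
    apply plane_ext L <;> simp [this]
  have hn : (fun s => graphMap L γ s 0) ⁻¹' (Metric.ball p r) ∈ 𝓝 (L p 0) := by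
    refine hc.continuousAt.preimage_mem_nhds ?_
    rw [hpp]
    exact Metric.ball_mem_nhds p h.pos
  have hpos : 0 < (volume : Measure ℝ) ((fun s => graphMap L γ s 0) ⁻¹' (Metric.ball p r)) :=
    Measure.measure_pos_of_mem_nhds _ hn
  have hl : LipschitzWith 1 fun x : Plane => L x 0 :=
    LipschitzWith.of_dist_le_mul fun x y => by
      rw [Real.dist_eq, dist_eq_norm, NNReal.coe_one, one_mul]
      exact abs_coord_sub_le L x y 0
  have := hl.hausdorffMeasure_image_le (d := 1) zero_le_one (frontier D)
  rw [hausdorffMeasure_real, ENNReal.coe_one, ENNReal.one_rpow, one_mul] at this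
  refine hpos.trans_le ((measure_mono ?_).trans this)
  intro s hs
  exact ⟨graphMap L γ s 0, (h.mem_bdry_iff _ hs).2 (by simp), by simp⟩

/-! ### Trace inequality -/

theorem ennreal_add_sq_le (a b : ℝ≥0∞) : (a + b) ^ 2 ≤ 2 * (a ^ 2 + b ^ 2) := by
  have := ENNReal.rpow_add_le_mul_rpow_add_rpow a b (p := 2) (by norm_num)
  norm_num at this
  exact_mod_cast this

theorem enorm_add_sq_le {E : Type*} [NormedAddCommGroup E] (a b : E) :
    ‖a + b‖ₑ ^ 2 ≤ 2 * (‖a‖ₑ ^ 2 + ‖b‖ₑ ^ 2) :=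
  (pow_le_pow_left' (enorm_add_le a b) 2).trans (ennreal_add_sq_le _ _)

theorem enorm_sub_sq_le {E : Type*} [NormedAddCommGroup E] (a b : E) :
    ‖a - b‖ₑ ^ 2 ≤ 2 * (‖a‖ₑ ^ 2 + ‖b‖ₑ ^ 2) :=
  (pow_le_pow_left' (enorm_sub_le) 2).trans (ennreal_add_sq_le _ _)

/-- The Cauchy-Schwarz inequality with a weight. -/
theorem lintegral_mul_sq_le {α : Type*} [MeasurableSpace α] {μ : Measure α} {f k : α → ℝ≥0∞}
    (hf : AEMeasurable f μ) (hk : AEMeasurable k μ) :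
    (∫⁻ x, f x * k x ∂μ) ^ 2 ≤ (∫⁻ x, k x ∂μ) * ∫⁻ x, f x ^ 2 * k x ∂μ := by
  have hh := ENNReal.lintegral_mul_le_Lp_mul_Lq μ Real.HolderConjugate.two_two
    (f := fun x => k x ^ (1 / 2 : ℝ)) (g := fun x => f x * k x ^ (1 / 2 : ℝ))
    (hk.pow_const _) (hf.mul (hk.pow_const _))
  have e1 : ∀ x, ((fun x => k x ^ (1 / 2 : ℝ)) * fun x => f x * k x ^ (1 / 2 : ℝ)) x
      = f x * k x := by
    intro x
    simp only [Pi.mul_apply]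
    rw [mul_left_comm, ← ENNReal.rpow_add_of_nonneg _ _ (by norm_num) (by norm_num)]
    norm_num
  have e2 : ∀ a : ℝ≥0∞, (a ^ (1 / 2 : ℝ)) ^ (2 : ℝ) = a := by
    intro a
    rw [← ENNReal.rpow_mul]
    norm_num
  simp only [e1, ENNReal.mul_rpow_of_nonneg _ _ (zero_le_two (α := ℝ)), e2] at hh
  calc _ ≤ ((∫⁻ x, k x ∂μ) ^ (1 / 2 : ℝ) *
        (∫⁻ x, f x ^ (2 : ℝ) * k x ∂μ) ^ (1 / 2 : ℝ)) ^ 2 := pow_le_pow_left' hh 2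
    _ = _ := by
      rw [← ENNReal.rpow_natCast, Nat.cast_ofNat,
        ENNReal.mul_rpow_of_nonneg _ _ (zero_le_two (α := ℝ)), e2, e2]
      simp only [ENNReal.rpow_two]

theorem lintegral_sq_le {α : Type*} [MeasurableSpace α] {μ : Measure α} {f : α → ℝ≥0∞}
    (hf : AEMeasurable f μ) : (∫⁻ x, f x ∂μ) ^ 2 ≤ μ univ * ∫⁻ x, f x ^ 2 ∂μ := by
  simpa using lintegral_mul_sq_le hf (aemeasurable_const (b := (1 : ℝ≥0∞)))

theorem enorm_sub_le_lintegral_deriv {h : ℝ → ℝ} (hh : ContDiff ℝ 1 h) {b t : ℝ}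
    (ht : t ∈ Ioo 0 b) : ‖h t - h 0‖ₑ ≤ ∫⁻ s in Ioo 0 b, ‖deriv h s‖ₑ := by
  rw [← intervalIntegral.integral_deriv_eq_sub (fun x _ => (hh.differentiable (by simp)) x)
    ((hh.continuous_deriv (by simp)).intervalIntegrable _ _), intervalIntegral.integral_of_le ht.1.le]
  refine (enorm_integral_le_lintegral_enorm _).trans (lintegral_mono_set ?_)
  exact fun s hs => ⟨hs.1, hs.2.trans_lt ht.2⟩

theorem enorm_sub_sq_le_lintegral_deriv {h : ℝ → ℝ} (hh : ContDiff ℝ 1 h) {b t : ℝ} (hb : b ≤ 1)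
    (ht : t ∈ Ioo 0 b) : ‖h t - h 0‖ₑ ^ 2 ≤ ∫⁻ s in Ioo 0 b, ‖deriv h s‖ₑ ^ 2 := by
  refine (pow_le_pow_left' (enorm_sub_le_lintegral_deriv hh ht) 2).trans ?_
  refine (lintegral_sq_le ?_).trans ?_
  · exact (hh.continuous_deriv (by simp)).enorm.measurable.aemeasurable
  · rw [Measure.restrict_apply_univ, Real.volume_Ioo, sub_zero]
    exact (mul_le_mul_left (ENNReal.ofReal_le_one.2 hb) _).trans_eq (one_mul _)

/-- A one-dimensional trace inequality. -/
theorem enorm_sq_le_lintegral_Ioo {h : ℝ → ℝ} (hh : ContDiff ℝ 1 h) {b : ℝ} (hb0 : 0 < b)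
    (hb : b ≤ 1) : ‖h 0‖ₑ ^ 2 ≤
      ENNReal.ofReal b⁻¹ * (2 * ∫⁻ s in Ioo 0 b, (‖h s‖ₑ ^ 2 + ‖deriv h s‖ₑ ^ 2)) := by
  have hm1 : Measurable fun s => ‖h s‖ₑ ^ 2 := (hh.continuous.enorm.measurable).pow_const 2
  have h1 : ∫⁻ _ in Ioo 0 b, ‖h 0‖ₑ ^ 2 ≤
      2 * ∫⁻ s in Ioo 0 b, (‖h s‖ₑ ^ 2 + ‖deriv h s‖ₑ ^ 2) := by
    calc ∫⁻ _ in Ioo 0 b, ‖h 0‖ₑ ^ 2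
        ≤ ∫⁻ s in Ioo 0 b, 2 * (‖h s‖ₑ ^ 2 + ∫⁻ s in Ioo 0 b, ‖deriv h s‖ₑ ^ 2) := by
          refine setLIntegral_mono' measurableSet_Ioo fun t ht => ?_
          have := enorm_sub_sq_le (h t) (h t - h 0)
          rw [sub_sub_cancel] at this
          refine this.trans ?_
          gcongr
          exact enorm_sub_sq_le_lintegral_deriv hh hb ht
      _ = 2 * ((∫⁻ s in Ioo 0 b, ‖h s‖ₑ ^ 2) +
            (∫⁻ s in Ioo 0 b, ‖deriv h s‖ₑ ^ 2) * ENNReal.ofReal b) := by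
          rw [lintegral_const_mul' _ _ (by norm_num), lintegral_add_left hm1, setLIntegral_const,
            Real.volume_Ioo, sub_zero]
      _ ≤ 2 * ((∫⁻ s in Ioo 0 b, ‖h s‖ₑ ^ 2) + ∫⁻ s in Ioo 0 b, ‖deriv h s‖ₑ ^ 2) := by
          gcongr
          exact (mul_le_mul_right (ENNReal.ofReal_le_one.2 hb) _).trans_eq (mul_one _)
      _ = _ := by rw [lintegral_add_left hm1]
  rw [setLIntegral_const, Real.volume_Ioo, sub_zero] at h1
  calc ‖h 0‖ₑ ^ 2 = ENNReal.ofReal b⁻¹ * (‖h 0‖ₑ ^ 2 * ENNReal.ofReal b) := by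
        rw [mul_left_comm, ← ENNReal.ofReal_mul (by positivity), inv_mul_cancel₀ hb0.ne',
          ENNReal.ofReal_one, mul_one]
    _ ≤ _ := by gcongr

theorem IsC1Fun.measurable_enorm_sq {φ : Plane → ℝ} (h : IsC1Fun φ) :
    Measurable fun x => ‖φ x‖ₑ ^ 2 := (h.continuous.enorm.measurable).pow_const 2

theorem IsC1Fun.measurable_enorm_fderiv_sq {φ : Plane → ℝ} (h : IsC1Fun φ) :
    Measurable fun x => ‖fderiv ℝ φ x‖ₑ ^ 2 :=
  ((h.1.continuous_fderiv (by simp)).enorm.measurable).pow_const 2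

theorem IsC1Fun.hasDerivAt_line {φ : Plane → ℝ} (h : IsC1Fun φ) (x v : Plane) (t : ℝ) :
    HasDerivAt (fun t : ℝ => φ (x + t • v)) (fderiv ℝ φ (x + t • v) v) t := by
  have h1 : HasDerivAt (fun t : ℝ => x + t • v) v t := by
    simpa using ((hasDerivAt_id t).smul_const v).const_add x
  exact (h.differentiable _).hasFDerivAt.comp_hasDerivAt t h1

theorem IsC1Fun.enorm_deriv_line_le {φ : Plane → ℝ} (h : IsC1Fun φ) (x v : Plane) (t : ℝ) :
    ‖deriv (fun t : ℝ => φ (x + t • v)) t‖ₑ ≤ ‖fderiv ℝ φ (x + t • v)‖ₑ * ‖v‖ₑ := by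
  rw [(h.hasDerivAt_line x v t).deriv]
  exact ContinuousLinearMap.le_opENorm _ _

/-- The one-dimensional trace inequality on vertical segments, integrated along the graph. -/
theorem IsGraphAt.trace_inequality {Ω Γ : Set Plane} (hΩ : MeasurableSet Ω)
    {p : Plane} {r : ℝ} {L : Plane ≃ₗᵢ[ℝ] Plane} {γ : ℝ → ℝ} {K : ℝ≥0}
    (h : IsGraphAt Ω Γ p r L γ K) : ∃ C : ℝ≥0, ∀ φ : Plane → ℝ, IsC1Fun φ →
      ∫⁻ x in Γ ∩ Metric.ball p (r / 2), ‖φ x‖ₑ ^ 2 ∂(arcLength Γ) ≤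
        C * ((∫⁻ x in Ω, ‖φ x‖ₑ ^ 2) + ∫⁻ x in Ω, ‖fderiv ℝ φ x‖ₑ ^ 2) := by
  have hr := h.pos
  set b : ℝ := min 1 (r / 2) with hb
  have hb0 : 0 < b := lt_min one_pos (by positivity)
  refine ⟨(1 + K) * (Real.toNNReal b⁻¹ * 2), fun φ hφ => ?_⟩
  set F : Plane → ℝ≥0∞ := Ω.indicator fun x => ‖φ x‖ₑ ^ 2 + ‖fderiv ℝ φ x‖ₑ ^ 2 with hF
  have hFm : Measurable F :=
    (hφ.measurable_enorm_sq.add hφ.measurable_enorm_fderiv_sq).indicator hΩ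
  have hFi : ∫⁻ x, F x = (∫⁻ x in Ω, ‖φ x‖ₑ ^ 2) + ∫⁻ x in Ω, ‖fderiv ℝ φ x‖ₑ ^ 2 := by
    rw [hF, lintegral_indicator hΩ, lintegral_add_left hφ.measurable_enorm_sq]
  set Φ : Plane → ℝ≥0∞ := fun x =>
    ENNReal.ofReal b⁻¹ * (2 * ∫⁻ t : ℝ, F (x + t • L.symm up)) with hΦ
  have hΦm : Measurable Φ := by
    refine (Measurable.const_mul ?_ _).const_mul _
    exact Measurable.lintegral_prod_right' (f := fun q : Plane × ℝ => F (q.1 + q.2 • L.symm up))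
      (hFm.comp (by fun_prop))
  have hpt : ∀ x ∈ Γ ∩ Metric.ball p (r / 2), ‖φ x‖ₑ ^ 2 ≤ Φ x := by
    rintro x ⟨hxΓ, hx⟩
    have hxr : x ∈ Metric.ball p r := Metric.ball_subset_ball (by linarith) hx
    have hg := (h.mem_bdry_iff x hxr).1 hxΓ
    have hC1 : ContDiff ℝ 1 fun t : ℝ => φ (x + t • L.symm up) :=
      hφ.1.comp (contDiff_const.add (contDiff_id.smul contDiff_const))
    have h1 := enorm_sq_le_lintegral_Ioo hC1 hb0 (min_le_left _ _)
    rw [zero_smul, add_zero] at h1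
    refine h1.trans ?_
    simp only [hΦ]
    gcongr ENNReal.ofReal b⁻¹ * (2 * ?_)
    refine (setLIntegral_mono' measurableSet_Ioo fun t ht => ?_).trans
      (setLIntegral_le_lintegral (Ioo 0 b) _)
    have hmem : x + t • L.symm up ∈ Metric.ball p r := by
      have h2 : ‖t • L.symm up‖ < r / 2 := by
        rw [norm_smul, LinearIsometryEquiv.norm_map, norm_up, mul_one, Real.norm_eq_abs,
          abs_of_pos ht.1]
        exact ht.2.trans_le (min_le_right _ _)
      rw [Metric.mem_ball, dist_eq_norm] at hx ⊢
      calc ‖x + t • L.symm up - p‖ = ‖(x - p) + t • L.symm up‖ := by congr 1; abel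
        _ ≤ ‖x - p‖ + ‖t • L.symm up‖ := norm_add_le _ _
        _ < r := by linarith
    have hΩm : x + t • L.symm up ∈ Ω := by
      refine (h.mem_iff _ hmem).2 ?_
      have := ht.1
      simp only [map_add, map_smul, LinearIsometryEquiv.apply_symm_apply, PiLp.add_apply,
        PiLp.smul_apply, up_zero, up_one, smul_eq_mul, mul_zero, add_zero, mul_one, hg]
      linarith
    rw [hF, indicator_of_mem hΩm]
    gcongr
    refine (hφ.enorm_deriv_line_le x (L.symm up) t).trans_eq ?_
    have : ‖L.symm up‖ₑ = 1 := by
      rw [← ofReal_norm, LinearIsometryEquiv.norm_map, norm_up, ENNReal.ofReal_one]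
    rw [this, mul_one]
  have hm : Measurable (fun s => graphMap L γ s 0) :=
    ((continuous_graphMap L h.smooth.continuous).comp (Continuous.prodMk_left 0)).measurable
  have hmp := measurePreserving_graphMap L h.smooth.continuous
  calc ∫⁻ x in Γ ∩ Metric.ball p (r / 2), ‖φ x‖ₑ ^ 2 ∂(arcLength Γ)
      ≤ ∫⁻ x in Γ ∩ Metric.ball p (r / 2), Φ x ∂(arcLength Γ) := setLIntegral_mono hΦm hpt
    _ ≤ ∫⁻ x in Metric.ball p r, Φ x ∂(arcLength Γ) :=
        lintegral_mono_set (inter_subset_right.trans (Metric.ball_subset_ball (by linarith)))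
    _ ≤ ∫⁻ x, Φ x ∂(((1 + K : ℝ≥0) : ℝ≥0∞) •
          (volume.restrict (Metric.ball (L p 0) r)).map (fun s => graphMap L γ s 0)) :=
        lintegral_mono' h.arcLength_le le_rfl
    _ = (1 + K : ℝ≥0) * ∫⁻ s in Metric.ball (L p 0) r, Φ (graphMap L γ s 0) := by
        rw [lintegral_smul_measure, lintegral_map hΦm hm, smul_eq_mul]
    _ ≤ (1 + K : ℝ≥0) * ∫⁻ s, Φ (graphMap L γ s 0) := by
        gcongr
        exact Measure.restrict_le_self
    _ = (1 + K : ℝ≥0) * (ENNReal.ofReal b⁻¹ * (2 * ∫⁻ x, F x)) := by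
        congr 1
        have hFg : Measurable fun q : ℝ × ℝ => F (graphMap L γ q.1 q.2) :=
          hFm.comp hmp.measurable
        simp only [hΦ, graphMap_add]
        rw [lintegral_const_mul' _ _ ENNReal.ofReal_ne_top, lintegral_const_mul' _ _ (by norm_num),
          ← hmp.lintegral_comp hFm, Measure.volume_eq_prod, lintegral_prod _ hFg.aemeasurable]
    _ = _ := by
        rw [hFi, ENNReal.ofReal]
        push_cast
        ring

/-- The trace inequality for `C¹` functions. -/
theorem exists_trace_inequality {Ω Γ : Set Plane} (hΩ : MeasurableSet Ω) (hΓ : IsCompact Γ)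
    (h : ∀ p ∈ Γ, ∃ r L γ K, IsGraphAt Ω Γ p r L γ K) : ∃ C : ℝ≥0, ∀ φ : Plane → ℝ, IsC1Fun φ →
      ∫⁻ x, ‖φ x‖ₑ ^ 2 ∂(arcLength Γ) ≤
        C * ((∫⁻ x in Ω, ‖φ x‖ₑ ^ 2) + ∫⁻ x in Ω, ‖fderiv ℝ φ x‖ₑ ^ 2) := by
  have key : ∃ C : ℝ≥0, ∀ φ : Plane → ℝ, IsC1Fun φ →
      ∫⁻ x in Γ, ‖φ x‖ₑ ^ 2 ∂(arcLength Γ) ≤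
        C * ((∫⁻ x in Ω, ‖φ x‖ₑ ^ 2) + ∫⁻ x in Ω, ‖fderiv ℝ φ x‖ₑ ^ 2) := by
    refine hΓ.induction_on (p := fun S => ∃ C : ℝ≥0, ∀ φ : Plane → ℝ, IsC1Fun φ →
      ∫⁻ x in S, ‖φ x‖ₑ ^ 2 ∂(arcLength Γ) ≤
        C * ((∫⁻ x in Ω, ‖φ x‖ₑ ^ 2) + ∫⁻ x in Ω, ‖fderiv ℝ φ x‖ₑ ^ 2)) ?_ ?_ ?_ ?_
    · exact ⟨0, fun φ _ => by simp⟩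
    · rintro s t hst ⟨C, hC⟩
      exact ⟨C, fun φ hφ => (lintegral_mono_set hst).trans (hC φ hφ)⟩
    · rintro s t ⟨C, hC⟩ ⟨C', hC'⟩
      refine ⟨C + C', fun φ hφ => (lintegral_union_le _ _ _).trans ?_⟩
      rw [ENNReal.coe_add, add_mul]
      exact add_le_add (hC φ hφ) (hC' φ hφ)
    · intro p hp
      obtain ⟨r, L, γ, K, hg⟩ := h p hp
      exact ⟨_, inter_mem_nhdsWithin _ (Metric.ball_mem_nhds p (half_pos hg.pos)),
        hg.trace_inequality hΩ⟩
  obtain ⟨C, hC⟩ := key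
  refine ⟨C, fun φ hφ => ?_⟩
  have := hC φ hφ
  rwa [arcLength_def, Measure.restrict_restrict hΓ.measurableSet, inter_self] at this

/-! ### Poincaré inequality -/

theorem lintegral_comp_add_smul_le {N : Plane → ℝ≥0∞} (hN : Measurable N) (c : Plane) {τ : ℝ}
    (hτ : 1 / 2 ≤ τ) : ∫⁻ z, N (c + τ • z) ≤ 4 * ∫⁻ z, N z := by
  have hτ0 : 0 < τ := by linarith
  have h1 : ∫⁻ z, N (c + τ • z) = ∫⁻ z, N (c + z) ∂(Measure.map (fun z : Plane => τ • z) volume) := by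
    rw [lintegral_map (f := fun z => N (c + z)) (hN.comp (measurable_const_add c))
      (measurable_const_smul τ)]
  rw [h1, Measure.map_addHaar_smul _ hτ0.ne', lintegral_smul_measure, lintegral_add_left_eq_self,
    smul_eq_mul]
  gcongr
  have h4 : (4 : ℝ≥0∞) = ENNReal.ofReal 4 := by norm_num
  rw [h4]
  refine ENNReal.ofReal_le_ofReal ?_
  rw [finrank_euclideanSpace_fin, abs_of_pos (by positivity), inv_le_comm₀ (by positivity) (by norm_num)]
  nlinarith

/-- The substitution that bounds averages of a function over segments joining two sets: one
changes variables in the endpoint that carries the larger weight. -/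
theorem lintegral_segment_le {N : Plane → ℝ≥0∞} (hN : Measurable N) (W B : Set Plane) {τ : ℝ} :
    ∫⁻ x in W, ∫⁻ z in B, N (x + τ • (z - x)) ≤ 4 * (volume W + volume B) * ∫⁻ z, N z := by
  rcases le_total (1 / 2) τ with h | h
  · calc ∫⁻ x in W, ∫⁻ z in B, N (x + τ • (z - x))
        ≤ ∫⁻ x in W, 4 * ∫⁻ z, N z := by
          refine lintegral_mono fun x => (lintegral_mono' Measure.restrict_le_self le_rfl).trans ?_
          refine le_trans (le_of_eq ?_) (lintegral_comp_add_smul_le hN (x - τ • x) h)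
          refine lintegral_congr fun z => ?_
          congr 1
          rw [smul_sub]; abel
      _ = 4 * volume W * ∫⁻ z, N z := by rw [setLIntegral_const]; ring
      _ ≤ _ := by gcongr; exact le_self_add
  · have hm : Measurable fun q : Plane × Plane => N (q.1 + τ • (q.2 - q.1)) :=
      hN.comp (by fun_prop)
    rw [lintegral_lintegral_swap hm.aemeasurable]
    calc ∫⁻ z in B, ∫⁻ x in W, N (x + τ • (z - x))
        ≤ ∫⁻ z in B, 4 * ∫⁻ z, N z := by
          refine lintegral_mono fun z => (lintegral_mono' Measure.restrict_le_self le_rfl).trans ?_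
          refine le_trans (le_of_eq ?_)
            (lintegral_comp_add_smul_le hN (τ • z) (τ := 1 - τ) (by linarith))
          refine lintegral_congr fun x => ?_
          congr 1
          rw [smul_sub, sub_smul, one_smul]; abel
      _ = 4 * volume B * ∫⁻ z, N z := by rw [setLIntegral_const]; ring
      _ ≤ _ := by gcongr; exact le_add_self

/-- `W` is a bounded open set on which every `C¹` function is close to a constant in `L²`, as
measured by its gradient on a bounded part of `Ω`. -/
structure PoincareIn (Ω W : Set Plane) : Prop where
  isOpen : IsOpen W
  isBounded : IsBounded W
  ineq : ∃ (C : ℝ≥0) (ρ : ℝ), ∀ φ : Plane → ℝ, IsC1Fun φ → ∃ a : ℝ,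
    ∫⁻ x in W, ‖φ x - a‖ₑ ^ 2 ≤ C * ∫⁻ x in Ω ∩ Metric.ball 0 ρ, ‖fderiv ℝ φ x‖ₑ ^ 2

theorem PoincareIn.empty (Ω : Set Plane) : PoincareIn Ω ∅ :=
  ⟨isOpen_empty, isBounded_empty, 0, 0, fun φ _ => ⟨0, by simp⟩⟩

/-- The Poincaré inequality on a set that is star-shaped with respect to all points of an open set
`B`. The differences `φ x - φ z` are integrals of the gradient over segments; the constant is the
value of `φ` at a suitable point of `B`. -/
theorem PoincareIn.of_star {Ω W B : Set Plane} (hΩ : MeasurableSet Ω) (hW : IsOpen W)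
    (hWb : IsBounded W) (hB : IsOpen B) (hBn : B.Nonempty) (hBb : IsBounded B)
    (hs : ∀ x ∈ W, ∀ z ∈ B, ∀ τ ∈ Ioo (0 : ℝ) 1, x + τ • (z - x) ∈ Ω) : PoincareIn Ω W := by
  obtain ⟨ρ, hρ⟩ := (hWb.union hBb).subset_ball (0 : Plane)
  have hρ0 : ∀ x ∈ W ∪ B, ‖x‖ < ρ := fun x hx => by simpa using hρ hx
  have hWt : volume W ≠ ⊤ := hWb.measure_lt_top.ne
  have hBt : volume B ≠ ⊤ := hBb.measure_lt_top.ne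
  have hB0 : volume B ≠ 0 := (hB.measure_pos _ hBn).ne'
  set M : ℝ≥0 := Real.toNNReal (2 * ρ) with hM
  refine ⟨hW, hWb, ((volume B)⁻¹ * (M ^ 2 * (4 * (volume W + volume B)))).toNNReal, ρ,
    fun φ hφ => ?_⟩
  set N : Plane → ℝ≥0∞ := (Ω ∩ Metric.ball 0 ρ).indicator fun x => ‖fderiv ℝ φ x‖ₑ ^ 2 with hN
  have hΩm : MeasurableSet (Ω ∩ Metric.ball 0 ρ) := hΩ.inter Metric.isOpen_ball.measurableSet
  have hNm : Measurable N := hφ.measurable_enorm_fderiv_sq.indicator hΩm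
  have hpt : ∀ x ∈ W, ∀ z ∈ B, ‖φ x - φ z‖ₑ ^ 2 ≤
      (M : ℝ≥0∞) ^ 2 * ∫⁻ τ in Ioo (0 : ℝ) 1, N (x + τ • (z - x)) := by
    intro x hx z hz
    have hC1 : ContDiff ℝ 1 fun t : ℝ => φ (x + t • (z - x)) :=
      hφ.1.comp (contDiff_const.add (contDiff_id.smul contDiff_const))
    have hc0 : φ (x + (0 : ℝ) • (z - x)) = φ x := by simp
    have hc1 : φ (x + (1 : ℝ) • (z - x)) = φ z := by simp
    have h1 : ‖φ z - φ x‖ₑ ≤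
        ∫⁻ t in Ioo (0 : ℝ) 1, ‖deriv (fun t : ℝ => φ (x + t • (z - x))) t‖ₑ := by
      rw [← hc0, ← hc1, ← intervalIntegral.integral_deriv_eq_sub
        (fun t _ => (hC1.differentiable (by simp)) t)
        ((hC1.continuous_deriv (by simp)).intervalIntegrable _ _),
        intervalIntegral.integral_of_le zero_le_one, ← restrict_Ioo_eq_restrict_Ioc]
      exact enorm_integral_le_lintegral_enorm _
    rw [enorm_sub_rev]
    refine (pow_le_pow_left' h1 2).trans ((lintegral_sq_le
      (hC1.continuous_deriv (by simp)).enorm.measurable.aemeasurable).trans ?_)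
    rw [Measure.restrict_apply_univ, Real.volume_Ioo, sub_zero, ENNReal.ofReal_one, one_mul,
      ← lintegral_const_mul' _ _ (by simp)]
    refine setLIntegral_mono' measurableSet_Ioo fun t ht => ?_
    have hmem : x + t • (z - x) ∈ Ω ∩ Metric.ball 0 ρ := by
      refine ⟨hs x hx z hz t ht, ?_⟩
      have := (convex_ball (0 : Plane) ρ).add_smul_sub_mem (hρ (Or.inl hx)) (hρ (Or.inr hz))
        ⟨ht.1.le, ht.2.le⟩
      exact this
    rw [hN, indicator_of_mem hmem, ← mul_pow, mul_comm]
    refine pow_le_pow_left' ((hφ.enorm_deriv_line_le x (z - x) t).trans ?_) 2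
    gcongr
    rw [← ofReal_norm, hM]
    refine ENNReal.ofReal_le_ofReal ((norm_sub_le _ _).trans ?_)
    have := hρ0 x (Or.inl hx)
    have := hρ0 z (Or.inr hz)
    linarith
  have hdouble : ∫⁻ z in B, ∫⁻ x in W, ‖φ x - φ z‖ₑ ^ 2 ≤
      M ^ 2 * (4 * (volume W + volume B)) * ∫⁻ x, N x := by
    have hc : Continuous fun q : Plane × Plane => ‖φ q.1 - φ q.2‖ₑ ^ 2 :=
      (ENNReal.continuous_pow 2).comp
        ((hφ.continuous.comp continuous_fst).sub (hφ.continuous.comp continuous_snd)).enorm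
    have hc2 : Continuous fun q : Plane × Plane => ‖φ q.2 - φ q.1‖ₑ ^ 2 := hc.comp continuous_swap
    rw [lintegral_lintegral_swap (f := fun z x => ‖φ x - φ z‖ₑ ^ 2) hc2.measurable.aemeasurable]
    calc ∫⁻ x in W, ∫⁻ z in B, ‖φ x - φ z‖ₑ ^ 2
        ≤ ∫⁻ x in W, ∫⁻ z in B, (M : ℝ≥0∞) ^ 2 * ∫⁻ τ in Ioo (0 : ℝ) 1, N (x + τ • (z - x)) :=
          setLIntegral_mono' hW.measurableSet fun x hx =>
            setLIntegral_mono' hB.measurableSet fun z hz => hpt x hx z hz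
      _ = M ^ 2 * ∫⁻ x in W, ∫⁻ z in B, ∫⁻ τ in Ioo (0 : ℝ) 1, N (x + τ • (z - x)) := by
          rw [← lintegral_const_mul' _ _ (by simp)]
          refine lintegral_congr fun x => ?_
          rw [← lintegral_const_mul' _ _ (by simp)]
      _ = M ^ 2 * ∫⁻ τ in Ioo (0 : ℝ) 1, ∫⁻ x in W, ∫⁻ z in B, N (x + τ • (z - x)) := by
          congr 1
          calc _ = ∫⁻ x in W, ∫⁻ τ in Ioo (0 : ℝ) 1, ∫⁻ z in B, N (x + τ • (z - x)) := by
                refine lintegral_congr fun x => ?_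
                refine lintegral_lintegral_swap (f := fun z τ => N (x + τ • (z - x))) ?_
                refine Measurable.aemeasurable ?_
                exact hNm.comp (g := N) (f := fun q : Plane × ℝ => x + q.2 • (q.1 - x))
                  (by fun_prop)
            _ = _ := by
                refine lintegral_lintegral_swap
                  (f := fun x τ => ∫⁻ z in B, N (x + τ • (z - x))) ?_
                refine Measurable.aemeasurable ?_
                exact Measurable.lintegral_prod_right'
                  (f := fun q : (Plane × ℝ) × Plane => N (q.1.1 + q.1.2 • (q.2 - q.1.1)))
                  (hNm.comp (by fun_prop))
      _ ≤ M ^ 2 * ∫⁻ τ in Ioo (0 : ℝ) 1, 4 * (volume W + volume B) * ∫⁻ z, N z := by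
          gcongr
          exact lintegral_segment_le hNm W B
      _ = _ := by
          rw [setLIntegral_const, Real.volume_Ioo]
          simp [mul_assoc]
  -- some `z` in `B` does at least as well as the average over `B`
  obtain ⟨z, -, hz⟩ := exists_le_setLAverage (μ := volume) (s := B)
    (f := fun z => ∫⁻ x in W, ‖φ x - φ z‖ₑ ^ 2) hB0 hBt (by
      refine Measurable.aemeasurable ?_
      have hc : Continuous fun q : Plane × Plane => ‖φ q.2 - φ q.1‖ₑ ^ 2 :=
        (ENNReal.continuous_pow 2).comp
          ((hφ.continuous.comp continuous_snd).sub (hφ.continuous.comp continuous_fst)).enorm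
      exact Measurable.lintegral_prod_right' hc.measurable)
  refine ⟨φ z, hz.trans ?_⟩
  rw [setLAverage_eq, ENNReal.div_eq_inv_mul, ENNReal.coe_toNNReal, mul_assoc]
  · have : ∫⁻ x in Ω ∩ Metric.ball 0 ρ, ‖fderiv ℝ φ x‖ₑ ^ 2 = ∫⁻ x, N x := by
      rw [hN, lintegral_indicator hΩm]
    rw [this]
    gcongr
  · refine ENNReal.mul_ne_top (ENNReal.inv_ne_top.2 hB0) ?_
    refine ENNReal.mul_ne_top (by simp) (ENNReal.mul_ne_top (by norm_num) ?_)
    exact ENNReal.add_ne_top.2 ⟨hWt, hBt⟩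

/-- Near a point where the cone condition holds, `Ω` is star-shaped with respect to a ball. -/
theorem ConeAt.poincareIn {Ω : Set Plane} (hΩ : IsOpen Ω) {p : Plane} (h : ConeAt Ω p) :
    ∃ δ > 0, PoincareIn Ω (Ω ∩ Metric.ball p δ) := by
  obtain ⟨δ, hδ, t₀, ht₀, θ, hθ, v, hv⟩ := h
  set t := t₀ / 2 with ht
  have ht0 : 0 < t := by positivity
  refine ⟨min δ (t * θ / 4), by positivity, ?_⟩
  refine PoincareIn.of_star (B := Metric.ball (p + t • v) (t * θ / 2)) hΩ.measurableSet
    (hΩ.inter Metric.isOpen_ball) (Metric.isBounded_ball.subset inter_subset_right)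
    Metric.isOpen_ball (Metric.nonempty_ball.2 (by positivity)) Metric.isBounded_ball ?_
  rintro x ⟨hxΩ, hx⟩ z hz τ hτ
  have hx1 : x ∈ Metric.ball p δ := Metric.ball_subset_ball (min_le_left _ _) hx
  have hx2 : ‖x - p‖ < t * θ / 4 := by
    rw [← dist_eq_norm]; exact Metric.ball_subset_ball (min_le_right _ _) hx
  rw [Metric.mem_ball, dist_eq_norm] at hz
  set w := t⁻¹ • ((z - (p + t • v)) - (x - p)) with hw
  have hwθ : ‖w‖ < θ := by
    rw [hw, norm_smul, Real.norm_eq_abs, abs_of_pos (by positivity), inv_mul_lt_iff₀ ht0]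
    refine (norm_sub_le _ _).trans_lt ?_
    nlinarith
  have he : x + τ • (z - x) = x + (τ * t) • (v + w) := by
    have : t • w = (z - (p + t • v)) - (x - p) := by
      rw [hw, smul_smul, mul_inv_cancel₀ ht0.ne', one_smul]
    rw [mul_smul, smul_add, this]
    congr 2
    abel
  rw [he]
  refine hv x ⟨hxΩ, hx1⟩ _ ⟨mul_pos hτ.1 ht0, ?_⟩ w hwθ
  nlinarith [hτ.1, hτ.2]

/-- The constants of the two inequalities differ by little because both are close to the function on
the intersection, a set of positive measure. -/
theorem PoincareIn.union {Ω W W' : Set Plane} (h : PoincareIn Ω W) (h' : PoincareIn Ω W')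
    (hn : (W ∩ W').Nonempty) : PoincareIn Ω (W ∪ W') := by
  obtain ⟨C, ρ, hC⟩ := h.ineq
  obtain ⟨C', ρ', hC'⟩ := h'.ineq
  have hI : 0 < volume (W ∩ W') := (h.isOpen.inter h'.isOpen).measure_pos _ hn
  have hIt : volume (W ∩ W') ≠ ⊤ := (h.isBounded.subset inter_subset_left).measure_lt_top.ne
  have hW' : volume W' ≠ ⊤ := h'.isBounded.measure_lt_top.ne
  set q : ℝ≥0 := (2 * (volume W' * (volume (W ∩ W'))⁻¹)).toNNReal with hq
  have hqe : (q : ℝ≥0∞) = 2 * (volume W' * (volume (W ∩ W'))⁻¹) :=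
    ENNReal.coe_toNNReal (ENNReal.mul_ne_top (by norm_num)
      (ENNReal.mul_ne_top hW' (ENNReal.inv_ne_top.2 hI.ne')))
  refine ⟨h.isOpen.union h'.isOpen, h.isBounded.union h'.isBounded,
    C + 2 * (C' + q * (C + C')), max ρ ρ', fun φ hφ => ?_⟩
  obtain ⟨a, ha⟩ := hC φ hφ
  obtain ⟨a', ha'⟩ := hC' φ hφ
  set E := ∫⁻ x in Ω ∩ Metric.ball 0 (max ρ ρ'), ‖fderiv ℝ φ x‖ₑ ^ 2 with hE
  replace ha : ∫⁻ x in W, ‖φ x - a‖ₑ ^ 2 ≤ C * E := ha.trans (by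
    gcongr; exact lintegral_mono_set (inter_subset_inter_right _
      (Metric.ball_subset_ball (le_max_left _ _))))
  replace ha' : ∫⁻ x in W', ‖φ x - a'‖ₑ ^ 2 ≤ C' * E := ha'.trans (by
    gcongr; exact lintegral_mono_set (inter_subset_inter_right _
      (Metric.ball_subset_ball (le_max_right _ _))))
  have hm : ∀ b : ℝ, Measurable fun x => ‖φ x - b‖ₑ ^ 2 := fun b =>
    ((hφ.continuous.sub continuous_const).enorm.measurable).pow_const 2
  have hdiff : ‖a' - a‖ₑ ^ 2 * volume (W ∩ W') ≤ 2 * ((C + C') * E) := by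
    rw [← setLIntegral_const]
    calc ∫⁻ _ in W ∩ W', ‖a' - a‖ₑ ^ 2
        ≤ ∫⁻ x in W ∩ W', 2 * (‖φ x - a‖ₑ ^ 2 + ‖φ x - a'‖ₑ ^ 2) := by
          refine lintegral_mono fun x => ?_
          have := enorm_sub_sq_le (φ x - a) (φ x - a')
          rwa [sub_sub_sub_cancel_left] at this
      _ = 2 * ((∫⁻ x in W ∩ W', ‖φ x - a‖ₑ ^ 2) + ∫⁻ x in W ∩ W', ‖φ x - a'‖ₑ ^ 2) := by
          rw [lintegral_const_mul' _ _ (by norm_num), lintegral_add_left (hm a)]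
      _ ≤ 2 * (C * E + C' * E) := by
          gcongr
          · exact (lintegral_mono_set inter_subset_left).trans ha
          · exact (lintegral_mono_set inter_subset_right).trans ha'
      _ = _ := by ring
  have hdiff' : ‖a' - a‖ₑ ^ 2 * volume W' ≤ q * ((C + C') * E) := by
    calc ‖a' - a‖ₑ ^ 2 * volume W'
        = (‖a' - a‖ₑ ^ 2 * volume (W ∩ W')) * (volume W' * (volume (W ∩ W'))⁻¹) := by
          rw [mul_assoc, mul_left_comm (volume (W ∩ W')), ENNReal.mul_inv_cancel hI.ne' hIt,
            mul_one]
      _ ≤ (2 * ((C + C') * E)) * (volume W' * (volume (W ∩ W'))⁻¹) := by gcongr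
      _ = _ := by rw [hqe]; ring
  refine ⟨a, (lintegral_union_le _ _ _).trans ?_⟩
  have h2 : ∫⁻ x in W', ‖φ x - a‖ₑ ^ 2 ≤ 2 * (C' * E + q * ((C + C') * E)) := by
    calc ∫⁻ x in W', ‖φ x - a‖ₑ ^ 2
        ≤ ∫⁻ x in W', 2 * (‖φ x - a'‖ₑ ^ 2 + ‖a' - a‖ₑ ^ 2) := by
          refine lintegral_mono fun x => ?_
          have := enorm_add_sq_le (φ x - a') (a' - a)
          rwa [sub_add_sub_cancel] at this
      _ = 2 * ((∫⁻ x in W', ‖φ x - a'‖ₑ ^ 2) + ‖a' - a‖ₑ ^ 2 * volume W') := by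
          rw [lintegral_const_mul' _ _ (by norm_num), lintegral_add_left (hm a'),
            setLIntegral_const]
      _ ≤ _ := by gcongr
  calc _ ≤ C * E + 2 * (C' * E + q * ((C + C') * E)) := add_le_add ha h2
    _ = _ := by push_cast; ring

/-- In a connected open set, Poincaré sets can be joined by a chain of overlapping ones. -/
theorem PoincareIn.exists_union_subset {Ω W W' : Set Plane} (hΩ : IsOpen Ω)
    (hc : IsPreconnected Ω) (h : PoincareIn Ω W) (h' : PoincareIn Ω W') (hW : W ⊆ Ω)
    (hW' : W' ⊆ Ω) : ∃ V ⊆ Ω, PoincareIn Ω V ∧ W ∪ W' ⊆ V := by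
  rcases W.eq_empty_or_nonempty with rfl | ⟨x₀, hx₀⟩
  · exact ⟨W', hW', h', by simp⟩
  rcases W'.eq_empty_or_nonempty with rfl | ⟨y₀, hy₀⟩
  · exact ⟨W, hW, h, by simp⟩
  set S : Set Plane := {x | ∃ V ⊆ Ω, PoincareIn Ω V ∧ W ⊆ V ∧ x ∈ V} with hS
  have hSo : IsOpen S := by
    refine isOpen_iff_mem_nhds.2 ?_
    rintro x ⟨V, hVΩ, hV, hWV, hx⟩
    filter_upwards [hV.isOpen.mem_nhds hx] with y hy
    exact ⟨V, hVΩ, hV, hWV, hy⟩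
  have hloc : ∀ x ∈ Ω, ∃ V ⊆ Ω, PoincareIn Ω V ∧ x ∈ V := by
    intro x hx
    obtain ⟨δ, hδ, hP⟩ := (coneAt_of_mem hΩ hx).poincareIn hΩ
    exact ⟨_, inter_subset_left, hP, hx, Metric.mem_ball_self hδ⟩
  have hSc : IsOpen (Ω \ S) := by
    refine isOpen_iff_mem_nhds.2 ?_
    rintro x ⟨hxΩ, hxS⟩
    obtain ⟨V, hVΩ, hV, hx⟩ := hloc x hxΩ
    filter_upwards [hV.isOpen.mem_nhds hx] with y hy
    refine ⟨hVΩ hy, ?_⟩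
    rintro ⟨V', hV'Ω, hV', hWV', hyV'⟩
    exact hxS ⟨V' ∪ V, union_subset hV'Ω hVΩ, hV'.union hV ⟨y, hyV', hy⟩,
      hWV'.trans subset_union_left, Or.inr hx⟩
  have hsub : Ω ⊆ S := by
    refine hc.subset_left_of_subset_union hSo hSc disjoint_sdiff_right ?_ ?_
    · intro x hx
      by_cases hxS : x ∈ S
      · exact Or.inl hxS
      · exact Or.inr ⟨hx, hxS⟩
    · exact ⟨x₀, hW hx₀, W, hW, h, Subset.rfl, hx₀⟩
  obtain ⟨V, hVΩ, hV, hWV, hy⟩ := hsub (hW' hy₀)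
  exact ⟨V ∪ W', union_subset hVΩ hW', hV.union h' ⟨y₀, hy, hy₀⟩,
    union_subset_union_left _ hWV⟩

/-- The Poincaré inequality on bounded parts of a connected open set with the cone condition. -/
theorem exists_poincareIn {Ω : Set Plane} (hΩ : IsOpen Ω) (hc : IsPreconnected Ω)
    (hcone : ∀ p ∈ closure Ω, ConeAt Ω p) (R : ℝ) :
    ∃ W ⊆ Ω, PoincareIn Ω W ∧ Ω ∩ Metric.ball 0 R ⊆ W := by
  have hK : IsCompact (closure Ω ∩ Metric.closedBall 0 R) :=
    (isCompact_closedBall _ _).inter_left isClosed_closure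
  have : ∃ W ⊆ Ω, PoincareIn Ω W ∧ Ω ∩ (closure Ω ∩ Metric.closedBall 0 R) ⊆ W := by
    refine hK.induction_on (p := fun S => ∃ W ⊆ Ω, PoincareIn Ω W ∧ Ω ∩ S ⊆ W) ?_ ?_ ?_ ?_
    · exact ⟨∅, empty_subset _, PoincareIn.empty Ω, by simp⟩
    · rintro s t hst ⟨W, hW, hP, hsub⟩
      exact ⟨W, hW, hP, (inter_subset_inter_right _ hst).trans hsub⟩
    · rintro s t ⟨W, hW, hP, hsub⟩ ⟨W', hW', hP', hsub'⟩
      obtain ⟨V, hV, hVP, hVs⟩ := hP.exists_union_subset hΩ hc hP' hW hW'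
      refine ⟨V, hV, hVP, ?_⟩
      rw [inter_union_distrib_left]
      exact (union_subset_union hsub hsub').trans hVs
    · rintro p ⟨hp, -⟩
      obtain ⟨δ, hδ, hP⟩ := (hcone p hp).poincareIn hΩ
      exact ⟨Metric.ball p δ, mem_nhdsWithin_of_mem_nhds (Metric.ball_mem_nhds p hδ),
        _, inter_subset_left, hP, Subset.rfl⟩
  obtain ⟨W, hW, hP, hsub⟩ := this
  refine ⟨W, hW, hP, fun x hx => hsub ⟨hx.1, subset_closure hx.1, Metric.ball_subset_closedBall hx.2⟩⟩

/-! ### Mollification -/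

/-- The convolution of `f` with the kernel `k`. -/
def moll (k f : Plane → ℝ) : Plane → ℝ := convolution f k (ContinuousLinearMap.mul ℝ ℝ) volume

theorem moll_apply (k f : Plane → ℝ) (x : Plane) : moll k f x = ∫ y, f y * k (x - y) := by
  simp [moll, convolution_def]

/-- A smooth probability density supported in the ball of radius `δ` about the origin. It need not
be even: its support may be any small ball near the origin. -/
structure IsMollifier (k : Plane → ℝ) (δ : ℝ) : Prop where
  isTestFun : IsTestFun k
  nonneg : ∀ z, 0 ≤ k z
  integral_eq : ∫ z, k z = 1
  norm_lt : ∀ z, k z ≠ 0 → ‖z‖ < δ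

theorem IsTestFun.comp_sub_left {k : Plane → ℝ} (hk : IsTestFun k) (x : Plane) :
    IsTestFun fun y => k (x - y) :=
  ⟨hk.1.comp (contDiff_const.sub contDiff_id),
    hk.2.comp_homeomorph (Homeomorph.subLeft x)⟩

theorem fderiv_comp_sub_left {k : Plane → ℝ} (hk : IsTestFun k) (x y w : Plane) :
    fderiv ℝ (fun y => k (x - y)) y w = - fderiv ℝ k (x - y) w := by
  have h1 : HasFDerivAt (fun y : Plane => x - y) (-ContinuousLinearMap.id ℝ Plane) y :=
    (hasFDerivAt_id y).const_sub x
  have h2 := ((hk.1.differentiable (by simp)) (x - y)).hasFDerivAt.comp y h1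
  rw [show (fun y => k (x - y)) = k ∘ fun y => x - y from rfl, h2.fderiv]
  simp

theorem integrable_mul_comp_sub {k f : Plane → ℝ} (hk : Continuous k) (hkc : HasCompactSupport k)
    (hf : LocallyIntegrable f volume) (x : Plane) : Integrable fun y => f y * k (x - y) :=
  hkc.convolutionExists_right (ContinuousLinearMap.mul ℝ ℝ) hf hk x

theorem moll_sub {k f g : Plane → ℝ} (hk : IsTestFun k) (hf : LocallyIntegrable f volume)
    (hg : LocallyIntegrable g volume) (x : Plane) :
    moll k (f - g) x = moll k f x - moll k g x := by
  simp only [moll_apply, Pi.sub_apply, sub_mul]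
  exact integral_sub (integrable_mul_comp_sub hk.continuous hk.2 hf x)
    (integrable_mul_comp_sub hk.continuous hk.2 hg x)

theorem contDiff_moll {k f : Plane → ℝ} (hk : IsTestFun k) (hf : LocallyIntegrable f volume) :
    ContDiff ℝ ∞ (moll k f) :=
  hk.2.contDiff_convolution_right (ContinuousLinearMap.mul ℝ ℝ) hf hk.1

theorem fderiv_moll {k f : Plane → ℝ} (hk : IsTestFun k) (hf : LocallyIntegrable f volume)
    (x w : Plane) : fderiv ℝ (moll k f) x w = moll (fun z => fderiv ℝ k z w) f x := by
  have h1 := hk.2.hasFDerivAt_convolution_right (ContinuousLinearMap.mul ℝ ℝ) hf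
    (hk.1.of_le (by simp)) x
  rw [moll, h1.fderiv]
  exact convolution_precompR_apply (ContinuousLinearMap.mul ℝ ℝ) hf (hk.2.fderiv (𝕜 := ℝ))
    (hk.1.continuous_fderiv (by simp)) x w

/-- Mollification commutes with weak differentiation away from the boundary. -/
theorem fderiv_moll_of_weak {Ω : Set Plane} (hΩ : MeasurableSet Ω) {k u g : Plane → ℝ}
    (hk : IsTestFun k) (hu : LocallyIntegrable (Ω.indicator u) volume) {w : Plane}
    (hw : ∀ ψ : Plane → ℝ, IsTestFun ψ → tsupport ψ ⊆ Ω →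
      ∫ x in Ω, u x * fderiv ℝ ψ x w = - ∫ x in Ω, ψ x * g x) {x : Plane}
    (hx : tsupport (fun y => k (x - y)) ⊆ Ω) :
    fderiv ℝ (moll k (Ω.indicator u)) x w = moll k (Ω.indicator g) x := by
  have h := hw _ (hk.comp_sub_left x) hx
  have e : ∀ (a b : Plane → ℝ), ∫ y, Ω.indicator a y * b y = ∫ y in Ω, a y * b y := by
    intro a b
    rw [← integral_indicator hΩ]
    refine integral_congr_ae (ae_of_all _ fun y => ?_)
    by_cases hy : y ∈ Ω <;> simp [hy]
  rw [fderiv_moll hk hu, moll_apply, moll_apply, e, e]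
  simp only [fderiv_comp_sub_left hk, mul_neg, integral_neg, neg_inj] at h
  rw [h]
  simp only [mul_comm]

theorem IsMollifier.lintegral_eq {k : Plane → ℝ} {δ : ℝ} (hk : IsMollifier k δ) :
    ∫⁻ z, ‖k z‖ₑ = 1 := by
  have h := ofReal_integral_eq_lintegral_ofReal (μ := volume)
    (hk.isTestFun.continuous.integrable_of_hasCompactSupport hk.isTestFun.2) (ae_of_all _ hk.nonneg)
  rw [hk.integral_eq, ENNReal.ofReal_one] at h
  rw [h]
  refine lintegral_congr fun z => ?_
  rw [← ofReal_norm, Real.norm_of_nonneg (hk.nonneg z)]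

theorem IsMollifier.enorm_moll_sq_le {k : Plane → ℝ} {δ : ℝ} (hk : IsMollifier k δ)
    {f : Plane → ℝ} (hf : AEMeasurable f volume) (x : Plane) :
    ‖moll k f x‖ₑ ^ 2 ≤ ∫⁻ y, ‖f y‖ₑ ^ 2 * ‖k (x - y)‖ₑ := by
  have hkm : Measurable fun y => ‖k (x - y)‖ₑ :=
    (hk.isTestFun.continuous.comp (continuous_const.sub continuous_id)).enorm.measurable
  calc ‖moll k f x‖ₑ ^ 2 ≤ (∫⁻ y, ‖f y‖ₑ * ‖k (x - y)‖ₑ) ^ 2 := by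
        rw [moll_apply]
        refine pow_le_pow_left' ((enorm_integral_le_lintegral_enorm _).trans_eq ?_) 2
        simp only [enorm_mul]
    _ ≤ (∫⁻ y, ‖k (x - y)‖ₑ) * ∫⁻ y, ‖f y‖ₑ ^ 2 * ‖k (x - y)‖ₑ :=
        lintegral_mul_sq_le hf.enorm hkm.aemeasurable
    _ = _ := by
        rw [lintegral_sub_left_eq_self (fun z => ‖k z‖ₑ) x, hk.lintegral_eq, one_mul]

/-- Mollification does not increase the `L²` norm. -/
theorem IsMollifier.lintegral_moll_sq_le {k : Plane → ℝ} {δ : ℝ} (hk : IsMollifier k δ)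
    {f : Plane → ℝ} (hf : AEMeasurable f volume) :
    ∫⁻ x, ‖moll k f x‖ₑ ^ 2 ≤ ∫⁻ x, ‖f x‖ₑ ^ 2 := by
  have hkm : Measurable fun q : Plane × Plane => ‖k (q.1 - q.2)‖ₑ :=
    (hk.isTestFun.continuous.comp (continuous_fst.sub continuous_snd)).enorm.measurable
  calc ∫⁻ x, ‖moll k f x‖ₑ ^ 2 ≤ ∫⁻ x, ∫⁻ y, ‖f y‖ₑ ^ 2 * ‖k (x - y)‖ₑ :=
        lintegral_mono fun x => hk.enorm_moll_sq_le hf x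
    _ = ∫⁻ y, ∫⁻ x, ‖f y‖ₑ ^ 2 * ‖k (x - y)‖ₑ := by
        refine lintegral_lintegral_swap ?_
        exact ((hf.enorm.pow_const 2).comp_snd).mul hkm.aemeasurable
    _ = ∫⁻ y, ‖f y‖ₑ ^ 2 := by
        refine lintegral_congr fun y => ?_
        have hm : Measurable fun x => ‖k (x - y)‖ₑ :=
          (hk.isTestFun.continuous.comp (continuous_id.sub continuous_const)).enorm.measurable
        rw [lintegral_const_mul _ hm, lintegral_sub_right_eq_self (fun z => ‖k z‖ₑ) y,
          hk.lintegral_eq, mul_one]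

theorem IsMollifier.enorm_moll_sub_le {k : Plane → ℝ} {δ : ℝ} (hk : IsMollifier k δ)
    {g : Plane → ℝ} (hg : LocallyIntegrable g volume) {x : Plane} {ε : ℝ}
    (h : ∀ y, ‖x - y‖ < δ → ‖g y - g x‖ ≤ ε) : ‖moll k g x - g x‖ ≤ ε := by
  have hi : Integrable fun y => k (x - y) :=
    (hk.isTestFun.comp_sub_left x).continuous.integrable_of_hasCompactSupport
      (hk.isTestFun.comp_sub_left x).2
  have h1 : ∫ y, k (x - y) = 1 := by
    rw [integral_sub_left_eq_self (fun z => k z) volume x, hk.integral_eq]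
  have e : moll k g x - g x = ∫ y, (g y - g x) * k (x - y) := by
    rw [moll_apply]
    simp only [sub_mul]
    rw [integral_sub (integrable_mul_comp_sub hk.isTestFun.continuous hk.isTestFun.2 hg x)
      (hi.const_mul _), integral_const_mul, h1, mul_one]
  rw [e]
  calc ‖∫ y, (g y - g x) * k (x - y)‖ ≤ ∫ y, ε * k (x - y) := by
        refine norm_integral_le_of_norm_le (hi.const_mul ε) (ae_of_all _ fun y => ?_)
        by_cases hz : k (x - y) = 0
        · simp [hz]
        · rw [norm_mul, Real.norm_of_nonneg (hk.nonneg _)]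
          exact mul_le_mul_of_nonneg_right (h y (hk.norm_lt _ hz)) (hk.nonneg _)
    _ = ε := by rw [integral_const_mul, h1, mul_one]

theorem MemLp.lintegral_sq_lt_top {α E : Type*} [MeasurableSpace α] [NormedAddCommGroup E]
    {μ : Measure α} {f : α → E} (hf : MemLp f 2 μ) : ∫⁻ x, ‖f x‖ₑ ^ 2 ∂μ < ⊤ := by
  have := hf.2
  rw [eLpNorm_eq_lintegral_rpow_enorm_toReal (by norm_num) (by norm_num)] at this
  by_contra h
  rw [not_lt, top_le_iff] at h
  simp [h] at this

theorem eLpNorm_two_sq {α E : Type*} [MeasurableSpace α] [NormedAddCommGroup E]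
    {μ : Measure α} (f : α → E) : eLpNorm f 2 μ ^ 2 = ∫⁻ x, ‖f x‖ₑ ^ 2 ∂μ := by
  rw [eLpNorm_eq_lintegral_rpow_enorm_toReal (by norm_num) (by norm_num)]
  simp only [ENNReal.toReal_ofNat, ENNReal.rpow_ofNat, one_div]
  rw [← ENNReal.rpow_natCast, ← ENNReal.rpow_mul]
  norm_num

/-- Mollifiers of small support approximate the identity in `L²`. -/
theorem exists_lintegral_moll_sub_le {f : Plane → ℝ} (hf : MemLp f 2 volume) {ε : ℝ≥0∞}
    (hε : ε ≠ 0) : ∃ δ > 0, ∀ k δ', δ' ≤ δ → IsMollifier k δ' →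
      ∫⁻ x, ‖moll k f x - f x‖ₑ ^ 2 ≤ ε := by
  rcases eq_or_ne ε ⊤ with rfl | hεt
  · exact ⟨1, one_pos, fun k δ' _ _ => le_top⟩
  set e : ℝ≥0∞ := min 1 (ε / 16) with he
  have hε16 : ε / 16 ≠ 0 := (ENNReal.div_pos hε (by norm_num)).ne'
  have he0 : e ≠ 0 := (lt_min zero_lt_one (pos_iff_ne_zero.2 hε16)).ne'
  obtain ⟨g, hgc, hfg, hg, hgL⟩ := hf.exists_hasCompactSupport_eLpNorm_sub_le (by norm_num) he0
  have hfg2 : ∫⁻ x, ‖(f - g) x‖ₑ ^ 2 ≤ ε / 16 := by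
    rw [← eLpNorm_two_sq]
    calc _ ≤ e ^ 2 := pow_le_pow_left' hfg 2
      _ ≤ e * 1 := by rw [sq]; gcongr; exact min_le_left _ _
      _ ≤ ε / 16 := by rw [mul_one]; exact min_le_right _ _
  -- `g` is uniformly continuous with compact support, so its mollification converges uniformly
  have hK : IsCompact (Metric.cthickening 1 (tsupport g)) := IsCompact.cthickening hgc
  set m : ℝ := (volume (Metric.cthickening 1 (tsupport g))).toReal with hm
  have hmt : volume (Metric.cthickening 1 (tsupport g)) = ENNReal.ofReal m :=
    (ENNReal.ofReal_toReal hK.measure_lt_top.ne).symm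
  have hm0 : 0 ≤ m := ENNReal.toReal_nonneg
  set s : ℝ := min 1 ((ε / 4).toReal / (m + 1)) with hs
  have hs0 : 0 < s := by
    refine lt_min one_pos (div_pos (ENNReal.toReal_pos (ENNReal.div_pos hε (by norm_num)).ne' ?_)
      (by positivity))
    exact (ENNReal.div_lt_top hεt (by norm_num)).ne
  obtain ⟨δ, hδ, hδs⟩ := Metric.uniformContinuous_iff.1
    (hgc.uniformContinuous_of_continuous hg) s hs0
  refine ⟨min δ 1, lt_min hδ one_pos, fun k δ' hδ' hk => ?_⟩
  have hgi : LocallyIntegrable g volume := hg.locallyIntegrable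
  have hfi : LocallyIntegrable f volume := hf.locallyIntegrable (by norm_num)
  have hunif : ∀ x, ‖moll k g x - g x‖ₑ ^ 2 ≤
      (Metric.cthickening 1 (tsupport g)).indicator (fun _ => ENNReal.ofReal s) x := by
    intro x
    by_cases hx : x ∈ Metric.cthickening 1 (tsupport g)
    · rw [indicator_of_mem hx]
      have : ‖moll k g x - g x‖ ≤ s := hk.enorm_moll_sub_le hgi fun y hy => by
        rw [← dist_eq_norm]
        refine (hδs ?_).le
        rw [dist_comm, dist_eq_norm]
        exact hy.trans_le (hδ'.trans (min_le_left _ _))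
      rw [← ofReal_norm, ← ENNReal.ofReal_pow (norm_nonneg _)]
      refine ENNReal.ofReal_le_ofReal ?_
      have : s ≤ 1 := min_le_left _ _
      nlinarith [norm_nonneg (moll k g x - g x)]
    · have hz : ∀ y, ‖x - y‖ < δ' → g y = 0 := by
        intro y hy
        by_contra hne
        refine hx (Metric.mem_cthickening_of_dist_le x y 1 _ (subset_tsupport g hne) ?_)
        rw [dist_eq_norm]
        exact hy.le.trans (hδ'.trans (min_le_right _ _))
      have hgx : g x = 0 := by
        by_contra hne
        exact hx (Metric.self_subset_cthickening _ (subset_tsupport g hne))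
      have : ‖moll k g x - g x‖ ≤ 0 := hk.enorm_moll_sub_le hgi fun y hy => by
        rw [hz y hy, hgx]; simp
      rw [norm_le_zero_iff.1 this]
      simp
  have hcpt : ∫⁻ x, ‖moll k g x - g x‖ₑ ^ 2 ≤ ε / 4 := by
    calc _ ≤ ∫⁻ x, (Metric.cthickening 1 (tsupport g)).indicator (fun _ => ENNReal.ofReal s) x :=
          lintegral_mono hunif
      _ = ENNReal.ofReal s * ENNReal.ofReal m := by
          rw [lintegral_indicator hK.measurableSet, setLIntegral_const, hmt]
      _ ≤ ENNReal.ofReal (ε / 4).toReal := by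
          rw [← ENNReal.ofReal_mul hs0.le]
          refine ENNReal.ofReal_le_ofReal ?_
          have h1 : s ≤ (ε / 4).toReal / (m + 1) := min_le_right _ _
          rw [le_div_iff₀ (by positivity)] at h1
          nlinarith
      _ ≤ ε / 4 := ENNReal.ofReal_toReal_le
  have hdecomp : ∀ x, moll k f x - f x
      = (moll k g x - g x) + (moll k (f - g) x - (f - g) x) := by
    intro x
    rw [moll_sub hk.isTestFun hfi hgi, Pi.sub_apply]
    ring
  have hfgm : AEMeasurable (f - g) volume := hf.1.aemeasurable.sub hg.measurable.aemeasurable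
  have hmg : Measurable fun x => ‖moll k g x - g x‖ₑ ^ 2 :=
    (((contDiff_moll hk.isTestFun hgi).continuous.sub hg).enorm.measurable).pow_const 2
  have hfgi : LocallyIntegrable (f - g) volume := hfi.sub hgi
  have hmfg : Measurable fun x => ‖moll k (f - g) x‖ₑ ^ 2 :=
    ((contDiff_moll hk.isTestFun hfgi).continuous.enorm.measurable).pow_const 2
  calc ∫⁻ x, ‖moll k f x - f x‖ₑ ^ 2
      ≤ ∫⁻ x, 2 * (‖moll k g x - g x‖ₑ ^ 2 +
          2 * (‖moll k (f - g) x‖ₑ ^ 2 + ‖(f - g) x‖ₑ ^ 2)) := by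
        refine lintegral_mono fun x => ?_
        rw [hdecomp x]
        refine (enorm_add_sq_le _ _).trans ?_
        gcongr
        exact enorm_sub_sq_le _ _
    _ = 2 * ((∫⁻ x, ‖moll k g x - g x‖ₑ ^ 2) +
          2 * ((∫⁻ x, ‖moll k (f - g) x‖ₑ ^ 2) + ∫⁻ x, ‖(f - g) x‖ₑ ^ 2)) := by
        rw [lintegral_const_mul' _ _ (by norm_num), lintegral_add_left hmg,
          lintegral_const_mul' _ _ (by norm_num), lintegral_add_left hmfg]
    _ ≤ 2 * (ε / 4 + 2 * (ε / 16 + ε / 16)) := by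
        gcongr
        exact (hk.lintegral_moll_sq_le hfgm).trans hfg2
    _ ≤ ε := by
        lift ε to ℝ≥0 using hεt
        rw [show (4 : ℝ≥0∞) = ((4 : ℝ≥0) : ℝ≥0∞) by norm_num,
          show (16 : ℝ≥0∞) = ((16 : ℝ≥0) : ℝ≥0∞) by norm_num,
          ← ENNReal.coe_div (by norm_num), ← ENNReal.coe_div (by norm_num)]
        norm_cast
        rw [← NNReal.coe_le_coe]
        push_cast
        have := ε.2
        linarith

/-- A mollifier supported in a prescribed ball. -/
theorem exists_isMollifier_ball (c : Plane) {r δ : ℝ} (hr : 0 < r) (hδ : ‖c‖ + r ≤ δ) :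
    ∃ k, IsMollifier k δ ∧ ∀ z, k z ≠ 0 → ‖z - c‖ < r := by
  let b : ContDiffBump c := ⟨r / 2, r, by positivity, by linarith⟩
  have hs : ∀ z, b.normed volume z ≠ 0 → ‖z - c‖ < r := by
    intro z hz
    have : z ∈ Function.support (b.normed volume) := hz
    rw [b.support_normed_eq] at this
    rwa [Metric.mem_ball, dist_eq_norm] at this
  refine ⟨b.normed volume, ⟨⟨b.contDiff_normed, b.hasCompactSupport_normed⟩, b.nonneg_normed,
    b.integral_normed, fun z hz => ?_⟩, hs⟩
  calc ‖z‖ = ‖c + (z - c)‖ := by rw [add_sub_cancel]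
    _ ≤ ‖c‖ + ‖z - c‖ := norm_add_le _ _
    _ < δ := by linarith [hs z hz]

/-! ### Density of smooth functions -/

open scoped Manifold in
/-- A smooth partition of unity on a compact set, subordinate to balls of prescribed radii. -/
theorem exists_partition {K : Set Plane} (hK : IsCompact K) {r : Plane → ℝ}
    (hr : ∀ p ∈ K, 0 < r p) : ∃ (t : Finset Plane) (χ : Plane → Plane → ℝ), (∀ i ∈ t, i ∈ K) ∧
      (∀ i ∈ t, IsTestFun (χ i) ∧ tsupport (χ i) ⊆ Metric.ball i (r i)) ∧
      ∀ x ∈ K, ∑ i ∈ t, χ i x = 1 := by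
  classical
  obtain ⟨t, htK, htc⟩ := hK.elim_nhds_subcover (fun p => Metric.ball p (r p))
    fun p hp => Metric.ball_mem_nhds p (hr p hp)
  obtain ⟨f, hf⟩ := SmoothPartitionOfUnity.exists_isSubordinate 𝓘(ℝ, Plane) hK.isClosed
    (fun i : t => Metric.ball (i : Plane) (r i)) (fun i => Metric.isOpen_ball) (by
      intro x hx
      obtain ⟨i, hi, hxi⟩ := mem_iUnion₂.1 (htc hx)
      exact mem_iUnion.2 ⟨⟨i, hi⟩, hxi⟩)
  refine ⟨t, fun i => if h : i ∈ t then f ⟨i, h⟩ else 0, htK, fun i hi => ?_, fun x hx => ?_⟩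
  · simp only [hi, dif_pos]
    have hsub := hf ⟨i, hi⟩
    refine ⟨⟨(f ⟨i, hi⟩).contMDiff.contDiff, ?_⟩, hsub⟩
    exact Metric.isCompact_of_isClosed_isBounded (isClosed_tsupport _)
      (Metric.isBounded_ball.subset hsub)
  · have h1 := f.sum_eq_one hx
    rw [finsum_eq_sum_of_fintype] at h1
    rw [← h1, ← Finset.sum_coe_sort t]
    refine Finset.sum_congr rfl fun i _ => ?_
    simp

theorem IsTestFun.mul {φ ψ : Plane → ℝ} (h : IsTestFun φ) (h' : IsTestFun ψ) :
    IsTestFun (fun x => φ x * ψ x) := ⟨h.1.mul h'.1, h.2.mul_right⟩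

theorem IsTestFun.memLp_top {φ : Plane → ℝ} (h : IsTestFun φ) (μ : Measure Plane) :
    MemLp φ ⊤ μ := by
  obtain ⟨C, hC⟩ := h.2.exists_bound_of_continuous h.continuous
  exact memLp_top_of_bound h.continuous.aestronglyMeasurable C (ae_of_all _ hC)

theorem IsTestFun.memLp_top_gradient {φ : Plane → ℝ} (h : IsTestFun φ) (μ : Measure Plane) :
    MemLp (gradient φ) ⊤ μ := by
  obtain ⟨C, hC⟩ := h.isC1Fun.hasCompactSupport_gradient.exists_bound_of_continuous
    h.isC1Fun.continuous_gradient
  exact memLp_top_of_bound h.isC1Fun.continuous_gradient.aestronglyMeasurable C (ae_of_all _ hC)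

theorem fderiv_mul_apply {φ ψ : Plane → ℝ} (h : IsC1Fun φ) (h' : IsC1Fun ψ) (x w : Plane) :
    fderiv ℝ (fun x => φ x * ψ x) x w = φ x * fderiv ℝ ψ x w + ψ x * fderiv ℝ φ x w := by
  rw [fderiv_fun_mul (h.differentiable x) (h'.differentiable x)]
  simp

theorem memLp_smulTest_fn {Ω : Set Plane} {χ : Plane → ℝ} (hχ : IsTestFun χ) (U : H1 Ω) :
    MemLp (fun x => χ x * fnOf U x) 2 (volume.restrict Ω) :=
  (Lp.memLp (fnOf U)).mul (hχ.memLp_top _)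

theorem memLp_smulTest_grad {Ω : Set Plane} {χ : Plane → ℝ} (hχ : IsTestFun χ) (U : H1 Ω) :
    MemLp (fun x => χ x • gradOf U x + fnOf U x • gradient χ x) 2 (volume.restrict Ω) :=
  MemLp.add (MemLp.smul (r := 2) (Lp.memLp (gradOf U)) (hχ.memLp_top _))
    (MemLp.smul (r := 2) (hχ.memLp_top_gradient _) (Lp.memLp (fnOf U)))

/-- The product of an `H¹` function with a test function. -/
def H1.smulTest {Ω : Set Plane} {χ : Plane → ℝ} (hχ : IsTestFun χ) (U : H1 Ω) : H1 Ω :=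
  ⟨WithLp.toLp 2 ((memLp_smulTest_fn hχ U).toLp _, (memLp_smulTest_grad hχ U).toLp _), by
    intro ψ hψ hs w
    have e1 := (memLp_smulTest_fn hχ U).coeFn_toLp
    have e2 := (memLp_smulTest_grad hχ U).coeFn_toLp
    have hχψ := hχ.mul hψ
    have hs' : tsupport (fun x => χ x * ψ x) ⊆ Ω :=
      (closure_mono (Function.support_mul_subset_right χ ψ)).trans hs
    have hU := U.2 _ hχψ hs' w
    have hχb := hχ.memLp_top (volume.restrict Ω)
    have hψb := hψ.memLp_top (volume.restrict Ω)
    have i1 : Integrable (fun x => fnOf U x * (χ x * fderiv ℝ ψ x w)) (volume.restrict Ω) :=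
      (Lp.memLp (fnOf U)).integrable_mul (MemLp.mul (r := 2) (hψ.memLp_fderiv w _) hχb)
    have i2 : Integrable (fun x => fnOf U x * (ψ x * fderiv ℝ χ x w)) (volume.restrict Ω) :=
      (Lp.memLp (fnOf U)).integrable_mul (MemLp.mul (r := 2) (hχ.memLp_fderiv w _) hψb)
    have i3 : Integrable (fun x => χ x * ψ x * inner ℝ (gradOf U x) w) (volume.restrict Ω) :=
      (hχψ.memLp _).integrable_mul ((Lp.memLp (gradOf U)).inner_const w)
    calc _ = ∫ x in Ω, fnOf U x * (χ x * fderiv ℝ ψ x w) := by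
          refine integral_congr_ae ?_
          filter_upwards [e1] with x hx
          refine (congrArg (fun a => a * fderiv ℝ ψ x w) hx).trans ?_
          ring
      _ = (∫ x in Ω, fnOf U x * fderiv ℝ (fun x => χ x * ψ x) x w)
            - ∫ x in Ω, fnOf U x * (ψ x * fderiv ℝ χ x w) := by
          rw [← integral_sub _ i2]
          · refine integral_congr_ae (ae_of_all _ fun x => ?_)
            simp only [fderiv_mul_apply hχ.isC1Fun hψ.isC1Fun]
            ring
          · refine (i1.add i2).congr (ae_of_all _ fun x => ?_)
            simp only [fderiv_mul_apply hχ.isC1Fun hψ.isC1Fun, Pi.add_apply]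
            ring
      _ = - (∫ x in Ω, χ x * ψ x * inner ℝ (gradOf U x) w)
            - ∫ x in Ω, fnOf U x * (ψ x * fderiv ℝ χ x w) := by
          congr 1
      _ = - ∫ x in Ω, (χ x * ψ x * inner ℝ (gradOf U x) w
            + fnOf U x * (ψ x * fderiv ℝ χ x w)) := by
          rw [integral_add i3 i2]; ring
      _ = _ := by
          congr 1
          refine integral_congr_ae ?_
          filter_upwards [e2] with x hx
          refine Eq.trans ?_ (congrArg (fun a => ψ x * inner ℝ a w) hx.symm)
          rw [inner_add_left, real_inner_smul_left, real_inner_smul_left, inner_gradient]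
          ring⟩

theorem fnOf_smulTest {Ω : Set Plane} {χ : Plane → ℝ} (hχ : IsTestFun χ) (U : H1 Ω) :
    fnOf (H1.smulTest hχ U) =ᵐ[volume.restrict Ω] fun x => χ x * fnOf U x :=
  (memLp_smulTest_fn hχ U).coeFn_toLp

theorem gradOf_smulTest {Ω : Set Plane} {χ : Plane → ℝ} (hχ : IsTestFun χ) (U : H1 Ω) :
    gradOf (H1.smulTest hχ U) =ᵐ[volume.restrict Ω]
      fun x => χ x • gradOf U x + fnOf U x • gradient χ x :=
  (memLp_smulTest_grad hχ U).coeFn_toLp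

theorem enorm_sq_eq_coords (x : Plane) : ‖x‖ₑ ^ 2 = ‖x 0‖ₑ ^ 2 + ‖x 1‖ₑ ^ 2 := by
  have h : ‖x‖ ^ 2 = ‖x 0‖ ^ 2 + ‖x 1‖ ^ 2 := by
    rw [EuclideanSpace.norm_sq_eq, Fin.sum_univ_two]
  have e : ∀ {E : Type} [NormedAddCommGroup E] (x : E), ‖x‖ₑ ^ 2 = ENNReal.ofReal (‖x‖ ^ 2) := by
    intro E _ x
    rw [← ofReal_norm, ENNReal.ofReal_pow (norm_nonneg _)]
  rw [e, e, e, h, ENNReal.ofReal_add (by positivity) (by positivity)]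

theorem gradient_coord (φ : Plane → ℝ) (x : Plane) (i : Fin 2) :
    gradient φ x i = fderiv ℝ φ x (EuclideanSpace.single i 1) := by
  rw [← inner_gradient, EuclideanSpace.inner_single_right]
  simp

theorem MemLp.coord {μ : Measure Plane} {F : Plane → Plane} (h : MemLp F 2 μ) (i : Fin 2) :
    MemLp (fun x => F x i) 2 μ := by
  have := h.inner_const (𝕜 := ℝ) (EuclideanSpace.single i 1)
  refine this.ae_eq (ae_of_all _ fun x => ?_)
  simp [EuclideanSpace.inner_single_right]

set_option maxHeartbeats 1000000 in
/-- Near a point with the cone condition, an `H¹` function is approximated by its convolutions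
with kernels supported in small balls placed so that only values in `Ω` are used. -/
theorem exists_isTestFun_near {Ω : Set Plane} (hΩ : IsOpen Ω) (hb : IsBounded Ω) {p : Plane}
    {δ t₀ θ : ℝ} (ht₀ : 0 < t₀) (hθ : 0 < θ) {v : Plane}
    (hcone : ∀ x ∈ Ω ∩ Metric.ball p δ, ∀ t ∈ Ioo (0 : ℝ) t₀, ∀ w : Plane, ‖w‖ < θ →
      x + t • (v + w) ∈ Ω) {χ : Plane → ℝ} (hχ : IsTestFun χ)
    (hχs : tsupport χ ⊆ Metric.ball p δ) (U : H1 Ω) {ε : ℝ≥0∞} (hε : ε ≠ 0) :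
    ∃ φ : Plane → ℝ, ∃ hφ : IsTestFun φ,
      ‖H1.ofC1 Ω hφ.isC1Fun - H1.smulTest hχ U‖ₑ ^ 2 ≤ ε := by
  set V : Plane → ℝ := fun x => χ x * fnOf U x with hV
  set G : Plane → Plane := fun x => χ x • gradOf U x + fnOf U x • gradient χ x with hG
  have hVL : MemLp (Ω.indicator V) 2 volume :=
    (memLp_indicator_iff_restrict hΩ.measurableSet).2 (memLp_smulTest_fn hχ U)
  have hGL : ∀ i : Fin 2, MemLp (Ω.indicator fun x => G x i) 2 volume := fun i =>
    (memLp_indicator_iff_restrict hΩ.measurableSet).2 (MemLp.coord (memLp_smulTest_grad hχ U) i)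
  have hε3 : ε / 3 ≠ 0 := (ENNReal.div_pos hε (by norm_num)).ne'
  obtain ⟨δ₁, hδ₁, h₁⟩ := exists_lintegral_moll_sub_le hVL hε3
  obtain ⟨δ₂, hδ₂, h₂⟩ := exists_lintegral_moll_sub_le (hGL 0) hε3
  obtain ⟨δ₃, hδ₃, h₃⟩ := exists_lintegral_moll_sub_le (hGL 1) hε3
  -- a margin between the support of the cutoff and the complement of the ball
  obtain ⟨δ₄, hδ₄, h₄⟩ : ∃ δ₄ > 0, ∀ x ∉ Metric.ball p δ, ∀ y ∈ tsupport χ, δ₄ ≤ ‖x - y‖ := by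
    obtain ⟨d, hd, hdis⟩ := (show IsCompact (tsupport χ) from hχ.2).exists_cthickening_subset_open
      Metric.isOpen_ball hχs
    refine ⟨d, hd, fun x hx y hy => ?_⟩
    by_contra hlt
    push Not at hlt
    refine hx (hdis (Metric.mem_cthickening_of_dist_le x y d _ hy ?_))
    rw [dist_eq_norm]
    exact hlt.le
  set d := min (min δ₁ δ₂) (min δ₃ δ₄) with hd
  have hd0 : 0 < d := by positivity
  set t := min (t₀ / 2) (d / (‖v‖ + θ)) with ht
  have hsum : 0 < ‖v‖ + θ := by positivity
  have ht0 : 0 < t := by positivity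
  have htt : t < t₀ := (min_le_left _ _).trans_lt (by linarith)
  have htd : t * (‖v‖ + θ) ≤ d := by
    rw [← le_div_iff₀ hsum]; exact min_le_right _ _
  obtain ⟨k, hk, hkc⟩ := exists_isMollifier_ball (-(t • v)) (r := t * θ / 2) (δ := d)
    (by positivity) (by
      rw [norm_neg, norm_smul, Real.norm_eq_abs, abs_of_pos ht0]
      nlinarith [norm_nonneg v])
  have hVi := hVL.locallyIntegrable (by norm_num)
  have hφ : IsTestFun (moll k (Ω.indicator V)) := by
    refine ⟨contDiff_moll hk.isTestFun hVi, ?_⟩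
    refine HasCompactSupport.convolution _ ?_ hk.isTestFun.2
    refine HasCompactSupport.of_support_subset_isCompact hb.isCompact_closure ?_
    exact (support_indicator_subset).trans subset_closure
  -- the weak gradient of the product, tested against translates of the kernel
  have hgrad : ∀ x ∈ Ω, ∀ i : Fin 2,
      gradient (moll k (Ω.indicator V)) x i = moll k (Ω.indicator fun x => G x i) x := by
    intro x hx i
    rw [gradient_coord]
    by_cases hxb : x ∈ Metric.ball p δ
    · refine fderiv_moll_of_weak hΩ.measurableSet hk.isTestFun hVi (fun ψ hψ hs => ?_) ?_
      · have h := (H1.smulTest hχ U).2 ψ hψ hs (EuclideanSpace.single i 1)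
        have e1 : ∫ x in Ω, V x * fderiv ℝ ψ x (EuclideanSpace.single i 1) =
            ∫ x in Ω, fnOf (H1.smulTest hχ U) x * fderiv ℝ ψ x (EuclideanSpace.single i 1) := by
          refine integral_congr_ae ?_
          filter_upwards [fnOf_smulTest hχ U] with y hy
          rw [hy]
        have e2 : ∫ x in Ω, ψ x * G x i =
            ∫ x in Ω, ψ x * inner ℝ (gradOf (H1.smulTest hχ U) x) (EuclideanSpace.single i 1) := by
          refine integral_congr_ae ?_
          filter_upwards [gradOf_smulTest hχ U] with y hy
          rw [hy, EuclideanSpace.inner_single_right]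
          simp [hG]
        rw [e1, e2]
        exact h
      · have hsub : Function.support (fun y => k (x - y)) ⊆
            Metric.closedBall (x + t • v) (t * θ / 2) := by
          intro y hy
          have := hkc _ hy
          rw [Metric.mem_closedBall, dist_eq_norm, norm_sub_rev]
          refine le_of_eq_of_le ?_ this.le
          congr 1
          abel
        refine (closure_minimal hsub Metric.isClosed_closedBall).trans fun y hy => ?_
        rw [Metric.mem_closedBall, dist_eq_norm] at hy
        have hy' : y = x + t • (v + t⁻¹ • (y - (x + t • v))) := by
          rw [smul_add, smul_smul, mul_inv_cancel₀ ht0.ne', one_smul]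
          abel
        rw [hy']
        refine hcone x ⟨hx, hxb⟩ t ⟨ht0, htt⟩ _ ?_
        rw [norm_smul, Real.norm_eq_abs, abs_of_pos (by positivity), inv_mul_lt_iff₀ ht0]
        nlinarith
    · have hz : ∀ y, k (x - y) ≠ 0 → y ∉ tsupport χ := by
        intro y hy hys
        have h5 := hk.norm_lt _ hy
        have h6 := h₄ x hxb y hys
        have h7 : d ≤ δ₄ := (min_le_right _ _).trans (min_le_right _ _)
        linarith
      have hzχ : ∀ y, k (x - y) ≠ 0 → χ y = 0 ∧ gradient χ y = 0 := by
        intro y hy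
        refine ⟨image_eq_zero_of_notMem_tsupport (hz y hy), ?_⟩
        have : fderiv ℝ χ y = 0 := image_eq_zero_of_notMem_tsupport
          (fun h => hz y hy (tsupport_fderiv_subset (𝕜 := ℝ) h))
        rw [gradient, this, map_zero]
      have hz' : ∀ y, fderiv ℝ k (x - y) ≠ 0 → y ∉ tsupport χ := by
        intro y hy hys
        have hmem : x - y ∈ tsupport k := tsupport_fderiv_subset (𝕜 := ℝ) (subset_tsupport _ hy)
        have h5 : x - y ∈ Metric.closedBall (-(t • v)) (t * θ / 2) := by
          refine closure_minimal (fun z hz => ?_) Metric.isClosed_closedBall hmem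
          rw [Metric.mem_closedBall, dist_eq_norm]
          exact (hkc z hz).le
        rw [Metric.mem_closedBall, dist_eq_norm] at h5
        have h6 := h₄ x hxb y hys
        have h7 : d ≤ δ₄ := (min_le_right _ _).trans (min_le_right _ _)
        have h8 : ‖x - y‖ ≤ ‖x - y - -(t • v)‖ + ‖-(t • v)‖ := by
          simpa using norm_add_le (x - y - -(t • v)) (-(t • v))
        rw [norm_neg (t • v), norm_smul, Real.norm_eq_abs, abs_of_pos ht0] at h8
        nlinarith [mul_pos ht0 hθ]
      rw [fderiv_moll hk.isTestFun hVi, moll_apply, moll_apply]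
      refine integral_congr_ae (ae_of_all _ fun y => ?_)
      by_cases hyΩ : y ∈ Ω
      · simp only [indicator_of_mem hyΩ, hV, hG]
        have e1 : χ y * fnOf U y * fderiv ℝ k (x - y) (EuclideanSpace.single i 1) = 0 := by
          by_cases hk0 : fderiv ℝ k (x - y) = 0
          · simp [hk0]
          · rw [image_eq_zero_of_notMem_tsupport (hz' y hk0)]; simp
        rw [e1]
        by_cases hk0 : k (x - y) = 0
        · simp [hk0]
        · obtain ⟨h5, h6⟩ := hzχ y hk0
          simp [h5, h6]
      · simp [hyΩ]
  refine ⟨_, hφ, ?_⟩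
  have hsubg : gradOf (H1.ofC1 Ω hφ.isC1Fun - H1.smulTest hχ U) =ᵐ[volume.restrict Ω]
      fun x => gradient (moll k (Ω.indicator V)) x - G x := by
    have := Lp.coeFn_sub (gradOf (H1.ofC1 Ω hφ.isC1Fun)) (gradOf (H1.smulTest hχ U))
    refine (this : gradOf (H1.ofC1 Ω hφ.isC1Fun - H1.smulTest hχ U) =ᵐ[volume.restrict Ω] _).trans ?_
    filter_upwards [gradOf_ofC1 Ω hφ.isC1Fun, gradOf_smulTest hχ U] with x h1 h2
    simp [h1, h2, hG]
  have hsubf : fnOf (H1.ofC1 Ω hφ.isC1Fun - H1.smulTest hχ U) =ᵐ[volume.restrict Ω]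
      fun x => moll k (Ω.indicator V) x - V x := by
    have := Lp.coeFn_sub (fnOf (H1.ofC1 Ω hφ.isC1Fun)) (fnOf (H1.smulTest hχ U))
    refine (this : fnOf (H1.ofC1 Ω hφ.isC1Fun - H1.smulTest hχ U) =ᵐ[volume.restrict Ω] _).trans ?_
    filter_upwards [fnOf_ofC1 Ω hφ.isC1Fun, fnOf_smulTest hχ U] with x h1 h2
    simp [h1, h2, hV]
  have hmain : ∀ {f : Plane → ℝ} {δ' : ℝ}, d ≤ δ' → (∀ k δ'', δ'' ≤ δ' → IsMollifier k δ'' →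
      ∫⁻ x, ‖moll k (Ω.indicator f) x - Ω.indicator f x‖ₑ ^ 2 ≤ ε / 3) →
      ∫⁻ x in Ω, ‖moll k (Ω.indicator f) x - f x‖ₑ ^ 2 ≤ ε / 3 := by
    intro f δ' hδ' h
    refine le_trans ?_ (h k d hδ' hk)
    refine le_trans (le_of_eq ?_) (setLIntegral_le_lintegral Ω _)
    refine setLIntegral_congr_fun hΩ.measurableSet fun x hx => ?_
    simp only [indicator_of_mem hx]
  rw [H1.enorm_sq]
  calc _ = (∫⁻ x in Ω, ‖moll k (Ω.indicator V) x - V x‖ₑ ^ 2) +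
        ∫⁻ x in Ω, (‖moll k (Ω.indicator fun x => G x 0) x - G x 0‖ₑ ^ 2 +
          ‖moll k (Ω.indicator fun x => G x 1) x - G x 1‖ₑ ^ 2) := by
        congr 1
        · refine lintegral_congr_ae ?_
          filter_upwards [hsubf] with x hx
          rw [hx]
        · refine lintegral_congr_ae ?_
          filter_upwards [hsubg, ae_restrict_mem hΩ.measurableSet] with x hx hxΩ
          rw [hx, enorm_sq_eq_coords, PiLp.sub_apply, PiLp.sub_apply, hgrad x hxΩ, hgrad x hxΩ]
    _ = (∫⁻ x in Ω, ‖moll k (Ω.indicator V) x - V x‖ₑ ^ 2) +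
        ((∫⁻ x in Ω, ‖moll k (Ω.indicator fun x => G x 0) x - G x 0‖ₑ ^ 2) +
          ∫⁻ x in Ω, ‖moll k (Ω.indicator fun x => G x 1) x - G x 1‖ₑ ^ 2) := by
        congr 1
        refine lintegral_add_left' ?_ _
        refine (AEMeasurable.enorm (AEMeasurable.sub ?_ ?_)).pow_const 2
        · exact (contDiff_moll hk.isTestFun
            ((hGL 0).locallyIntegrable (by norm_num))).continuous.measurable.aemeasurable
        · exact (MemLp.coord (memLp_smulTest_grad hχ U) 0).1.aemeasurable
    _ ≤ ε / 3 + (ε / 3 + ε / 3) := by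
        gcongr
        · exact hmain ((min_le_left _ _).trans (min_le_left _ _)) h₁
        · exact hmain ((min_le_left _ _).trans (min_le_right _ _)) h₂
        · exact hmain ((min_le_right _ _).trans (min_le_left _ _)) h₃
    _ = ε := by rw [← add_assoc, ENNReal.add_thirds]

theorem coeFn_finset_sum {α ι : Type*} [MeasurableSpace α] {μ : Measure α} (t : Finset ι)
    (f : ι → Lp ℝ 2 μ) : ∀ᵐ x ∂μ, (∑ i ∈ t, f i : Lp ℝ 2 μ) x = ∑ i ∈ t, f i x := by
  classical
  induction t using Finset.induction_on with
  | empty =>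
    filter_upwards [Lp.coeFn_zero ℝ 2 μ] with x hx
    simpa using hx
  | insert i t hi ih =>
    rw [Finset.sum_insert hi]
    filter_upwards [Lp.coeFn_add (f i) (∑ j ∈ t, f j), ih] with x h1 h2
    rw [h1, Pi.add_apply, h2, Finset.sum_insert hi]

/-- The restrictions of test functions to `Ω`. -/
def testSubspace (Ω : Set Plane) : Submodule ℝ (H1 Ω) :=
  (smoothTracePairs Ω ∅).map (LinearMap.fst ℝ (H1 Ω) (Lp ℝ 2 (arcLength ∅)))

theorem mem_testSubspace {Ω : Set Plane} {φ : Plane → ℝ} (hφ : IsTestFun φ) :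
    H1.ofC1 Ω hφ.isC1Fun ∈ testSubspace Ω := by
  refine ⟨(H1.ofC1 Ω hφ.isC1Fun, 0), ⟨φ, hφ, fnOf_ofC1 Ω hφ.isC1Fun, ?_⟩, rfl⟩
  have : arcLength ∅ = 0 := by simp [arcLength_def]
  rw [this]
  exact ae_zero.symm ▸ trivial

/-- Restrictions of test functions are dense in `H¹(Ω)`. -/
theorem dense_testSubspace {Ω : Set Plane} (hΩ : IsOpen Ω) (hb : IsBounded Ω)
    (hcone : ∀ p ∈ closure Ω, ConeAt Ω p) : (testSubspace Ω).topologicalClosure = ⊤ := by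
  have hK : IsCompact (closure Ω) := hb.isCompact_closure
  choose! δ hδ t₀ ht₀ θ hθ v hv using hcone
  obtain ⟨t, χ, htK, hχ, hsum⟩ := exists_partition hK hδ
  rw [eq_top_iff]
  rintro U -
  classical
  have hU : U = ∑ i ∈ t.attach, H1.smulTest (hχ i i.2).1 U := by
    refine H1.ext_fnOf hΩ ?_
    have h1 : fnOf (∑ i ∈ t.attach, H1.smulTest (hχ i i.2).1 U)
        = ∑ i ∈ t.attach, fnOf (H1.smulTest (hχ i i.2).1 U) := map_sum (fnOfL Ω) _ _
    rw [h1]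
    have h2 : ∀ᵐ x ∂(volume.restrict Ω), ∀ i : t,
        fnOf (H1.smulTest (hχ i i.2).1 U) x = χ i x * fnOf U x :=
      ae_all_iff.2 fun i => fnOf_smulTest (hχ i i.2).1 U
    filter_upwards [h2, coeFn_finset_sum t.attach fun i => fnOf (H1.smulTest (hχ i i.2).1 U),
      ae_restrict_mem hΩ.measurableSet] with x hx hx2 hxΩ
    rw [hx2]
    simp only [hx]
    rw [← Finset.sum_mul, Finset.sum_attach t fun i => χ i x, hsum x (subset_closure hxΩ), one_mul]
  rw [hU]
  refine Submodule.sum_mem _ fun i _ => ?_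
  rw [← SetLike.mem_coe, Submodule.topologicalClosure_coe, EMetric.mem_closure_iff]
  intro ε hε
  have hiK := htK i i.2
  have he2 : (min 1 (ε / 2)) ^ 2 ≠ 0 := pow_ne_zero _
    (lt_min zero_lt_one (ENNReal.div_pos hε.ne' (by norm_num))).ne'
  obtain ⟨φ, hφ, h⟩ := exists_isTestFun_near hΩ hb (ht₀ i hiK) (hθ i hiK) (hv i hiK)
    (hχ i i.2).1 (hχ i i.2).2 U he2
  refine ⟨_, mem_testSubspace hφ, ?_⟩
  rw [edist_comm, edist_eq_enorm_sub]
  have h3 : ‖H1.ofC1 Ω hφ.isC1Fun - H1.smulTest (hχ i i.2).1 U‖ₑ ≤ min 1 (ε / 2) :=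
    (ENNReal.pow_le_pow_left_iff two_ne_zero).1 h
  refine h3.trans_lt ?_
  by_cases hεt : ε = ⊤
  · rw [hεt]; exact (min_le_left _ _).trans_lt ENNReal.one_lt_top
  · exact (min_le_right _ _).trans_lt (ENNReal.half_lt_self hε.ne' hεt)

/-! ### Bounded operators from their graphs -/

section Graphs

variable {E F : Type*} [NormedAddCommGroup E] [NormedSpace ℝ E] [NormedAddCommGroup F]
  [NormedSpace ℝ F]

theorem norm_snd_le_of_mem_closure {P : Submodule ℝ (E × F)} {C : ℝ}
    (hP : ∀ p ∈ P, ‖p.2‖ ≤ C * ‖p.1‖) {p : E × F} (hp : p ∈ P.topologicalClosure) :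
    ‖p.2‖ ≤ C * ‖p.1‖ := by
  have hc : IsClosed {p : E × F | ‖p.2‖ ≤ C * ‖p.1‖} :=
    isClosed_le continuous_snd.norm (continuous_const.mul continuous_fst.norm)
  exact closure_minimal hP hc hp

/-- If the second components of a subspace of `E × F` are controlled by the first, then its
closure contains a point above every point of the closure of its projection. -/
theorem exists_mem_closure_of_norm_le [CompleteSpace F] {P : Submodule ℝ (E × F)} {C : ℝ}
    (hP : ∀ p ∈ P, ‖p.2‖ ≤ C * ‖p.1‖) {h : E}
    (hh : h ∈ (P.map (LinearMap.fst ℝ E F)).topologicalClosure) :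
    ∃ y, (h, y) ∈ P.topologicalClosure := by
  rw [← SetLike.mem_coe, Submodule.topologicalClosure_coe, mem_closure_iff_seq_limit] at hh
  obtain ⟨x, hx, hlim⟩ := hh
  choose p hpP hpx using hx
  have hcau : CauchySeq fun n => (p n).2 := by
    have h1 := hlim.cauchySeq
    rw [Metric.cauchySeq_iff'] at h1 ⊢
    intro ε hε
    obtain ⟨N, hN⟩ := h1 (ε / (|C| + 1)) (by positivity)
    refine ⟨N, fun n hn => ?_⟩
    have h2 := hN n hn
    rw [lt_div_iff₀ (by positivity), ← hpx, ← hpx] at h2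
    have h3 := hP _ (P.sub_mem (hpP n) (hpP N))
    rw [dist_eq_norm] at h2 ⊢
    calc ‖(p n).2 - (p N).2‖ ≤ C * ‖(p n).1 - (p N).1‖ := h3
      _ ≤ (|C| + 1) * ‖(p n).1 - (p N).1‖ := by
          gcongr
          linarith [le_abs_self C]
      _ = ‖(p n).1 - (p N).1‖ * (|C| + 1) := mul_comm _ _
      _ < ε := h2
  obtain ⟨y, hy⟩ := cauchySeq_tendsto_of_complete hcau
  refine ⟨y, ?_⟩
  rw [← SetLike.mem_coe, Submodule.topologicalClosure_coe]
  refine mem_closure_of_tendsto (b := atTop) (f := p) ?_ (Eventually.of_forall hpP)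
  have hlim' : Tendsto (fun n => (p n).1) atTop (𝓝 h) := by
    refine hlim.congr fun n => ?_
    rw [← hpx]
    rfl
  exact hlim'.prodMk_nhds hy

/-- A linear relation that is total, single-valued and bounded is the graph of a bounded
operator. -/
theorem exists_clm_of_relation {R : E → F → Prop} {C : ℝ}
    (hadd : ∀ g h y z, R g y → R h z → R (g + h) (y + z))
    (hsmul : ∀ (a : ℝ) g y, R g y → R (a • g) (a • y))
    (hex : ∀ g, ∃ y, R g y ∧ ‖y‖ ≤ C * ‖g‖) (h0 : ∀ y, R 0 y → y = 0) (hC : 0 ≤ C) :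
    ∃ T : E →L[ℝ] F, (∀ g y, T g = y ↔ R g y) ∧ ‖T‖ ≤ C := by
  choose T hT hTC using hex
  have huniq : ∀ g y, R g y → T g = y := by
    intro g y h
    have h1 := hadd _ _ _ _ (hT g) (hsmul (-1) _ _ h)
    rw [neg_one_smul, neg_one_smul, ← sub_eq_add_neg, ← sub_eq_add_neg, sub_self] at h1
    exact sub_eq_zero.1 (h0 _ h1)
  refine ⟨LinearMap.mkContinuous
    { toFun := T
      map_add' := fun g h => huniq _ _ (hadd _ _ _ _ (hT g) (hT h))
      map_smul' := fun a g => huniq _ _ (hsmul a _ _ (hT g)) } C hTC, ?_,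
    LinearMap.mkContinuous_norm_le _ hC _⟩
  intro g y
  refine ⟨?_, huniq g y⟩
  rintro rfl
  exact hT g

/-- A subspace of `E × F` that projects onto `E` and whose second components are controlled by the
first is the graph of a bounded operator. -/
theorem exists_clm_of_submodule {P : Submodule ℝ (E × F)} {C : ℝ}
    (hP : ∀ p ∈ P, ‖p.2‖ ≤ C * ‖p.1‖) (hex : ∀ g, ∃ y, (g, y) ∈ P) (hC : 0 ≤ C) :
    ∃ T : E →L[ℝ] F, (∀ g y, T g = y ↔ (g, y) ∈ P) ∧ ‖T‖ ≤ C := by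
  refine exists_clm_of_relation (R := fun g y => (g, y) ∈ P)
    (fun g h y z hg hh => P.add_mem hg hh) (fun a g y h => P.smul_mem a h)
    (fun g => ?_) (fun y h => ?_) hC
  · obtain ⟨y, hy⟩ := hex g
    exact ⟨y, hy, hP _ hy⟩
  · have h1 := hP _ h
    simpa using h1

/-- An inequality `‖u - M u • e‖ ≤ K ‖G u‖` follows from the existence of some multiple of `e` with
the same property, if `M e = 1`. -/
theorem norm_sub_smul_le_of_norm_sub_smul_le {M : E →L[ℝ] ℝ} {e u : E} {a B : ℝ} (he : M e = 1)
    (h : ‖u - a • e‖ ≤ B) : ‖u - M u • e‖ ≤ (1 + ‖M‖ * ‖e‖) * B := by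
  have h2 : u - M u • e = (u - a • e) - M (u - a • e) • e := by
    rw [map_sub, map_smul, he, smul_eq_mul, mul_one, sub_smul]
    abel
  calc ‖u - M u • e‖ ≤ ‖u - a • e‖ + ‖M (u - a • e) • e‖ := by
        rw [h2]; exact norm_sub_le _ _
    _ ≤ ‖u - a • e‖ + (‖M‖ * ‖u - a • e‖) * ‖e‖ := by
        rw [norm_smul]
        gcongr
        exact M.le_opNorm _
    _ = (1 + ‖M‖ * ‖e‖) * ‖u - a • e‖ := by ring
    _ ≤ _ := by gcongr

theorem norm_le_of_mem_topologicalClosure {P : Submodule ℝ E} {S : E →L[ℝ] E} {G : E →L[ℝ] F}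
    {K : ℝ} (hP : ∀ u ∈ P, ‖S u‖ ≤ K * ‖G u‖) {u : E} (hu : u ∈ P.topologicalClosure) :
    ‖S u‖ ≤ K * ‖G u‖ := by
  have hcl : IsClosed {u : E | ‖S u‖ ≤ K * ‖G u‖} :=
    isClosed_le S.continuous.norm (continuous_const.mul G.continuous.norm)
  exact closure_minimal hP hcl hu

end Graphs

/-! ### Traces -/

-- Instances that search finds only slowly through the definition of `H1` as a submodule.

instance (Ω : Set Plane) : Module ℝ (H1 Ω) := Submodule.module _
instance (Ω : Set Plane) : SMul ℝ (H1 Ω) := Module.toDistribMulAction.toSMul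
instance (Ω : Set Plane) : AddCommGroup (H1 Ω) := Submodule.addCommGroup _
instance (Ω : Set Plane) : NormedAddCommGroup (H1 Ω) := Submodule.normedAddCommGroup _
instance (Ω : Set Plane) : NormedSpace ℝ (H1 Ω) := Submodule.normedSpace _

theorem fnOf_sub {Ω : Set Plane} (U V : H1 Ω) : fnOf (U - V) = fnOf U - fnOf V := rfl
theorem fnOf_smul {Ω : Set Plane} (a : ℝ) (U : H1 Ω) : fnOf (a • U) = a • fnOf U := rfl
theorem gradOf_sub {Ω : Set Plane} (U V : H1 Ω) : gradOf (U - V) = gradOf U - gradOf V := rfl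
theorem gradOf_smul {Ω : Set Plane} (a : ℝ) (U : H1 Ω) : gradOf (a • U) = a • gradOf U := rfl

theorem norm_sq_le_of_enorm_sq_le {E F : Type*} [NormedAddCommGroup E] [NormedAddCommGroup F]
    {x : E} {y : F} {C : ℝ≥0} (h : ‖x‖ₑ ^ 2 ≤ C * ‖y‖ₑ ^ 2) : ‖x‖ ≤ Real.sqrt C * ‖y‖ := by
  have h1 : ‖x‖₊ ^ 2 ≤ C * ‖y‖₊ ^ 2 := by
    rw [enorm_eq_nnnorm, enorm_eq_nnnorm] at h
    exact_mod_cast h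
  have h2 : ‖x‖ ^ 2 ≤ C * ‖y‖ ^ 2 := by exact_mod_cast h1
  calc ‖x‖ = Real.sqrt (‖x‖ ^ 2) := (Real.sqrt_sq (norm_nonneg _)).symm
    _ ≤ Real.sqrt (C * ‖y‖ ^ 2) := Real.sqrt_le_sqrt h2
    _ = _ := by rw [Real.sqrt_mul (NNReal.coe_nonneg C), Real.sqrt_sq (norm_nonneg _)]

theorem norm_snd_le_of_mem_smoothTracePairs {Ω Γ : Set Plane} (hΩ : IsOpen Ω) {C : ℝ≥0}
    (hC : ∀ φ : Plane → ℝ, IsC1Fun φ → ∫⁻ x, ‖φ x‖ₑ ^ 2 ∂(arcLength Γ) ≤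
        C * ((∫⁻ x in Ω, ‖φ x‖ₑ ^ 2) + ∫⁻ x in Ω, ‖fderiv ℝ φ x‖ₑ ^ 2))
    {P : H1 Ω × Lp ℝ 2 (arcLength Γ)} (hP : P ∈ smoothTracePairs Ω Γ) :
    ‖P.2‖ ≤ Real.sqrt C * ‖P.1‖ := by
  obtain ⟨φ, hφ, h1, h2⟩ := hP
  refine norm_sq_le_of_enorm_sq_le ?_
  rw [H1.eq_ofC1 hΩ hφ.isC1Fun h1, enorm_ofC1_sq, enorm_sq_eq_lintegral]
  refine le_trans (le_of_eq ?_) (hC φ hφ.isC1Fun)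
  refine lintegral_congr_ae ?_
  filter_upwards [h2] with x hx
  rw [hx]

theorem mem_smoothTracePairs_ofC1 {Ω Γ : Set Plane} {φ : Plane → ℝ} (hφ : IsTestFun φ)
    (h : MemLp φ 2 (arcLength Γ)) :
    (H1.ofC1 Ω hφ.isC1Fun, h.toLp φ) ∈ smoothTracePairs Ω Γ :=
  ⟨φ, hφ, fnOf_ofC1 Ω hφ.isC1Fun, h.coeFn_toLp⟩

theorem memLp_arcLength {Γ : Set Plane} (hΓ : arcLength Γ univ < ⊤) {φ : Plane → ℝ}
    (h : IsC1Fun φ) : MemLp φ 2 (arcLength Γ) := by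
  have : IsFiniteMeasure (arcLength Γ) := ⟨hΓ⟩
  exact h.memLp _

namespace IsHolderDomain

variable {η : ℝ≥0} {D : Set Plane}

theorem exists_trace_bound (hD : IsHolderDomain η D) : ∃ C : ℝ, 0 ≤ C ∧
    ∀ P ∈ traceGraph D (frontier D), ‖P.2‖ ≤ C * ‖P.1‖ := by
  obtain ⟨C, hC⟩ := exists_trace_inequality hD.isOpen.measurableSet (isCompact_frontier hD)
    fun p hp => by
      obtain ⟨r, L, γ, K, h, -⟩ := hD.exists_isGraphAt hp
      exact ⟨r, L, γ, K, h⟩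
  refine ⟨Real.sqrt C, Real.sqrt_nonneg _, fun P hP => ?_⟩
  exact norm_snd_le_of_mem_closure
    (fun P hP => norm_snd_le_of_mem_smoothTracePairs hD.isOpen hC hP) hP

theorem exists_mem_traceGraph (hD : IsHolderDomain η D) (U : H1 D) :
    ∃ f, (U, f) ∈ traceGraph D (frontier D) := by
  obtain ⟨C, -, hC⟩ := hD.exists_trace_bound
  refine exists_mem_closure_of_norm_le (P := smoothTracePairs D (frontier D))
    (fun P hP => hC P (Submodule.le_topologicalClosure _ hP)) ?_
  have h1 := dense_testSubspace hD.isOpen hD.isBounded (fun p hp => hD.coneAt hp)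
  have h2 : testSubspace D ≤ (smoothTracePairs D (frontier D)).map
      (LinearMap.fst ℝ (H1 D) (Lp ℝ 2 (arcLength (frontier D)))) := by
    rintro _ ⟨P, ⟨φ, hφ, h3, -⟩, rfl⟩
    refine ⟨_, mem_smoothTracePairs_ofC1 hφ (memLp_arcLength hD.arcLength_lt_top hφ.isC1Fun), ?_⟩
    exact (H1.eq_ofC1 hD.isOpen hφ.isC1Fun h3).symm
  refine Submodule.topologicalClosure_mono h2 ?_
  rw [h1]
  trivial

theorem exists_trace (hD : IsHolderDomain η D) :
    ∃ T : H1 D →L[ℝ] Lp ℝ 2 (arcLength (frontier D)),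
      ∀ U f, T U = f ↔ (U, f) ∈ traceGraph D (frontier D) := by
  obtain ⟨C, hC0, hC⟩ := hD.exists_trace_bound
  obtain ⟨T, hT, -⟩ := exists_clm_of_submodule hC hD.exists_mem_traceGraph hC0
  exact ⟨T, hT⟩

/-- The trace operator `H¹(D) → L²(∂D)`. -/
def trace (hD : IsHolderDomain η D) : H1 D →L[ℝ] Lp ℝ 2 (arcLength (frontier D)) :=
  hD.exists_trace.choose

theorem trace_eq_iff (hD : IsHolderDomain η D) (U : H1 D) (f) :
    hD.trace U = f ↔ (U, f) ∈ traceGraph D (frontier D) := hD.exists_trace.choose_spec U f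

theorem mem_traceGraph (hD : IsHolderDomain η D) (U : H1 D) :
    (U, hD.trace U) ∈ traceGraph D (frontier D) := (hD.trace_eq_iff U _).1 rfl

theorem boundaryValue_eq_iff (hD : IsHolderDomain η D) (U V : H1 D) :
    boundaryValue U = boundaryValue V ↔ hD.trace U = hD.trace V := by
  have h1 : boundaryValue U = boundaryValue V ↔ U - V ∈ traceKer D :=
    Submodule.Quotient.eq (traceKer D)
  rw [h1, ← sub_eq_zero (a := hD.trace U), ← map_sub, hD.trace_eq_iff]
  rfl

theorem arcLength_finite (hD : IsHolderDomain η D) : IsFiniteMeasure (arcLength (frontier D)) :=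
  ⟨hD.arcLength_lt_top⟩

/-- The trace of a `C¹` function is its restriction. It is approximated in `H¹(D)` by test
functions, and so on the boundary by the trace inequality. -/
theorem trace_ofC1 (hD : IsHolderDomain η D) {φ : Plane → ℝ} (hφ : IsC1Fun φ) :
    hD.trace (H1.ofC1 D hφ) =ᵐ[arcLength (frontier D)] φ := by
  obtain ⟨C, hC⟩ := exists_trace_inequality hD.isOpen.measurableSet (isCompact_frontier hD)
    fun p hp => by
      obtain ⟨r, L, γ, K, h, -⟩ := hD.exists_isGraphAt hp
      exact ⟨r, L, γ, K, h⟩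
  have hL : ∀ {ψ : Plane → ℝ}, IsC1Fun ψ → MemLp ψ 2 (arcLength (frontier D)) :=
    fun h => memLp_arcLength hD.arcLength_lt_top h
  have htest : ∀ {ψ : Plane → ℝ} (h : IsTestFun ψ),
      hD.trace (H1.ofC1 D h.isC1Fun) = (hL h.isC1Fun).toLp ψ := fun h =>
    (hD.trace_eq_iff _ _).2 (Submodule.le_topologicalClosure _ (mem_smoothTracePairs_ofC1 h _))
  have hmem : H1.ofC1 D hφ ∈ (testSubspace D).topologicalClosure := by
    rw [dense_testSubspace hD.isOpen hD.isBounded fun p hp => hD.coneAt hp]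
    trivial
  rw [← SetLike.mem_coe, Submodule.topologicalClosure_coe, mem_closure_iff_seq_limit] at hmem
  obtain ⟨V, hV, hlim⟩ := hmem
  have hV' : ∀ n, ∃ ψ : Plane → ℝ, ∃ h : IsTestFun ψ, V n = H1.ofC1 D h.isC1Fun := by
    intro n
    obtain ⟨P, ⟨ψ, hψ, h3, -⟩, h4⟩ := hV n
    exact ⟨ψ, hψ, by rw [← h4]; exact H1.eq_ofC1 hD.isOpen hψ.isC1Fun h3⟩
  choose ψ hψ hVψ using hV'
  have h1 : Tendsto (fun n => hD.trace (V n)) atTop (𝓝 (hD.trace (H1.ofC1 D hφ))) :=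
    (hD.trace.continuous.tendsto _).comp hlim
  have h2 : Tendsto (fun n => hD.trace (V n)) atTop (𝓝 ((hL hφ).toLp φ)) := by
    rw [tendsto_iff_norm_sub_tendsto_zero] at hlim ⊢
    have h5 := hlim.const_mul (Real.sqrt C)
    rw [mul_zero] at h5
    refine squeeze_zero (fun _ => norm_nonneg _) (fun n => ?_) h5
    refine norm_sq_le_of_enorm_sq_le ?_
    have hs := (hψ n).isC1Fun.sub hφ
    have e1 : V n - H1.ofC1 D hφ = H1.ofC1 D hs := by
      refine H1.eq_ofC1 hD.isOpen hs ?_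
      rw [hVψ n]
      refine (Lp.coeFn_sub (fnOf (H1.ofC1 D (hψ n).isC1Fun)) (fnOf (H1.ofC1 D hφ))).trans ?_
      filter_upwards [fnOf_ofC1 D (hψ n).isC1Fun, fnOf_ofC1 D hφ] with x hx hy
      simp [hx, hy]
    have e2 : hD.trace (V n) - (hL hφ).toLp φ = (hL hs).toLp (ψ n - φ) := by
      rw [hVψ n, htest (hψ n)]
      exact (MemLp.toLp_sub _ _).symm
    rw [e1, e2, enorm_ofC1_sq, enorm_sq_eq_lintegral]
    refine le_trans (le_of_eq ?_) (hC _ hs)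
    refine lintegral_congr_ae ?_
    filter_upwards [(hL hs).coeFn_toLp] with x hx
    rw [hx]
  rw [tendsto_nhds_unique h1 h2]
  exact (hL hφ).coeFn_toLp

end IsHolderDomain

/-! ### The mean over the boundary -/

instance (D : Set Plane) : CompleteSpace (HHalf D) :=
  inferInstanceAs (CompleteSpace (H1 D ⧸ traceKer D))

theorem norm_boundaryValue_le {D : Set Plane} (U : H1 D) : ‖boundaryValue U‖ ≤ ‖U‖ :=
  Submodule.Quotient.norm_mk_le (traceKer D) U

theorem exists_boundaryValue_eq {D : Set Plane} (q : HHalf D) {ε : ℝ} (hε : 0 < ε) :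
    ∃ U, boundaryValue U = q ∧ ‖U‖ < ‖q‖ + ε :=
  Submodule.Quotient.norm_mk_lt (S := traceKer D) q hε

/-- The map to boundary values as a bounded operator. -/
def boundaryValueL (D : Set Plane) : H1 D →L[ℝ] HHalf D :=
  LinearMap.mkContinuous boundaryValue 1 fun U => by
    rw [one_mul]; exact norm_boundaryValue_le U

namespace IsHolderDomain

variable {η : ℝ≥0} {D : Set Plane}

/-- The average over the boundary, as a bounded functional on `L²(∂D)`. -/
theorem exists_average (hD : IsHolderDomain η D) :
    ∃ A : Lp ℝ 2 (arcLength (frontier D)) →L[ℝ] ℝ,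
      ∀ f, A f = ⨍ y, f y ∂(arcLength (frontier D)) := by
  refine ⟨((arcLength (frontier D)).real univ)⁻¹ • innerSL ℝ
    (indicatorConstLp 2 MeasurableSet.univ hD.arcLength_lt_top.ne (1 : ℝ)), fun f => ?_⟩
  rw [average_eq, smul_apply, innerSL_apply_apply, L2.inner_indicatorConstLp_one,
    Measure.restrict_univ]

theorem exists_mean (hD : IsHolderDomain η D) : ∃ m : HHalf D →L[ℝ] ℝ,
    ∀ U : H1 D, m (boundaryValue U) = ⨍ y, hD.trace U y ∂(arcLength (frontier D)) := by
  obtain ⟨A, hA⟩ := hD.exists_average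
  refine ⟨(traceKer D).liftQL (A.comp hD.trace) ?_, fun U => hA _⟩
  intro U hU
  have : hD.trace U = 0 := (hD.trace_eq_iff U 0).2 hU
  simp [this]

/-- The mean of the boundary values, as a functional on `H^{1/2}(∂D)`. -/
def mean (hD : IsHolderDomain η D) : HHalf D →L[ℝ] ℝ := hD.exists_mean.choose

theorem mean_boundaryValue (hD : IsHolderDomain η D) (U : H1 D) :
    hD.mean (boundaryValue U) = ⨍ y, hD.trace U y ∂(arcLength (frontier D)) :=
  hD.exists_mean.choose_spec U

theorem arcLength_real_ne_zero (hD : IsHolderDomain η D) :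
    (arcLength (frontier D)).real univ ≠ 0 := by
  have := hD.arcLength_finite
  exact (measureReal_ne_zero_iff).2 hD.arcLength_pos.ne'

theorem mem_HHalf0_iff (hD : IsHolderDomain η D) (q : HHalf D) :
    q ∈ HHalf0 D ↔ hD.mean q = 0 := by
  have := hD.arcLength_finite
  constructor
  · rintro ⟨U, f, rfl, hf, -, h0⟩
    rw [mean_boundaryValue, (hD.trace_eq_iff U f).2 hf, average_eq, h0, smul_zero]
  · intro h
    obtain ⟨U, rfl⟩ := Submodule.Quotient.mk_surjective (traceKer D) q
    refine ⟨U, hD.trace U, rfl, hD.mem_traceGraph U, ?_, ?_⟩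
    · exact (Lp.memLp (hD.trace U)).integrable (by norm_num)
    · have h' : hD.mean (boundaryValue U) = 0 := h
      rw [mean_boundaryValue, average_eq, smul_eq_mul] at h'
      exact (mul_eq_zero.1 h').resolve_left (inv_ne_zero hD.arcLength_real_ne_zero)

theorem isClosed_HHalf0 (hD : IsHolderDomain η D) : IsClosed (HHalf0 D : Set (HHalf D)) := by
  have : (HHalf0 D : Set (HHalf D)) = {q | hD.mean q = 0} := by
    ext q; exact hD.mem_HHalf0_iff q
  rw [this]
  exact isClosed_eq hD.mean.continuous continuous_const

theorem exists_cutoff (hD : IsHolderDomain η D) :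
    ∃ χ : Plane → ℝ, IsTestFun χ ∧ ∀ x ∈ closure D, χ x = 1 := by
  obtain ⟨R, hR⟩ := hD.isBounded.closure.exists_norm_le
  obtain ⟨χ, hχ, h1, -⟩ := exists_isTestFun_eq_one R
  exact ⟨χ, hχ, fun x hx => h1 x (hR x hx)⟩

/-- The constant function `1` in `H¹(D)`. -/
def one (hD : IsHolderDomain η D) : H1 D := H1.ofC1 D hD.exists_cutoff.choose_spec.1.isC1Fun

theorem fnOf_one (hD : IsHolderDomain η D) :
    fnOf hD.one =ᵐ[volume.restrict D] fun _ => (1 : ℝ) := by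
  filter_upwards [fnOf_ofC1 D hD.exists_cutoff.choose_spec.1.isC1Fun,
    ae_restrict_mem hD.isOpen.measurableSet] with x hx hxD
  exact hx.trans (hD.exists_cutoff.choose_spec.2 x (subset_closure hxD))

theorem gradOf_one (hD : IsHolderDomain η D) : gradOf hD.one = 0 := by
  refine (Lp.eq_zero_iff_ae_eq_zero).2 ?_
  filter_upwards [gradOf_ofC1 D hD.exists_cutoff.choose_spec.1.isC1Fun,
    ae_restrict_mem hD.isOpen.measurableSet] with x hx hxD
  refine hx.trans ?_
  have : hD.exists_cutoff.choose =ᶠ[𝓝 x] fun _ => (1 : ℝ) := by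
    filter_upwards [hD.isOpen.mem_nhds hxD] with y hy
    exact hD.exists_cutoff.choose_spec.2 y (subset_closure hy)
  simp [gradient, this.fderiv_eq]

theorem trace_one (hD : IsHolderDomain η D) :
    hD.trace hD.one =ᵐ[arcLength (frontier D)] fun _ => (1 : ℝ) := by
  have h : ∀ᵐ x ∂(arcLength (frontier D)), x ∈ frontier D :=
    ae_restrict_mem isClosed_frontier.measurableSet
  filter_upwards [hD.trace_ofC1 hD.exists_cutoff.choose_spec.1.isC1Fun, h] with x hx hxD
  exact hx.trans (hD.exists_cutoff.choose_spec.2 x (frontier_subset_closure hxD))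

theorem mean_one (hD : IsHolderDomain η D) : hD.mean (boundaryValue hD.one) = 1 := by
  have := hD.arcLength_finite
  rw [mean_boundaryValue, average_congr hD.trace_one]
  have : NeZero (arcLength (frontier D)) := ⟨fun h => by
    have := hD.arcLength_pos
    simp [h] at this⟩
  exact average_const _ _

theorem eq_one_of_fnOf (hD : IsHolderDomain η D) {V : H1 D}
    (hV : fnOf V =ᵐ[volume.restrict D] fun _ => (1 : ℝ)) : V = hD.one :=
  H1.ext_fnOf hD.isOpen (hV.trans hD.fnOf_one.symm)

theorem apply_one_of_mem (hD : IsHolderDomain η D) (g : HNegHalf0 D) :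
    (g : StrongDual ℝ (HHalf D)) (boundaryValue hD.one) = 0 := g.2 _ hD.fnOf_one

theorem mem_HNegHalf0_iff (hD : IsHolderDomain η D) (g : StrongDual ℝ (HHalf D)) :
    g ∈ HNegHalf0 D ↔ g (boundaryValue hD.one) = 0 := by
  refine ⟨fun h => h _ hD.fnOf_one, fun h V hV => ?_⟩
  rwa [hD.eq_one_of_fnOf hV]

/-! ### Poincaré inequality in `H¹(D)` -/

set_option maxHeartbeats 1000000 in
/-- The Poincaré inequality on all of `D`, for test functions; the constant `a` need not be the
boundary mean. -/
theorem exists_sub_smul_one_le (hD : IsHolderDomain η D) : ∃ K : ℝ, 0 ≤ K ∧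
    ∀ U ∈ testSubspace D, ∃ a : ℝ, ‖U - a • hD.one‖ ≤ K * ‖gradOfL D U‖ := by
  obtain ⟨ρ, hρ⟩ := hD.isBounded.subset_ball (0 : Plane)
  obtain ⟨W, -, hW, hsub⟩ := exists_poincareIn hD.isOpen hD.isConnected.isPreconnected
    (fun p hp => hD.coneAt hp) ρ
  obtain ⟨C, ρ', hC⟩ := hW.ineq
  rw [inter_eq_left.2 hρ] at hsub
  refine ⟨Real.sqrt (C + 1 : ℝ≥0), Real.sqrt_nonneg _, ?_⟩
  intro U hU
  obtain ⟨P, ⟨φ, hφ, h3, -⟩, rfl⟩ := hU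
  generalize hV : (LinearMap.fst ℝ (H1 D) _) P = U
  replace h3 : fnOf U =ᵐ[volume.restrict D] φ := by rw [← hV]; exact h3
  clear hV
  obtain ⟨a, ha⟩ := hC φ hφ.isC1Fun
  refine ⟨a, norm_sq_le_of_enorm_sq_le ?_⟩
  have h3' : U = H1.ofC1 D hφ.isC1Fun := H1.eq_ofC1 hD.isOpen hφ.isC1Fun h3
  have hg : gradOf (U - a • hD.one) = gradOf U := by
    rw [gradOf_sub, gradOf_smul, hD.gradOf_one, smul_zero, sub_zero]
  have hf : fnOf (U - a • hD.one) =ᵐ[volume.restrict D] fun x => φ x - a := by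
    rw [fnOf_sub, fnOf_smul]
    filter_upwards [Lp.coeFn_sub (fnOf U) (a • fnOf hD.one), Lp.coeFn_smul a (fnOf hD.one),
      hD.fnOf_one, h3] with x h1 h2 h3 h4
    rw [h1, Pi.sub_apply, h2, Pi.smul_apply, h3, h4]
    simp
  have hgr : gradOf U =ᵐ[volume.restrict D] gradient φ := by
    rw [h3']
    exact gradOf_ofC1 D hφ.isC1Fun
  have key : ∫⁻ x in D, ‖fnOf (U - a • hD.one) x‖ₑ ^ 2 ≤ C * ∫⁻ x in D, ‖gradOf U x‖ₑ ^ 2 := by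
    calc ∫⁻ x in D, ‖fnOf (U - a • hD.one) x‖ₑ ^ 2 = ∫⁻ x in D, ‖φ x - a‖ₑ ^ 2 := by
          refine lintegral_congr_ae ?_
          filter_upwards [hf] with x hx
          rw [hx]
      _ ≤ ∫⁻ x in W, ‖φ x - a‖ₑ ^ 2 := lintegral_mono_set hsub
      _ ≤ _ := ha
      _ ≤ C * ∫⁻ x in D, ‖fderiv ℝ φ x‖ₑ ^ 2 :=
          mul_le_mul_right (lintegral_mono_set inter_subset_left) _
      _ = C * ∫⁻ x in D, ‖gradOf U x‖ₑ ^ 2 := by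
          congr 1
          refine lintegral_congr_ae ?_
          filter_upwards [hgr] with x hx
          rw [hx, enorm_gradient]
  rw [H1.enorm_sq, hg, gradOfL_apply, ENNReal.coe_add, ENNReal.coe_one, add_mul, one_mul,
    enorm_sq_eq_lintegral (gradOf U)]
  exact add_le_add_left key _

set_option maxHeartbeats 1000000 in
/-- `H¹` functions are controlled by their gradient and their boundary mean. -/
theorem exists_poincare (hD : IsHolderDomain η D) : ∃ C : ℝ, 0 ≤ C ∧ ∀ U : H1 D,
    ‖U - hD.mean (boundaryValue U) • hD.one‖ ≤ C * ‖gradOf U‖ := by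
  obtain ⟨K, hK0, hK⟩ := hD.exists_sub_smul_one_le
  let M : H1 D →L[ℝ] ℝ := hD.mean.comp (boundaryValueL D)
  have hM1 : M hD.one = 1 := hD.mean_one
  refine ⟨(1 + ‖M‖ * ‖hD.one‖) * K, by positivity, fun U => ?_⟩
  have hmem : U ∈ (testSubspace D).topologicalClosure := by
    rw [dense_testSubspace hD.isOpen hD.isBounded fun p hp => hD.coneAt hp]
    trivial
  have hS : ∀ V : H1 D, (ContinuousLinearMap.id ℝ (H1 D) - M.smulRight hD.one) V
      = V - M V • hD.one := fun V => rfl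
  have key := norm_le_of_mem_topologicalClosure
    (S := ContinuousLinearMap.id ℝ (H1 D) - M.smulRight hD.one) (G := gradOfL D)
    (K := (1 + ‖M‖ * ‖hD.one‖) * K) (fun V hV => ?_) hmem
  · rw [hS] at key
    exact key
  · obtain ⟨a, ha⟩ := hK V hV
    rw [hS, mul_assoc]
    exact norm_sub_smul_le_of_norm_sub_smul_le hM1 ha

end IsHolderDomain

/-! ### Coercive forms and operators -/

section Coercive

variable {X Y : Type*} [NormedAddCommGroup X] [InnerProductSpace ℝ X] [CompleteSpace X]
  [NormedAddCommGroup Y] [InnerProductSpace ℝ Y]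

/-- An abstract Neumann problem: `G` plays the role of the gradient, `e` of the constant `1` and
`M` of a mean for which the Poincaré inequality holds. The form `⟪S G u, G v⟫ + M u * M v` is
coercive on the whole space, and its solution automatically has mean zero. -/
theorem exists_neumann_solution {M : X →L[ℝ] ℝ} {e : X} {G : X →L[ℝ] Y} {S : Y →L[ℝ] Y}
    {K c : ℝ} (hM : M e = 1) (hG : G e = 0) (hK : ∀ u, ‖u - M u • e‖ ≤ K * ‖G u‖) (hK0 : 0 ≤ K)
    (hc : 0 < c) (hS : ∀ y, c⁻¹ * ‖y‖ ^ 2 ≤ inner ℝ (S y) y) {l : X →L[ℝ] ℝ} (hl : l e = 0) :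
    ∃ u, M u = 0 ∧ (∀ v, inner ℝ (S (G u)) (G v) = l v) ∧ ‖u‖ ≤ K * (c * (‖l‖ * K)) := by
  let B : X →L[ℝ] X →L[ℝ] ℝ :=
    ((isBoundedBilinearMap_inner (𝕜 := ℝ)
      (E := Y)).toContinuousLinearMap.bilinearComp (S.comp G) G) + (ContinuousLinearMap.mul ℝ ℝ).bilinearComp M M
  have hB : ∀ u v, B u v = inner ℝ (S (G u)) (G v) + M u * M v := fun u v => rfl
  have hco : IsCoercive B := by
    refine ⟨(2 * K ^ 2 * c + 2 * ‖e‖ ^ 2 + 1)⁻¹, by positivity, fun u => ?_⟩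
    rw [mul_assoc, inv_mul_le_iff₀ (by positivity), hB]
    have h1 : ‖u‖ ≤ K * ‖G u‖ + |M u| * ‖e‖ := by
      calc ‖u‖ = ‖(u - M u • e) + M u • e‖ := by rw [sub_add_cancel]
        _ ≤ ‖u - M u • e‖ + ‖M u • e‖ := norm_add_le _ _
        _ ≤ _ := by
          rw [norm_smul, Real.norm_eq_abs]
          gcongr
          exact hK u
    have h2 : ‖u‖ * ‖u‖ ≤ 2 * (K * ‖G u‖) ^ 2 + 2 * (|M u| * ‖e‖) ^ 2 := by
      have := mul_self_le_mul_self (norm_nonneg u) h1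
      nlinarith [sq_nonneg (K * ‖G u‖ - |M u| * ‖e‖)]
    have h3 : ‖G u‖ ^ 2 ≤ c * inner ℝ (S (G u)) (G u) := by
      have := hS (G u)
      rwa [inv_mul_le_iff₀ hc] at this
    have h4 : 0 ≤ inner ℝ (S (G u)) (G u) := le_trans (by positivity) (hS (G u))
    have h5 : |M u| ^ 2 = M u * M u := by rw [sq_abs, sq]
    have h6 : 0 ≤ M u * M u := mul_self_nonneg _
    calc ‖u‖ * ‖u‖ ≤ 2 * (K * ‖G u‖) ^ 2 + 2 * (|M u| * ‖e‖) ^ 2 := h2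
      _ = 2 * K ^ 2 * ‖G u‖ ^ 2 + 2 * ‖e‖ ^ 2 * (M u * M u) := by
        rw [mul_pow, mul_pow, h5]; ring
      _ ≤ 2 * K ^ 2 * (c * inner ℝ (S (G u)) (G u)) + 2 * ‖e‖ ^ 2 * (M u * M u) := by gcongr
      _ ≤ (2 * K ^ 2 * c + 2 * ‖e‖ ^ 2 + 1) * (inner ℝ (S (G u)) (G u) + M u * M u) := by
        have a1 : 0 ≤ 2 * K ^ 2 * c * (M u * M u) := by positivity
        have a2 : 0 ≤ 2 * ‖e‖ ^ 2 * inner ℝ (S (G u)) (G u) := by positivity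
        nlinarith
  obtain ⟨u, hu⟩ := hco.continuousLinearEquivOfBilin.surjective
    ((InnerProductSpace.toDual ℝ X).symm l)
  have hsol : ∀ v, B u v = l v := fun v => by
    rw [← hco.continuousLinearEquivOfBilin_apply, hu, InnerProductSpace.toDual_symm_apply]
  have hMu : M u = 0 := by
    have := hsol e
    rwa [hB, hG, inner_zero_right, hM, mul_one, zero_add, hl] at this
  have hsol' : ∀ v, inner ℝ (S (G u)) (G v) = l v := fun v => by
    rw [← hsol, hB, hMu, zero_mul, add_zero]
  refine ⟨u, hMu, hsol', ?_⟩
  have h1 : ‖u‖ ≤ K * ‖G u‖ := by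
    have := hK u
    rwa [hMu, zero_smul, sub_zero] at this
  have h2 : ‖G u‖ ^ 2 ≤ c * (‖l‖ * (K * ‖G u‖)) := by
    have h3 := hS (G u)
    rw [inv_mul_le_iff₀ hc, hsol'] at h3
    refine h3.trans (mul_le_mul_of_nonneg_left ?_ hc.le)
    calc l u ≤ ‖l u‖ := le_abs_self _
      _ ≤ ‖l‖ * ‖u‖ := l.le_opNorm u
      _ ≤ _ := by gcongr
  refine h1.trans (mul_le_mul_of_nonneg_left ?_ hK0)
  rcases (norm_nonneg (G u)).eq_or_lt with h | h
  · rw [← h]; positivity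
  · nlinarith

end Coercive

/-! ### The interior Neumann problem -/

/-- Multiplication by the conductivity as a bounded operator on square integrable fields. -/
theorem IsConductivity.exists_mulL {c : ℝ} {D : Set Plane} {σ : Plane → ℝ}
    (hσ : IsConductivity c D σ) (hc : 0 < c) :
    ∃ S : Lp Plane 2 (volume.restrict D) →L[ℝ] Lp Plane 2 (volume.restrict D),
      (∀ y, S y =ᵐ[volume.restrict D] fun x => σ x • y x) ∧ ∀ y, ‖S y‖ ≤ c * ‖y‖ := by
  have hm : ∀ y : Lp Plane 2 (volume.restrict D),
      AEStronglyMeasurable (fun x => σ x • y x) (volume.restrict D) := fun y =>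
    hσ.1.aestronglyMeasurable.smul (Lp.memLp y).1
  have hle : ∀ y : Lp Plane 2 (volume.restrict D),
      ∀ᵐ x ∂(volume.restrict D), ‖σ x • y x‖ ≤ c * ‖y x‖ := fun y => by
    filter_upwards [hσ.2] with x hx
    rw [norm_smul, Real.norm_eq_abs, abs_of_nonneg ((inv_pos.2 hc).le.trans hx.1)]
    exact mul_le_mul_of_nonneg_right hx.2 (norm_nonneg _)
  have hmem : ∀ y : Lp Plane 2 (volume.restrict D),
      MemLp (fun x => σ x • y x) 2 (volume.restrict D) := fun y =>
    (Lp.memLp y).of_le_mul (hm y) (hle y)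
  have hb : ∀ y : Lp Plane 2 (volume.restrict D), ‖(hmem y).toLp _‖ ≤ c * ‖y‖ := fun y => by
    refine Lp.norm_le_mul_norm_of_ae_le_mul ?_
    filter_upwards [(hmem y).coeFn_toLp, hle y] with x h1 h2
    rwa [h1]
  refine ⟨LinearMap.mkContinuous
    { toFun := fun y => (hmem y).toLp _
      map_add' := fun y z => ?_
      map_smul' := fun a y => ?_ } c hb, fun y => (hmem y).coeFn_toLp, hb⟩
  · refine Lp.ext ?_
    filter_upwards [(hmem (y + z)).coeFn_toLp, (hmem y).coeFn_toLp, (hmem z).coeFn_toLp,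
      Lp.coeFn_add y z, Lp.coeFn_add ((hmem y).toLp _) ((hmem z).toLp _)] with x h1 h2 h3 h4 h5
    rw [h1, h5, Pi.add_apply, h2, h3, h4, Pi.add_apply, smul_add]
  · refine Lp.ext ?_
    filter_upwards [(hmem (a • y)).coeFn_toLp, (hmem y).coeFn_toLp,
      Lp.coeFn_smul a y, Lp.coeFn_smul a ((hmem y).toLp _)] with x h1 h2 h4 h5
    rw [h1, RingHom.id_apply, h5, Pi.smul_apply, h2, h4, Pi.smul_apply, smul_comm]

theorem IsConductivity.le_inner {c : ℝ} {D : Set Plane} {σ : Plane → ℝ}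
    (hσ : IsConductivity c D σ) 
    {S : Lp Plane 2 (volume.restrict D) →L[ℝ] Lp Plane 2 (volume.restrict D)}
    (hS : ∀ y, S y =ᵐ[volume.restrict D] fun x => σ x • y x)
    (y : Lp Plane 2 (volume.restrict D)) : c⁻¹ * ‖y‖ ^ 2 ≤ inner ℝ (S y) y := by
  rw [← real_inner_self_eq_norm_sq, ← real_inner_smul_left, L2.inner_def, L2.inner_def]
  refine integral_mono_ae (L2.integrable_inner _ _) (L2.integrable_inner _ _) ?_
  filter_upwards [hS y, hσ.2, Lp.coeFn_smul c⁻¹ y] with x h1 h2 h3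
  change inner ℝ ((c⁻¹ • y) x) (y x) ≤ inner ℝ (S y x) (y x)
  rw [h1, h3, Pi.smul_apply, real_inner_smul_left, real_inner_smul_left]
  exact mul_le_mul_of_nonneg_right h2.1 real_inner_self_nonneg

theorem inner_eq_integral_of_mulL {D : Set Plane} {σ : Plane → ℝ}
    {S : Lp Plane 2 (volume.restrict D) →L[ℝ] Lp Plane 2 (volume.restrict D)}
    (hS : ∀ y, S y =ᵐ[volume.restrict D] fun x => σ x • y x)
    (y z : Lp Plane 2 (volume.restrict D)) :
    inner ℝ (S y) z = ∫ x in D, σ x * inner ℝ (y x) (z x) := by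
  rw [L2.inner_def]
  refine integral_congr_ae ?_
  filter_upwards [hS y] with x h1
  rw [h1, real_inner_smul_left]

namespace IsHolderDomain

variable {η : ℝ≥0} {D : Set Plane} {c : ℝ}

theorem eq_zero_of_gradOf_eq_zero (hD : IsHolderDomain η D) {U : H1 D} (h : gradOf U = 0)
    (h0 : hD.mean (boundaryValue U) = 0) : U = 0 := by
  obtain ⟨K, -, hK⟩ := hD.exists_poincare
  have h1 := hK U
  rw [h, norm_zero, mul_zero, h0, zero_smul, sub_zero] at h1
  exact norm_le_zero_iff.1 h1

theorem exists_isInteriorSolution (hD : IsHolderDomain η D) (hc : 0 < c) : ∃ C : ℝ, 0 ≤ C ∧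
    ∀ σ, IsConductivity c D σ → ∀ g : HNegHalf0 D, ∃ U : H1 D,
      hD.mean (boundaryValue U) = 0 ∧ IsInteriorSolution D σ g U ∧ ‖U‖ ≤ C * ‖g‖ := by
  obtain ⟨K, hK0, hK⟩ := hD.exists_poincare
  refine ⟨K * (c * K), by positivity, fun σ hσ g => ?_⟩
  obtain ⟨S, hS, -⟩ := hσ.exists_mulL hc
  obtain ⟨U, h1, h2, h3⟩ := exists_neumann_solution (X := H1 D)
    (Y := Lp Plane 2 (volume.restrict D)) (M := hD.mean.comp (boundaryValueL D)) (e := hD.one)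
    (G := gradOfL D) (S := S) (K := K) (c := c) (l := g.1.comp (boundaryValueL D))
    hD.mean_one hD.gradOf_one hK hK0 hc (hσ.le_inner hS) (hD.apply_one_of_mem g)
  refine ⟨U, h1, fun V => ?_, h3.trans ?_⟩
  · rw [← inner_eq_integral_of_mulL hS]
    exact h2 V
  · have h4 : ‖g.1.comp (boundaryValueL D)‖ ≤ ‖g‖ := by
      refine (ContinuousLinearMap.opNorm_comp_le _ _).trans ?_
      refine mul_le_of_le_one_right (norm_nonneg _) ?_
      exact LinearMap.mkContinuous_norm_le _ zero_le_one _
    calc K * (c * (‖g.1.comp (boundaryValueL D)‖ * K)) ≤ K * (c * (‖g‖ * K)) := by gcongr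
      _ = _ := by ring

/-- Existence and boundedness of the Neumann-to-Dirichlet map, with a bound that depends on the
bounds of the conductivity only. -/
theorem exists_isNtD (hD : IsHolderDomain η D) (hc : 0 < c) : ∃ C : ℝ, 0 ≤ C ∧
    ∀ σ, IsConductivity c D σ → ∃ Λ, IsNtD D σ Λ ∧ ‖Λ‖ ≤ C := by
  obtain ⟨C, hC0, hC⟩ := hD.exists_isInteriorSolution hc
  refine ⟨C, hC0, fun σ hσ => ?_⟩
  obtain ⟨S, hS, -⟩ := hσ.exists_mulL hc
  have hsol : ∀ (g : StrongDual ℝ (HHalf D)) U, IsInteriorSolution D σ g U ↔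
      ∀ V, inner ℝ (S (gradOfL D U)) (gradOfL D V) = g (boundaryValue V) := by
    intro g U
    refine forall_congr' fun V => ?_
    rw [inner_eq_integral_of_mulL hS]
    rfl
  refine exists_clm_of_relation
    (R := fun (g : HNegHalf0 D) (q : HHalf0 D) =>
      ∃ U : H1 D, IsInteriorSolution D σ g U ∧ boundaryValue U = q) ?_ ?_ ?_ ?_ hC0
  · rintro g h y z ⟨U, hU, hUy⟩ ⟨V, hV, hVz⟩
    refine ⟨U + V, ?_, ?_⟩
    · rw [hsol] at hU hV ⊢
      intro W
      rw [map_add, map_add, inner_add_left, hU, hV]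
      rfl
    · rw [map_add, hUy, hVz]
      rfl
  · rintro a g y ⟨U, hU, hUy⟩
    refine ⟨a • U, ?_, ?_⟩
    · rw [hsol] at hU ⊢
      intro W
      rw [map_smul, map_smul, real_inner_smul_left, hU]
      rfl
    · rw [map_smul, hUy]
      rfl
  · intro g
    obtain ⟨U, h1, h2, h3⟩ := hC σ hσ g
    refine ⟨⟨boundaryValue U, (hD.mem_HHalf0_iff _).2 h1⟩, ⟨U, h2, rfl⟩, ?_⟩
    exact (norm_boundaryValue_le U).trans h3
  · rintro y ⟨U, hU, hUy⟩
    rw [hsol] at hU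
    have h1 : inner ℝ (S (gradOfL D U)) (gradOfL D U) = 0 := hU U
    have h2 := hσ.le_inner hS (gradOfL D U)
    rw [h1] at h2
    have h3 : gradOf U = 0 := by
      by_contra hne
      have : 0 < ‖gradOfL D U‖ := norm_pos_iff.2 hne
      have : 0 < c⁻¹ * ‖gradOfL D U‖ ^ 2 := by positivity
      linarith
    have h4 : hD.mean (boundaryValue U) = 0 := by
      rw [hUy]
      exact (hD.mem_HHalf0_iff _).1 y.2
    have h5 := hD.eq_zero_of_gradOf_eq_zero h3 h4
    rw [h5, map_zero] at hUy
    exact Subtype.ext hUy.symm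

/-- The Neumann-to-Dirichlet maps are coercive, uniformly in the conductivity: `⟨g, Λ_σ g⟩` is the
energy of the solution, and the energy controls `g`. -/
theorem norm_sq_le_ntd {σ : Plane → ℝ} (hσ : IsConductivity c D σ)
    (hc : 0 < c) {Λ : HNegHalf0 D →L[ℝ] HHalf0 D} (hΛ : IsNtD D σ Λ) (g : HNegHalf0 D) :
    (c ^ 3)⁻¹ * ‖g‖ ^ 2 ≤ (g : StrongDual ℝ (HHalf D)) (Λ g : HHalf D) := by
  obtain ⟨U, hU, hUq⟩ := (hΛ g (Λ g)).1 rfl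
  obtain ⟨S, hS, hSc⟩ := hσ.exists_mulL hc
  have hU' : ∀ V, inner ℝ (S (gradOf U)) (gradOf V)
      = (g : StrongDual ℝ (HHalf D)) (boundaryValue V) := by
    intro V
    rw [inner_eq_integral_of_mulL hS]
    exact hU V
  have h1 : ‖g‖ ≤ c * ‖gradOf U‖ := by
    refine ContinuousLinearMap.opNorm_le_bound _ (by positivity) fun q => ?_
    refine le_of_forall_pos_le_add fun ε hε => ?_
    obtain ⟨V, rfl, hV⟩ := exists_boundaryValue_eq q
      (ε := ε / (c * ‖gradOf U‖ + 1)) (by positivity)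
    calc ‖(g : StrongDual ℝ (HHalf D)) (boundaryValue V)‖
        = ‖(inner ℝ (S (gradOf U)) (gradOf V) : ℝ)‖ := by rw [hU' V]
      _ ≤ ‖S (gradOf U)‖ * ‖gradOf V‖ := norm_inner_le_norm _ _
      _ ≤ (c * ‖gradOf U‖) * (‖boundaryValue V‖ + ε / (c * ‖gradOf U‖ + 1)) := by
          gcongr
          · exact hSc _
          · exact (H1.norm_gradOf_le V).trans hV.le
      _ = c * ‖gradOf U‖ * ‖boundaryValue V‖
          + (c * ‖gradOf U‖ / (c * ‖gradOf U‖ + 1)) * ε := by ring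
      _ ≤ c * ‖gradOf U‖ * ‖boundaryValue V‖ + 1 * ε := by
          gcongr
          rw [div_le_one (by positivity)]
          linarith
      _ = _ := by rw [one_mul]
  have h2 := hσ.le_inner hS (gradOf U)
  rw [hU' U, hUq] at h2
  refine le_trans ?_ h2
  calc (c ^ 3)⁻¹ * ‖g‖ ^ 2 ≤ (c ^ 3)⁻¹ * (c * ‖gradOf U‖) ^ 2 := by gcongr
    _ = c⁻¹ * ‖gradOf U‖ ^ 2 := by field_simp

end IsHolderDomain

/-! ### Reflection across the boundary -/

/-- Reflection across the graph of `γ` along the second axis of the coordinates `L`. -/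
def graphReflection (L : Plane ≃ₗᵢ[ℝ] Plane) (γ : ℝ → ℝ) (x : Plane) : Plane :=
  x + (2 * (γ (L x 0) - L x 1)) • L.symm up

section Reflection

variable (L : Plane ≃ₗᵢ[ℝ] Plane) {γ : ℝ → ℝ}

@[simp] theorem graphReflection_zero (x : Plane) : L (graphReflection L γ x) 0 = L x 0 := by
  simp [graphReflection]

@[simp] theorem graphReflection_one (x : Plane) :
    L (graphReflection L γ x) 1 = 2 * γ (L x 0) - L x 1 := by
  simp [graphReflection]
  ring

theorem contDiff_graphReflection (hγ : ContDiff ℝ 1 γ) : ContDiff ℝ 1 (graphReflection L γ) := by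
  have h : ∀ i, ContDiff ℝ 1 fun x => L x i := fun i =>
    (contDiff_euclidean.1 L.contDiff) i
  unfold graphReflection
  exact contDiff_id.add ((contDiff_const.mul ((hγ.comp (h 0)).sub (h 1))).smul contDiff_const)

theorem measurePreserving_graphReflection (hγ : ContDiff ℝ 1 γ) :
    MeasurePreserving (graphReflection L γ) volume volume := by
  have hm := (contDiff_graphReflection L hγ).continuous.measurable
  have hg := measurePreserving_graphMap L hγ.continuous
  have hn : MeasurePreserving (fun q : ℝ × ℝ => (q.1, -q.2)) volume volume :=
    (MeasurePreserving.id (volume : Measure ℝ)).prod (Measure.measurePreserving_neg volume)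
  refine ⟨hm, ?_⟩
  calc Measure.map (graphReflection L γ) volume
      = Measure.map (graphReflection L γ)
          (Measure.map (fun q : ℝ × ℝ => graphMap L γ q.1 q.2) volume) := by rw [hg.map_eq]
    _ = Measure.map (fun q : ℝ × ℝ => graphReflection L γ (graphMap L γ q.1 q.2)) volume :=
        Measure.map_map hm hg.measurable
    _ = Measure.map (fun q : ℝ × ℝ => graphMap L γ q.1 (-q.2)) volume := by
        congr 1
        funext q
        apply plane_ext L
        · simp
        · simp
          ring
    _ = volume := (hg.comp hn).map_eq

theorem graphReflection_eq_self {x : Plane} (hx : L x 1 = γ (L x 0)) :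
    graphReflection L γ x = x := by
  simp [graphReflection, hx]

end Reflection

theorem IsC1Fun.mul_comp {χ φ : Plane → ℝ} {ρ : Plane → Plane} (hχ : IsC1Fun χ)
    (hρ : ContDiff ℝ 1 ρ) (hφ : IsC1Fun φ) : IsC1Fun fun x => χ x * φ (ρ x) :=
  ⟨hχ.1.mul (hφ.1.comp hρ), hχ.2.mul_right⟩

theorem IsC1Fun.exists_bound {χ : Plane → ℝ} (hχ : IsC1Fun χ) {ρ : Plane → Plane}
    (hρ : ContDiff ℝ 1 ρ) : ∃ M : ℝ, 0 ≤ M ∧ ∀ x, |χ x| ≤ M ∧ ‖fderiv ℝ χ x‖ ≤ M ∧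
      (x ∈ tsupport χ → ‖fderiv ℝ ρ x‖ ≤ M) := by
  obtain ⟨M₁, h₁⟩ := hχ.continuous.bounded_above_of_compact_support hχ.2
  obtain ⟨M₂, h₂⟩ := (hχ.1.continuous_fderiv (by simp)).bounded_above_of_compact_support
    (hχ.2.fderiv (𝕜 := ℝ))
  obtain ⟨M₃, h₃⟩ := (show IsCompact (tsupport χ) from hχ.2).exists_bound_of_continuousOn
    (hρ.continuous_fderiv (by simp)).continuousOn
  refine ⟨max (max M₁ M₂) M₃, ?_, fun x => ⟨?_, ?_, fun hx => ?_⟩⟩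
  · exact (norm_nonneg _).trans ((h₁ 0).trans ((le_max_left _ _).trans (le_max_left _ _)))
  · exact (h₁ x).trans ((le_max_left _ _).trans (le_max_left _ _))
  · exact (h₂ x).trans ((le_max_right _ _).trans (le_max_left _ _))
  · exact (h₃ x hx).trans (le_max_right _ _)

theorem IsC1Fun.norm_fderiv_mul_comp_le {χ φ : Plane → ℝ} {ρ : Plane → Plane} (hχ : IsC1Fun χ)
    (hρ : ContDiff ℝ 1 ρ) (hφ : IsC1Fun φ) {M : ℝ} (hM0 : 0 ≤ M) {x : Plane}
    (h1 : |χ x| ≤ M) (h2 : ‖fderiv ℝ χ x‖ ≤ M) (h3 : ‖fderiv ℝ ρ x‖ ≤ M) :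
    ‖fderiv ℝ (fun x => χ x * φ (ρ x)) x‖ ≤ M * (‖fderiv ℝ φ (ρ x)‖ * M) + |φ (ρ x)| * M := by
  have hd : HasFDerivAt (fun x => φ (ρ x)) ((fderiv ℝ φ (ρ x)).comp (fderiv ℝ ρ x)) x :=
    (hφ.differentiable (ρ x)).hasFDerivAt.comp x (hρ.differentiable (by simp) x).hasFDerivAt
  rw [((hχ.differentiable x).hasFDerivAt.fun_mul hd).fderiv]
  refine (norm_add_le _ _).trans ?_
  rw [norm_smul, norm_smul, Real.norm_eq_abs, Real.norm_eq_abs]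
  gcongr
  exact (ContinuousLinearMap.opNorm_comp_le _ _).trans (by gcongr)

/-- Multiplication with a cutoff after a measure preserving change of variables is bounded
in `H¹`. -/
theorem exists_norm_ofC1_mul_comp_le {Ω A : Set Plane} (hΩ : MeasurableSet Ω)
    (hA : MeasurableSet A) {χ : Plane → ℝ} {ρ : Plane → Plane} (hχ : IsC1Fun χ)
    (hρ : ContDiff ℝ 1 ρ) (hmp : MeasurePreserving ρ volume volume)
    (hmaps : ∀ x ∈ Ω, x ∈ tsupport χ → ρ x ∈ A) :
    ∃ C : ℝ, 0 ≤ C ∧ ∀ φ (hφ : IsC1Fun φ),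
      ‖H1.ofC1 Ω (hχ.mul_comp hρ hφ)‖ ≤ C * ‖H1.ofC1 A hφ‖ := by
  obtain ⟨M, hM0, hM⟩ := hχ.exists_bound hρ
  lift M to ℝ≥0 using hM0
  refine ⟨Real.sqrt (3 * M ^ 2 + 2 * M ^ 4 : ℝ≥0), Real.sqrt_nonneg _, fun φ hφ => ?_⟩
  refine norm_sq_le_of_enorm_sq_le ?_
  rw [enorm_ofC1_sq, enorm_ofC1_sq]
  set F : Plane → ℝ≥0∞ := fun x => ‖φ x‖ₑ ^ 2 + ‖fderiv ℝ φ x‖ₑ ^ 2 with hF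
  have hFm : Measurable F := hφ.measurable_enorm_sq.add hφ.measurable_enorm_fderiv_sq
  have key : ∀ x ∈ Ω, ‖χ x * φ (ρ x)‖ₑ ^ 2 + ‖fderiv ℝ (fun x => χ x * φ (ρ x)) x‖ₑ ^ 2
      ≤ (3 * M ^ 2 + 2 * M ^ 4 : ℝ≥0) * A.indicator F (ρ x) := by
    intro x hx
    by_cases hxs : x ∈ tsupport χ
    · obtain ⟨h1, h2, h3⟩ := hM x
      rw [indicator_of_mem (hmaps x hx hxs), hF]
      have e1 := hχ.norm_fderiv_mul_comp_le hρ hφ M.2 h1 h2 (h3 hxs)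
      have e2 : ‖χ x * φ (ρ x)‖ ≤ M * |φ (ρ x)| := by
        rw [norm_mul]
        exact mul_le_mul_of_nonneg_right h1 (norm_nonneg _)
      have e3 : ‖χ x * φ (ρ x)‖ ^ 2 + ‖fderiv ℝ (fun x => χ x * φ (ρ x)) x‖ ^ 2
          ≤ (3 * M ^ 2 + 2 * M ^ 4) * (‖φ (ρ x)‖ ^ 2 + ‖fderiv ℝ φ (ρ x)‖ ^ 2) := by
        have e4 := pow_le_pow_left₀ (norm_nonneg _) e1 2
        have e5 := pow_le_pow_left₀ (norm_nonneg _) e2 2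
        have hb := norm_nonneg (fderiv ℝ φ (ρ x))
        have ha := abs_nonneg (φ (ρ x))
        have hm : (0 : ℝ) ≤ M := M.2
        rw [Real.norm_eq_abs (φ (ρ x))]
        set a := |φ (ρ x)|
        set b := ‖fderiv ℝ φ (ρ x)‖
        change _ ≤ ((M : ℝ) * (b * M) + a * M) ^ 2 at e4
        have e6 : ((M : ℝ) * (b * M) + a * M) ^ 2 ≤ 2 * (M : ℝ) ^ 4 * b ^ 2 + 2 * M ^ 2 * a ^ 2 := by
          nlinarith [sq_nonneg ((M : ℝ) * (b * M) - a * M)]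
        have e7 : 0 ≤ 2 * (M : ℝ) ^ 4 * a ^ 2 := by positivity
        have e8 : 0 ≤ 3 * (M : ℝ) ^ 2 * b ^ 2 := by positivity
        nlinarith
      have e4 : ‖χ x * φ (ρ x)‖₊ ^ 2 + ‖fderiv ℝ (fun x => χ x * φ (ρ x)) x‖₊ ^ 2
          ≤ (3 * M ^ 2 + 2 * M ^ 4) * (‖φ (ρ x)‖₊ ^ 2 + ‖fderiv ℝ φ (ρ x)‖₊ ^ 2) := by
        exact_mod_cast e3
      simp only [enorm_eq_nnnorm]
      exact_mod_cast e4
    · have h1 : χ x = 0 := image_eq_zero_of_notMem_tsupport hxs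
      have h2 : (fun x => χ x * φ (ρ x)) =ᶠ[𝓝 x] fun _ => 0 := by
        filter_upwards [(isClosed_tsupport χ).isOpen_compl.mem_nhds hxs] with y hy
        rw [image_eq_zero_of_notMem_tsupport hy, zero_mul]
      rw [h2.fderiv_eq]
      simp [h1]
  have hψ := hχ.mul_comp hρ hφ
  rw [← lintegral_add_left hψ.measurable_enorm_sq, ← lintegral_add_left hφ.measurable_enorm_sq]
  calc ∫⁻ x in Ω, (‖χ x * φ (ρ x)‖ₑ ^ 2 + ‖fderiv ℝ (fun x => χ x * φ (ρ x)) x‖ₑ ^ 2)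
      ≤ ∫⁻ x in Ω, (3 * M ^ 2 + 2 * M ^ 4 : ℝ≥0) * A.indicator F (ρ x) :=
        setLIntegral_mono' hΩ key
    _ ≤ ∫⁻ x, (3 * M ^ 2 + 2 * M ^ 4 : ℝ≥0) * A.indicator F (ρ x) :=
        setLIntegral_le_lintegral _ _
    _ = (3 * M ^ 2 + 2 * M ^ 4 : ℝ≥0) * ∫⁻ x, A.indicator F (ρ x) :=
        lintegral_const_mul _ ((hFm.indicator hA).comp hmp.measurable)
    _ = (3 * M ^ 2 + 2 * M ^ 4 : ℝ≥0) * ∫⁻ x in A, F x := by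
        rw [hmp.lintegral_comp (hFm.indicator hA), lintegral_indicator hA]

namespace IsHolderDomain

variable {η : ℝ≥0} {D : Set Plane}

/-- Near a boundary point there is a measure preserving `C¹` map that fixes the boundary and takes `D`
to the exterior: the reflection `γ + t ↦ γ - t` in the graph of `γ`, in the vertical direction. -/
theorem exists_reflection (hD : IsHolderDomain η D) {p : Plane} (hp : p ∈ frontier D) :
    ∃ r > 0, ∃ ρ : Plane → Plane, ContDiff ℝ 1 ρ ∧ MeasurePreserving ρ volume volume ∧
      ∀ x ∈ Metric.ball p r, (x ∈ D → ρ x ∈ Metric.ball p 1 \ closure D) ∧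
        (x ∈ frontier D → ρ x = x) := by
  obtain ⟨r, L, γ, K, h1, h2⟩ := hD.exists_isGraphAt hp
  have hc := contDiff_graphReflection L h1.smooth
  have hpp : graphReflection L γ p = p :=
    graphReflection_eq_self L ((h1.mem_bdry_iff p (Metric.mem_ball_self h1.pos)).1 hp)
  have hn : graphReflection L γ ⁻¹' (Metric.ball p (min r 1)) ∈ 𝓝 p := by
    refine hc.continuous.continuousAt.preimage_mem_nhds ?_
    rw [hpp]
    exact Metric.ball_mem_nhds p (lt_min h1.pos one_pos)
  obtain ⟨δ, hδ, hδs⟩ := Metric.mem_nhds_iff.1 hn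
  refine ⟨min r δ, lt_min h1.pos hδ, graphReflection L γ, hc,
    measurePreserving_graphReflection L h1.smooth, fun x hx => ⟨fun hxD => ?_, fun hxb => ?_⟩⟩
  · have hx1 : x ∈ Metric.ball p r := Metric.ball_subset_ball (min_le_left _ _) hx
    have hx2 := hδs (Metric.ball_subset_ball (min_le_right _ _) hx)
    refine ⟨Metric.ball_subset_ball (min_le_right _ _) hx2, ?_⟩
    refine (h2.mem_iff _ (Metric.ball_subset_ball (min_le_left _ _) hx2)).2 ?_
    have := (h1.mem_iff x hx1).1 hxD
    simp
    linarith
  · have hx1 : x ∈ Metric.ball p r := Metric.ball_subset_ball (min_le_left _ _) hx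
    exact graphReflection_eq_self L ((h1.mem_bdry_iff x hx1).1 hxb)

/-- The boundary values of a `C¹` function are controlled in `H^{1/2}(∂D)` by the function outside
of `D`: near the boundary, its reflection from the exterior is a function in `D` with the same
boundary values. -/
theorem exists_norm_boundaryValue_le (hD : IsHolderDomain η D) : ∃ C : ℝ, 0 ≤ C ∧ ∃ R : ℝ,
    closure D ⊆ Metric.ball 0 R ∧
    ∀ φ (hφ : IsC1Fun φ), ‖boundaryValue (H1.ofC1 D hφ)‖
      ≤ C * ‖H1.ofC1 (Metric.ball 0 R \ closure D) hφ‖ := by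
  classical
  choose! r hr ρ hρ hmp hmaps using fun p (hp : p ∈ frontier D) => hD.exists_reflection hp
  obtain ⟨t, χ, htΓ, hχ, hsum⟩ := exists_partition (isCompact_frontier hD) hr
  obtain ⟨R₀, hR₀⟩ := hD.isBounded.closure.subset_ball (0 : Plane)
  have hR : ∀ p ∈ frontier D, Metric.ball p 1 ⊆ Metric.ball 0 (R₀ + 1) := by
    intro p hp x hx
    have h1 := hR₀ (frontier_subset_closure hp)
    rw [mem_ball_zero_iff] at h1 ⊢
    rw [Metric.mem_ball, dist_eq_norm] at hx
    have := norm_add_le (x - p) p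
    rw [sub_add_cancel] at this
    linarith
  have hA : MeasurableSet (Metric.ball (0 : Plane) (R₀ + 1) \ closure D) :=
    Metric.isOpen_ball.measurableSet.diff isClosed_closure.measurableSet
  have hloc : ∀ i ∈ t, ∃ C : ℝ, 0 ≤ C ∧ ∀ φ (hφ : IsC1Fun φ) (h : IsC1Fun fun x => χ i x * φ (ρ i x)),
      ‖H1.ofC1 D h‖ ≤ C * ‖H1.ofC1 (Metric.ball 0 (R₀ + 1) \ closure D) hφ‖ := by
    intro i hi
    obtain ⟨C, hC0, hC⟩ := exists_norm_ofC1_mul_comp_le hD.isOpen.measurableSet hA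
      (hχ i hi).1.isC1Fun (hρ i (htΓ i hi)) (hmp i (htΓ i hi)) fun x hx hxs => by
        have h1 := (hmaps i (htΓ i hi) x ((hχ i hi).2 hxs)).1 hx
        exact ⟨hR i (htΓ i hi) h1.1, h1.2⟩
    exact ⟨C, hC0, fun φ hφ _ => hC φ hφ⟩
  choose! C hC0 hC using hloc
  refine ⟨∑ i ∈ t, C i, Finset.sum_nonneg hC0, R₀ + 1,
    hR₀.trans (Metric.ball_subset_ball (by linarith)), fun φ hφ => ?_⟩
  have hψ : ∀ i : t, IsC1Fun fun x => χ i x * φ (ρ i x) := fun i =>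
    (hχ i i.2).1.isC1Fun.mul_comp (hρ i (htΓ i i.2)) hφ
  have hbv : boundaryValue (H1.ofC1 D hφ) = boundaryValue (∑ i : t, H1.ofC1 D (hψ i)) := by
    rw [hD.boundaryValue_eq_iff]
    refine Lp.ext ?_
    rw [map_sum]
    have hmem : ∀ᵐ x ∂(arcLength (frontier D)), x ∈ frontier D :=
      ae_restrict_mem isClosed_frontier.measurableSet
    have hall : ∀ᵐ x ∂(arcLength (frontier D)), ∀ i : t,
        hD.trace (H1.ofC1 D (hψ i)) x = χ i x * φ (ρ i x) :=
      ae_all_iff.2 fun i => hD.trace_ofC1 (hψ i)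
    filter_upwards [hD.trace_ofC1 hφ, coeFn_finset_sum Finset.univ
      (fun i : t => hD.trace (H1.ofC1 D (hψ i))), hall, hmem] with x h1 h2 h3 h4
    rw [h1, h2]
    have h5 : ∀ i : t, hD.trace (H1.ofC1 D (hψ i)) x = χ i x * φ x := by
      intro i
      rw [h3 i]
      by_cases hx : x ∈ tsupport (χ i)
      · rw [(hmaps i (htΓ i i.2) x ((hχ i i.2).2 hx)).2 h4]
      · rw [image_eq_zero_of_notMem_tsupport hx, zero_mul, zero_mul]
    simp only [h5]
    rw [← Finset.sum_mul, Finset.sum_coe_sort t (fun i => χ i x), hsum x h4, one_mul]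
  rw [hbv]
  refine (norm_boundaryValue_le _).trans ((norm_sum_le _ _).trans ?_)
  rw [Finset.sum_mul, ← Finset.sum_coe_sort t]
  exact Finset.sum_le_sum fun i _ => hC i i.2 φ hφ (hψ i)

end IsHolderDomain

/-! ### The Poincaré inequality in the exterior -/

theorem H1.ofC1_add {Ω : Set Plane} (hΩ : IsOpen Ω) {φ ψ : Plane → ℝ} (h : IsC1Fun φ)
    (h' : IsC1Fun ψ) : H1.ofC1 Ω (h.add h') = H1.ofC1 Ω h + H1.ofC1 Ω h' := by
  refine (H1.eq_ofC1 hΩ _ ?_).symm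
  refine (Lp.coeFn_add (fnOf (H1.ofC1 Ω h)) (fnOf (H1.ofC1 Ω h'))).trans ?_
  filter_upwards [fnOf_ofC1 Ω h, fnOf_ofC1 Ω h'] with x h1 h2
  rw [Pi.add_apply, h1, h2, Pi.add_apply]

theorem H1.ofC1_smul {Ω : Set Plane} (hΩ : IsOpen Ω) {φ : Plane → ℝ} (a : ℝ) (h : IsC1Fun φ) :
    H1.ofC1 Ω (h.smul a) = a • H1.ofC1 Ω h := by
  refine (H1.eq_ofC1 hΩ _ ?_).symm
  refine (Lp.coeFn_smul a (fnOf (H1.ofC1 Ω h))).trans ?_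
  filter_upwards [fnOf_ofC1 Ω h] with x h1
  rw [Pi.smul_apply, h1, Pi.smul_apply]

theorem H1.ofC1_sub {Ω : Set Plane} (hΩ : IsOpen Ω) {φ ψ : Plane → ℝ} (h : IsC1Fun φ)
    (h' : IsC1Fun ψ) : H1.ofC1 Ω (h.sub h') = H1.ofC1 Ω h - H1.ofC1 Ω h' := by
  refine (H1.eq_ofC1 hΩ _ ?_).symm
  refine (Lp.coeFn_sub (fnOf (H1.ofC1 Ω h)) (fnOf (H1.ofC1 Ω h'))).trans ?_
  filter_upwards [fnOf_ofC1 Ω h, fnOf_ofC1 Ω h'] with x h1 h2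
  rw [Pi.sub_apply, h1, h2, Pi.sub_apply]

/-- A test function with values in `[0, 1]` that is `1` on the closed ball of radius `R`. -/
def cutoff (R : ℝ) : Plane → ℝ := (exists_isTestFun_eq_one R).choose

theorem isTestFun_cutoff (R : ℝ) : IsTestFun (cutoff R) := (exists_isTestFun_eq_one R).choose_spec.1

theorem cutoff_eq_one {R : ℝ} {x : Plane} (hx : ‖x‖ ≤ R) : cutoff R x = 1 :=
  (exists_isTestFun_eq_one R).choose_spec.2.1 x hx

/-- The part of the exterior of `D` in the ball of radius `R`. -/
def extBall (D : Set Plane) (R : ℝ) : Set Plane := Metric.ball 0 R \ closure D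

theorem isOpen_extBall (D : Set Plane) (R : ℝ) : IsOpen (extBall D R) :=
  Metric.isOpen_ball.sdiff isClosed_closure

theorem extBall_mono (D : Set Plane) {R S : ℝ} (h : R ≤ S) : extBall D R ⊆ extBall D S :=
  sdiff_subset_sdiff_left (Metric.ball_subset_ball h)

theorem extBall_subset (D : Set Plane) (R : ℝ) : extBall D R ⊆ (closure D)ᶜ := fun _ hx => hx.2

theorem isOpen_exterior (D : Set Plane) : IsOpen (closure D)ᶜ := isClosed_closure.isOpen_compl

/-- The constant function `1` in `H¹` of a bounded part of the exterior. -/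
def extOne (D : Set Plane) (R : ℝ) : H1 (extBall D R) :=
  H1.ofC1 (extBall D R) (isTestFun_cutoff R).isC1Fun

theorem fnOf_extOne (D : Set Plane) (R : ℝ) :
    fnOf (extOne D R) =ᵐ[volume.restrict (extBall D R)] fun _ => (1 : ℝ) := by
  filter_upwards [fnOf_ofC1 (extBall D R) (isTestFun_cutoff R).isC1Fun,
    ae_restrict_mem (isOpen_extBall D R).measurableSet] with x hx hxD
  exact hx.trans (cutoff_eq_one (mem_ball_zero_iff.1 hxD.1).le)

theorem gradOf_extOne (D : Set Plane) (R : ℝ) : gradOf (extOne D R) = 0 := by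
  refine (Lp.eq_zero_iff_ae_eq_zero).2 ?_
  filter_upwards [gradOf_ofC1 (extBall D R) (isTestFun_cutoff R).isC1Fun,
    ae_restrict_mem (isOpen_extBall D R).measurableSet] with x hx hxD
  refine hx.trans ?_
  have : cutoff R =ᶠ[𝓝 x] fun _ => (1 : ℝ) := by
    filter_upwards [Metric.isOpen_ball.mem_nhds hxD.1] with y hy
    exact cutoff_eq_one (mem_ball_zero_iff.1 hy).le
  simp [gradient, this.fderiv_eq]

theorem H1.ofC1_sub_smul_cutoff_eq (D : Set Plane) {φ : Plane → ℝ} (hφ : IsC1Fun φ) (a R : ℝ) :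
    H1.ofC1 (extBall D R) (hφ.sub ((isTestFun_cutoff R).isC1Fun.smul a))
      = H1.ofC1 (extBall D R) hφ - a • extOne D R := by
  rw [H1.ofC1_sub (isOpen_extBall D R) hφ ((isTestFun_cutoff R).isC1Fun.smul a),
    H1.ofC1_smul (isOpen_extBall D R) a (isTestFun_cutoff R).isC1Fun]
  rfl

/-- The energy of a function in the exterior of `D`, as a norm. -/
def extEnergy (D : Set Plane) {φ : Plane → ℝ} (hφ : IsC1Fun φ) : ℝ :=
  ‖gradOf (H1.ofC1 (closure D)ᶜ hφ)‖

theorem extEnergy_nonneg (D : Set Plane) {φ : Plane → ℝ} (hφ : IsC1Fun φ) : 0 ≤ extEnergy D hφ :=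
  norm_nonneg _

theorem enorm_gradOf_ofC1_sq (Ω : Set Plane) {φ : Plane → ℝ} (h : IsC1Fun φ) :
    ‖gradOf (H1.ofC1 Ω h)‖ₑ ^ 2 = ∫⁻ x in Ω, ‖fderiv ℝ φ x‖ₑ ^ 2 := by
  rw [enorm_sq_eq_lintegral]
  refine lintegral_congr_ae ?_
  filter_upwards [gradOf_ofC1 Ω h] with x hx
  rw [hx, enorm_gradient]

theorem norm_ofC1_sub_smul_extOne_le {D : Set Plane} {R : ℝ} {W : Set Plane} {C : ℝ≥0}
    {φ : Plane → ℝ} (hφ : IsC1Fun φ) {a : ℝ} (hW : extBall D R ⊆ W)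
    (ha : ∫⁻ x in W, ‖φ x - a‖ₑ ^ 2 ≤ C * ∫⁻ x in (closure D)ᶜ, ‖fderiv ℝ φ x‖ₑ ^ 2) :
    ‖H1.ofC1 (extBall D R) hφ - a • extOne D R‖ ≤ Real.sqrt (C + 1 : ℝ≥0) * extEnergy D hφ := by
  refine norm_sq_le_of_enorm_sq_le ?_
  have hg : gradOf (H1.ofC1 (extBall D R) hφ - a • extOne D R)
      = gradOf (H1.ofC1 (extBall D R) hφ) := by
    rw [gradOf_sub, gradOf_smul, gradOf_extOne, smul_zero, sub_zero]
  rw [H1.enorm_sq, hg, ← enorm_sq_eq_lintegral (gradOf _), enorm_gradOf_ofC1_sq,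
    enorm_gradOf_ofC1_sq, ENNReal.coe_add, ENNReal.coe_one, add_mul, one_mul]
  refine add_le_add ?_ (lintegral_mono_set (extBall_subset D R))
  refine le_trans (le_of_eq ?_) ((lintegral_mono_set hW).trans ha)
  refine lintegral_congr_ae ?_
  rw [fnOf_sub, fnOf_smul]
  filter_upwards [fnOf_ofC1 (extBall D R) hφ, fnOf_extOne D R,
    Lp.coeFn_sub (fnOf (H1.ofC1 (extBall D R) hφ)) (a • fnOf (extOne D R)),
    Lp.coeFn_smul a (fnOf (extOne D R))] with x h1 h2 h3 h4
  rw [h3, Pi.sub_apply, h4, Pi.smul_apply, h1, h2, smul_eq_mul, mul_one]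

namespace IsHolderDomain

variable {η : ℝ≥0} {D : Set Plane}

theorem exists_norm_sub_smul_extOne_le (hD : IsHolderDomain η D)
    (hext : IsConnected (closure D)ᶜ) (S : ℝ) : ∃ C : ℝ, 0 ≤ C ∧ ∀ φ (hφ : IsC1Fun φ), ∃ a : ℝ,
      ∀ R ≤ S, ‖H1.ofC1 (extBall D R) hφ - a • extOne D R‖ ≤ C * extEnergy D hφ := by
  obtain ⟨W, -, hW, hsub⟩ := exists_poincareIn (isOpen_exterior D) hext.isPreconnected
    (fun p hp => hD.coneAt_ext hp) S
  obtain ⟨C, ρ, hC⟩ := hW.ineq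
  refine ⟨Real.sqrt (C + 1 : ℝ≥0), Real.sqrt_nonneg _, fun φ hφ => ?_⟩
  obtain ⟨a, ha⟩ := hC φ hφ
  refine ⟨a, fun R hR => norm_ofC1_sub_smul_extOne_le hφ (W := W) ?_ (ha.trans ?_)⟩
  · exact fun x hx => hsub ⟨hx.2, Metric.ball_subset_ball hR hx.1⟩
  · exact mul_le_mul_right (lintegral_mono_set inter_subset_left) _

theorem ofC1_cutoff (hD : IsHolderDomain η D) {R : ℝ} (hR : closure D ⊆ Metric.ball 0 R) :
    H1.ofC1 D (isTestFun_cutoff R).isC1Fun = hD.one := by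
  refine hD.eq_one_of_fnOf ?_
  filter_upwards [fnOf_ofC1 D (isTestFun_cutoff R).isC1Fun,
    ae_restrict_mem hD.isOpen.measurableSet] with x hx hxD
  exact hx.trans (cutoff_eq_one (mem_ball_zero_iff.1 (hR (subset_closure hxD))).le)

theorem ofC1_sub_smul_cutoff (hD : IsHolderDomain η D) {φ : Plane → ℝ} (hφ : IsC1Fun φ)
    {R : ℝ} (hR : closure D ⊆ Metric.ball 0 R) (a : ℝ) :
    H1.ofC1 D (hφ.sub ((isTestFun_cutoff R).isC1Fun.smul a)) = H1.ofC1 D hφ - a • hD.one := by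
  rw [H1.ofC1_sub hD.isOpen hφ ((isTestFun_cutoff R).isC1Fun.smul a),
    H1.ofC1_smul hD.isOpen a (isTestFun_cutoff R).isC1Fun, hD.ofC1_cutoff hR]

set_option maxHeartbeats 1000000 in
/-- Boundary values are controlled by the energy in the exterior, up to constants. The constant
that is subtracted in the bounded parts of the exterior may be taken to be the boundary mean. -/
theorem exists_exterior_poincare (hD : IsHolderDomain η D) (hext : IsConnected (closure D)ᶜ)
    (S : ℝ) : ∃ C : ℝ, 0 ≤ C ∧ ∀ φ (hφ : IsC1Fun φ),
      ‖boundaryValue (H1.ofC1 D hφ) - hD.mean (boundaryValue (H1.ofC1 D hφ)) •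
        boundaryValue hD.one‖ ≤ C * extEnergy D hφ ∧
      ∀ R ≤ S, ‖H1.ofC1 (extBall D R) hφ -
        hD.mean (boundaryValue (H1.ofC1 D hφ)) • extOne D R‖ ≤
          (C + C * ‖extOne D R‖) * extEnergy D hφ := by
  obtain ⟨C₁, hC₁0, R₁, hR₁, hC₁⟩ := hD.exists_norm_boundaryValue_le
  obtain ⟨C₂, hC₂0, hC₂⟩ := hD.exists_norm_sub_smul_extOne_le hext (max S R₁)
  set K₁ := (1 + ‖hD.mean‖ * ‖boundaryValue hD.one‖) * (C₁ * C₂) with hK₁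
  set K₂ := ‖hD.mean‖ * (C₁ * C₂) with hK₂
  have hK₁0 : 0 ≤ K₁ := by positivity
  have hK₂0 : 0 ≤ K₂ := by positivity
  refine ⟨K₁ + K₂ + C₂, by positivity, fun φ hφ => ?_⟩
  obtain ⟨a, ha⟩ := hC₂ φ hφ
  have hE := extEnergy_nonneg D hφ
  have h1 : ‖boundaryValue (H1.ofC1 D hφ) - a • boundaryValue hD.one‖
      ≤ C₁ * C₂ * extEnergy D hφ := by
    have h2 := hC₁ _ (hφ.sub ((isTestFun_cutoff R₁).isC1Fun.smul a))
    rw [hD.ofC1_sub_smul_cutoff hφ hR₁, map_sub, map_smul] at h2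
    refine h2.trans ?_
    rw [mul_assoc]
    refine mul_le_mul_of_nonneg_left ?_ hC₁0
    have h3 := ha R₁ (le_max_right _ _)
    rwa [← H1.ofC1_sub_smul_cutoff_eq] at h3
  have h2 : |hD.mean (boundaryValue (H1.ofC1 D hφ)) - a| ≤ K₂ * extEnergy D hφ := by
    have h3 := hD.mean.le_opNorm (boundaryValue (H1.ofC1 D hφ) - a • boundaryValue hD.one)
    rw [map_sub, map_smul, hD.mean_one, smul_eq_mul, mul_one, Real.norm_eq_abs] at h3
    refine h3.trans ?_
    rw [hK₂, mul_assoc]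
    exact mul_le_mul_of_nonneg_left h1 (norm_nonneg _)
  constructor
  · refine (norm_sub_smul_le_of_norm_sub_smul_le hD.mean_one h1).trans ?_
    rw [← mul_assoc, ← hK₁]
    exact mul_le_mul_of_nonneg_right (by linarith) hE
  · intro R hR
    have h3 := ha R (hR.trans (le_max_left _ _))
    have h4 : H1.ofC1 (extBall D R) hφ - hD.mean (boundaryValue (H1.ofC1 D hφ)) • extOne D R
        = (H1.ofC1 (extBall D R) hφ - a • extOne D R)
          - (hD.mean (boundaryValue (H1.ofC1 D hφ)) - a) • extOne D R := by
      rw [sub_smul]; abel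
    rw [h4]
    refine (norm_sub_le _ _).trans ?_
    rw [norm_smul, Real.norm_eq_abs]
    have h5 := mul_le_mul_of_nonneg_right h2 (norm_nonneg (extOne D R))
    have h6 := norm_nonneg (extOne D R)
    have h7 : 0 ≤ (K₁ + K₂) * extEnergy D hφ := by positivity
    have h8 : 0 ≤ (K₁ + C₂) * ‖extOne D R‖ * extEnergy D hφ := by positivity
    linarith

end IsHolderDomain

/-! ### The exterior Neumann problem -/

section Dual

variable {Y Z : Type*} [NormedAddCommGroup Y] [InnerProductSpace ℝ Y] [CompleteSpace Y]
  [NormedAddCommGroup Z] [NormedSpace ℝ Z] [CompleteSpace Z]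

/-- The variational problem `⟪G, ∇φ⟫ = -g(φ)` for the pairs `(∇φ, φ)` of a subspace on which `∇φ`
controls `φ`, solved in the closure of the subspace. -/
theorem exists_dual_solution {S : Submodule ℝ (Y × Z)} {C : ℝ} (hC : 0 ≤ C)
    (hS : ∀ p ∈ S, ‖p.2‖ ≤ C * ‖p.1‖) (g : Z →L[ℝ] ℝ) :
    ∃ G q, (G, q) ∈ S.topologicalClosure ∧ (∀ p ∈ S, inner ℝ G p.1 = - g p.2) ∧
      ‖q‖ ≤ C * (‖g‖ * C) ∧ g q = - ‖G‖ ^ 2 := by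
  let K := (S.map (LinearMap.fst ℝ Y Z)).topologicalClosure
  have : CompleteSpace K := (Submodule.isClosed_topologicalClosure _).completeSpace_coe
  have hS' : ∀ p ∈ S.topologicalClosure, ‖p.2‖ ≤ C * ‖p.1‖ := fun p hp =>
    norm_snd_le_of_mem_closure hS hp
  obtain ⟨T, hT, hTC⟩ := exists_clm_of_relation (E := K) (F := Z) (C := C)
    (R := fun k z => ((k : Y), z) ∈ S.topologicalClosure)
    (fun g h y z hg hh => S.topologicalClosure.add_mem hg hh)
    (fun a g y h => S.topologicalClosure.smul_mem a h)
    (fun k => by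
      obtain ⟨y, hy⟩ := exists_mem_closure_of_norm_le hS k.2
      exact ⟨y, hy, hS' _ hy⟩)
    (fun y h => by
      have := hS' _ h
      simpa using this) hC
  let l : StrongDual ℝ K := -(g.comp T)
  let G := (InnerProductSpace.toDual ℝ K).symm l
  have hG : ∀ k : K, inner ℝ (G : Y) (k : Y) = - g (T k) := fun k =>
    InnerProductSpace.toDual_symm_apply (x := k) (y := l)
  refine ⟨G, T G, (hT _ _).1 rfl, fun p hp => ?_, ?_, ?_⟩
  · have hk : p.1 ∈ K := Submodule.le_topologicalClosure _ ⟨p, hp, rfl⟩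
    have h1 : T ⟨p.1, hk⟩ = p.2 := (hT _ _).2 (Submodule.le_topologicalClosure _ hp)
    have h2 := hG ⟨p.1, hk⟩
    rwa [h1] at h2
  · have h1 : ‖G‖ ≤ ‖g‖ * C := by
      have e : ‖G‖ = ‖l‖ := (InnerProductSpace.toDual ℝ K).symm.norm_map l
      rw [e]
      have e2 : ‖l‖ = ‖g.comp T‖ := norm_neg _
      rw [e2]
      exact (ContinuousLinearMap.opNorm_comp_le _ _).trans
        (mul_le_mul_of_nonneg_left hTC (norm_nonneg _))
    exact (T.le_opNorm G).trans (mul_le_mul hTC h1 (norm_nonneg _) hC)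
  · have h1 := hG G
    rw [real_inner_self_eq_norm_sq] at h1
    linarith

end Dual

theorem sub_smul_sub_comm {E : Type*} [NormedAddCommGroup E] [NormedSpace ℝ E] (a b e : E)
    (m n : ℝ) : a - b - (m - n) • e = a - m • e - (b - n • e) := by
  rw [sub_smul, sub_sub_sub_comm]

theorem cauchySeq_of_norm_sub_le {E F : Type*} [NormedAddCommGroup E] [NormedAddCommGroup F]
    {x : ℕ → E} {y : ℕ → F} {C : ℝ} (hx : CauchySeq x)
    (h : ∀ n m, ‖y n - y m‖ ≤ C * ‖x n - x m‖) : CauchySeq y := by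
  rw [Metric.cauchySeq_iff'] at hx ⊢
  intro ε hε
  obtain ⟨N, hN⟩ := hx (ε / (|C| + 1)) (by positivity)
  refine ⟨N, fun n hn => ?_⟩
  have h2 := hN n hn
  rw [lt_div_iff₀ (by positivity)] at h2
  rw [dist_eq_norm] at h2 ⊢
  calc ‖y n - y N‖ ≤ C * ‖x n - x N‖ := h n N
    _ ≤ (|C| + 1) * ‖x n - x N‖ := by
        gcongr
        linarith [le_abs_self C]
    _ = ‖x n - x N‖ * (|C| + 1) := mul_comm _ _
    _ < ε := h2

namespace IsHolderDomain

variable {η : ℝ≥0} {D : Set Plane}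

theorem exists_traceQ (hD : IsHolderDomain η D) :
    ∃ T : HHalf D →L[ℝ] Lp ℝ 2 (arcLength (frontier D)),
      ∀ U : H1 D, T (boundaryValue U) = hD.trace U := by
  refine ⟨(traceKer D).liftQL hD.trace ?_, fun U => rfl⟩
  intro U hU
  exact (hD.trace_eq_iff U 0).2 hU

/-- The embedding of `H^{1/2}(∂D)` in `L²(∂D)`. -/
def traceQ (hD : IsHolderDomain η D) : HHalf D →L[ℝ] Lp ℝ 2 (arcLength (frontier D)) :=
  hD.exists_traceQ.choose

theorem traceQ_boundaryValue (hD : IsHolderDomain η D) (U : H1 D) :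
    hD.traceQ (boundaryValue U) = hD.trace U := hD.exists_traceQ.choose_spec U

/-- The boundary values of a `C¹` function less their mean. -/
def centered (hD : IsHolderDomain η D) {φ : Plane → ℝ} (hφ : IsC1Fun φ) : HHalf D :=
  boundaryValue (H1.ofC1 D hφ)
    - hD.mean (boundaryValue (H1.ofC1 D hφ)) • boundaryValue hD.one

theorem centered_add (hD : IsHolderDomain η D) {φ ψ : Plane → ℝ} (hφ : IsC1Fun φ)
    (hψ : IsC1Fun ψ) : hD.centered (hφ.add hψ) = hD.centered hφ + hD.centered hψ := by
  unfold centered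
  rw [H1.ofC1_add hD.isOpen hφ hψ, map_add, map_add, add_smul]
  abel

theorem centered_smul (hD : IsHolderDomain η D) (a : ℝ) {φ : Plane → ℝ} (hφ : IsC1Fun φ) :
    hD.centered (hφ.smul a) = a • hD.centered hφ := by
  unfold centered
  rw [H1.ofC1_smul hD.isOpen a hφ, map_smul, map_smul, smul_sub, smul_smul, smul_eq_mul]

/-- The pairs of the gradient in the exterior and the centered boundary values of a test
function. -/
def exteriorPairs (hD : IsHolderDomain η D) :
    Submodule ℝ (Lp Plane 2 (volume.restrict (closure D)ᶜ) × HHalf D) where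
  carrier := {P | ∃ (φ : Plane → ℝ) (hφ : IsTestFun φ),
    P.1 = gradOf (H1.ofC1 (closure D)ᶜ hφ.isC1Fun) ∧ P.2 = hD.centered hφ.isC1Fun}
  zero_mem' := by
    have h0 : IsTestFun (0 : Plane → ℝ) := ⟨contDiff_const, HasCompactSupport.zero⟩
    refine ⟨(0 : ℝ) • 0, ⟨h0.1.const_smul (0 : ℝ), (h0.isC1Fun.smul 0).2⟩, ?_, ?_⟩
    · refine Eq.trans ?_
        (congrArg gradOf (H1.ofC1_smul (isOpen_exterior D) 0 h0.isC1Fun)).symm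
      rw [gradOf_smul, zero_smul]
      rfl
    · refine Eq.trans ?_ (hD.centered_smul 0 h0.isC1Fun).symm
      rw [zero_smul]
      rfl
  add_mem' := by
    rintro P Q ⟨φ, hφ, hP1, hP2⟩ ⟨ψ, hψ, hQ1, hQ2⟩
    refine ⟨φ + ψ, ⟨hφ.1.add hψ.1, hφ.2.add hψ.2⟩, ?_, ?_⟩
    · rw [Prod.fst_add, hP1, hQ1]
      exact (congrArg gradOf (H1.ofC1_add (isOpen_exterior D) hφ.isC1Fun hψ.isC1Fun)).symm
    · rw [Prod.snd_add, hP2, hQ2]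
      exact (hD.centered_add hφ.isC1Fun hψ.isC1Fun).symm
  smul_mem' := by
    rintro a P ⟨φ, hφ, hP1, hP2⟩
    refine ⟨a • φ, ⟨hφ.1.const_smul a, hφ.2.smul_left (f := fun _ => a)⟩, ?_, ?_⟩
    · rw [Prod.smul_fst, hP1]
      exact (congrArg gradOf (H1.ofC1_smul (isOpen_exterior D) a hφ.isC1Fun)).symm
    · rw [Prod.smul_snd, hP2]
      exact (hD.centered_smul a hφ.isC1Fun).symm

/-- The restriction of a `C¹` function to a bounded part of the exterior, less its boundary mean. -/
def extCentered (hD : IsHolderDomain η D) (R : ℝ) {φ : Plane → ℝ} (hφ : IsC1Fun φ) :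
    H1 (extBall D R) :=
  H1.ofC1 (extBall D R) hφ - hD.mean (boundaryValue (H1.ofC1 D hφ)) • extOne D R

theorem extCentered_sub (hD : IsHolderDomain η D) (R : ℝ) {φ ψ : Plane → ℝ} (hφ : IsC1Fun φ)
    (hψ : IsC1Fun ψ) :
    hD.extCentered R (hφ.sub hψ) = hD.extCentered R hφ - hD.extCentered R hψ := by
  have h : hD.mean (boundaryValue (H1.ofC1 D (hφ.sub hψ)))
      = hD.mean (boundaryValue (H1.ofC1 D hφ)) - hD.mean (boundaryValue (H1.ofC1 D hψ)) := by
    rw [H1.ofC1_sub hD.isOpen hφ hψ, map_sub, map_sub]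
  unfold extCentered
  rw [h, H1.ofC1_sub (isOpen_extBall D R) hφ hψ]
  exact sub_smul_sub_comm _ _ _ _ _

theorem fnOf_extCentered (hD : IsHolderDomain η D) (R : ℝ) {φ : Plane → ℝ} (hφ : IsC1Fun φ) :
    fnOf (hD.extCentered R hφ) =ᵐ[volume.restrict (extBall D R)]
      fun x => φ x - hD.mean (boundaryValue (H1.ofC1 D hφ)) := by
  unfold extCentered
  rw [fnOf_sub, fnOf_smul]
  filter_upwards [fnOf_ofC1 (extBall D R) hφ, fnOf_extOne D R,
    Lp.coeFn_sub (fnOf (H1.ofC1 (extBall D R) hφ))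
      (hD.mean (boundaryValue (H1.ofC1 D hφ)) • fnOf (extOne D R)),
    Lp.coeFn_smul (hD.mean (boundaryValue (H1.ofC1 D hφ))) (fnOf (extOne D R))] with x h1 h2 h3 h4
  rw [h3, Pi.sub_apply, h4, Pi.smul_apply, h1, h2, smul_eq_mul, mul_one]

theorem gradOf_extCentered (hD : IsHolderDomain η D) (R : ℝ) {φ : Plane → ℝ} (hφ : IsC1Fun φ) :
    gradOf (hD.extCentered R hφ) =ᵐ[volume.restrict (extBall D R)] gradient φ := by
  unfold extCentered
  rw [gradOf_sub, gradOf_smul, gradOf_extOne, smul_zero, sub_zero]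
  exact gradOf_ofC1 (extBall D R) hφ

/-- The trace of the centered function on the side of the exterior is that on the side of `D`. -/
theorem mem_traceGraph_extCentered (hD : IsHolderDomain η D) {R : ℝ}
    (hR : closure D ⊆ Metric.ball 0 R) {φ : Plane → ℝ} (hφ : IsTestFun φ) :
    (hD.extCentered R hφ.isC1Fun, hD.traceQ (hD.centered hφ.isC1Fun)) ∈
      smoothTracePairs (extBall D R) (frontier D) := by
  set m := hD.mean (boundaryValue (H1.ofC1 D hφ.isC1Fun)) with hm
  have hχ := isTestFun_cutoff R
  refine ⟨φ - m • cutoff R, ⟨hφ.1.sub (hχ.1.const_smul m), ?_⟩, ?_, ?_⟩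
  · exact (hφ.isC1Fun.sub (hχ.isC1Fun.smul m)).2
  · filter_upwards [hD.fnOf_extCentered R hφ.isC1Fun,
      ae_restrict_mem (isOpen_extBall D R).measurableSet] with x hx hxD
    rw [hx, Pi.sub_apply, Pi.smul_apply, cutoff_eq_one (mem_ball_zero_iff.1 hxD.1).le, smul_eq_mul,
      mul_one]
  · have e : hD.centered hφ.isC1Fun
        = boundaryValue (H1.ofC1 D (hφ.isC1Fun.sub (hχ.isC1Fun.smul m))) := by
      rw [hD.ofC1_sub_smul_cutoff hφ.isC1Fun hR, map_sub, map_smul]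
      rfl
    change hD.traceQ (hD.centered hφ.isC1Fun) =ᵐ[arcLength (frontier D)] φ - m • cutoff R
    rw [e, hD.traceQ_boundaryValue]
    exact hD.trace_ofC1 _

theorem ae_eq_of_tendsto_of_tendsto {E : Type*} [NormedAddCommGroup E] {A B : Set Plane}
    (h : A ⊆ B) {f : ℕ → Plane → E} {a : ℕ → Lp E 2 (volume.restrict A)}
    {b : ℕ → Lp E 2 (volume.restrict B)} {a' : Lp E 2 (volume.restrict A)}
    {b' : Lp E 2 (volume.restrict B)} (ha : ∀ n, a n =ᵐ[volume.restrict A] f n)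
    (hb : ∀ n, b n =ᵐ[volume.restrict B] f n) (ha' : Tendsto a atTop (𝓝 a'))
    (hb' : Tendsto b atTop (𝓝 b')) : a' =ᵐ[volume.restrict A] b' := by
  have hle : volume.restrict A ≤ volume.restrict B := Measure.restrict_mono h le_rfl
  have h1 : TendstoInMeasure (volume.restrict A) f atTop a' :=
    (tendstoInMeasure_of_tendsto_Lp ha').congr_left ha
  have h2 : TendstoInMeasure (volume.restrict B) f atTop b' :=
    (tendstoInMeasure_of_tendsto_Lp hb').congr_left hb
  have h3 : TendstoInMeasure (volume.restrict A) f atTop b' := fun ε hε =>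
    tendsto_of_tendsto_of_tendsto_of_le_of_le tendsto_const_nhds (h2 ε hε) (fun _ => zero_le)
      fun n => hle _
  exact tendstoInMeasure_ae_unique h1 h3

end IsHolderDomain

namespace IsHolderDomain

variable {η : ℝ≥0} {D : Set Plane}

/-- If the gradients of test functions converge in the exterior and their centered boundary values
converge, then the test functions, less their boundary means, converge in `H¹` on bounded parts of
the exterior. -/
theorem exists_tendsto_extCentered (hD : IsHolderDomain η D) (hext : IsConnected (closure D)ᶜ)
    {φ : ℕ → Plane → ℝ} (hφ : ∀ n, IsTestFun (φ n))
    {G : Lp Plane 2 (volume.restrict (closure D)ᶜ)} {q : HHalf D}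
    (hG : Tendsto (fun n => gradOf (H1.ofC1 (closure D)ᶜ (hφ n).isC1Fun)) atTop (𝓝 G))
    (hq : Tendsto (fun n => hD.centered (hφ n).isC1Fun) atTop (𝓝 q)) {R : ℝ}
    (hR : closure D ⊆ Metric.ball 0 R) :
    ∃ U : H1 (extBall D R),
      Tendsto (fun n => fnOf (hD.extCentered R (hφ n).isC1Fun)) atTop (𝓝 (fnOf U)) ∧
      gradOf U =ᵐ[volume.restrict (extBall D R)] G ∧
      (U, hD.traceQ q) ∈ traceGraph (extBall D R) (frontier D) := by
  obtain ⟨C, -, hC⟩ := hD.exists_exterior_poincare hext R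
  have hcau : CauchySeq fun n => hD.extCentered R (hφ n).isC1Fun := by
    refine cauchySeq_of_norm_sub_le (C := C + C * ‖extOne D R‖) hG.cauchySeq fun n m => ?_
    have h1 := (hC _ ((hφ n).isC1Fun.sub (hφ m).isC1Fun)).2 R le_rfl
    have h2 : extEnergy D ((hφ n).isC1Fun.sub (hφ m).isC1Fun)
        = ‖gradOf (H1.ofC1 (closure D)ᶜ (hφ n).isC1Fun)
          - gradOf (H1.ofC1 (closure D)ᶜ (hφ m).isC1Fun)‖ := by
      unfold extEnergy
      rw [H1.ofC1_sub (isOpen_exterior D) (hφ n).isC1Fun (hφ m).isC1Fun, gradOf_sub]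
    rw [h2] at h1
    rw [← hD.extCentered_sub]
    exact h1
  obtain ⟨U, hU⟩ := cauchySeq_tendsto_of_complete hcau
  refine ⟨U, ((fnOfL (extBall D R)).continuous.tendsto U).comp hU, ?_, ?_⟩
  · exact ae_eq_of_tendsto_of_tendsto (extBall_subset D R) (f := fun n => gradient (φ n))
      (fun n => hD.gradOf_extCentered R (hφ n).isC1Fun)
      (fun n => gradOf_ofC1 (closure D)ᶜ (hφ n).isC1Fun)
      (((gradOfL (extBall D R)).continuous.tendsto U).comp hU) hG
  · have h1 := hU.prodMk_nhds ((hD.traceQ.continuous.tendsto q).comp hq)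
    have h2 : (U, hD.traceQ q) ∈ closure
        (smoothTracePairs (extBall D R) (frontier D) : Set (H1 (extBall D R) × _)) :=
      mem_closure_of_tendsto h1
        (Eventually.of_forall fun n => hD.mem_traceGraph_extCentered hR (hφ n))
    exact h2

/-- Existence of a solution of finite energy, in the sense of the weak formulation, for the
exterior Neumann problem. It is the limit of test functions, normalized to have mean zero on the
boundary. -/
theorem exists_finite_energy_solution (hD : IsHolderDomain η D)
    (hext : IsConnected (closure D)ᶜ) : ∃ C : ℝ, 0 ≤ C ∧ ∀ g : HNegHalf0 D,
      ∃ (u : Plane → ℝ) (G : Lp Plane 2 (volume.restrict (closure D)ᶜ)) (q : HHalf D),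
        hD.mean q = 0 ∧ ‖q‖ ≤ C * ‖g‖ ∧ (g : StrongDual ℝ (HHalf D)) q = - ‖G‖ ^ 2 ∧
        (∀ R : ℝ, closure D ⊆ Metric.ball 0 R → ∃ U : H1 (extBall D R),
          fnOf U =ᵐ[volume.restrict (extBall D R)] u ∧
          gradOf U =ᵐ[volume.restrict (extBall D R)] G ∧
          (U, hD.traceQ q) ∈ traceGraph (extBall D R) (frontier D)) ∧
        ∀ φ (hφ : IsTestFun φ), ∫ x in (closure D)ᶜ, inner ℝ (G x) (gradient φ x)
          = - (g : StrongDual ℝ (HHalf D)) (boundaryValue (H1.ofC1 D hφ.isC1Fun)) := by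
  obtain ⟨C, hC0, hC⟩ := hD.exists_exterior_poincare hext 0
  have hS : ∀ p ∈ hD.exteriorPairs, ‖p.2‖ ≤ C * ‖p.1‖ := by
    rintro p ⟨φ, hφ, h1, h2⟩
    rw [h1, h2]
    exact (hC φ hφ.isC1Fun).1
  refine ⟨C * C, by positivity, fun g => ?_⟩
  obtain ⟨G, q, hmem, hsol, hqle, hen⟩ := exists_dual_solution hC0 hS
    (g : StrongDual ℝ (HHalf D))
  have hseq : ∃ (φ : ℕ → Plane → ℝ) (hφ : ∀ n, IsTestFun (φ n)),
      Tendsto (fun n => gradOf (H1.ofC1 (closure D)ᶜ (hφ n).isC1Fun)) atTop (𝓝 G) ∧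
      Tendsto (fun n => hD.centered (hφ n).isC1Fun) atTop (𝓝 q) := by
    have hmem' : (G, q) ∈ closure (hD.exteriorPairs : Set
      (Lp Plane 2 (volume.restrict (closure D)ᶜ) × HHalf D)) := hmem
    obtain ⟨p, hp, hlim⟩ := mem_closure_iff_seq_limit.1 hmem'
    choose φ hφ h1 h2 using hp
    refine ⟨φ, hφ, ?_, ?_⟩
    · exact (((continuous_fst.tendsto _).comp hlim).congr fun n => h1 n)
    · exact (((continuous_snd.tendsto _).comp hlim).congr fun n => h2 n)
  obtain ⟨φ, hφ, hlimG, hlimq⟩ := hseq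
  choose! U hU using fun R (hR : closure D ⊆ Metric.ball 0 R) =>
    hD.exists_tendsto_extCentered hext hφ hlimG hlimq hR
  obtain ⟨R₀, hR₀⟩ := hD.isBounded.closure.subset_ball (0 : Plane)
  have hball : ∀ k : ℕ, closure D ⊆ Metric.ball 0 (R₀ + k) := fun k =>
    hR₀.trans (Metric.ball_subset_ball (by linarith [Nat.cast_nonneg (α := ℝ) k]))
  -- the limits in the different balls are glued together
  let u : Plane → ℝ := fun x => fnOf (U (R₀ + (⌈‖x‖ - R₀⌉₊ + 1 : ℕ))) x
  have hfn := fun (R : ℝ) (n : ℕ) => hD.fnOf_extCentered R (hφ n).isC1Fun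
  have hu : ∀ R, closure D ⊆ Metric.ball 0 R →
      fnOf (U R) =ᵐ[volume.restrict (extBall D R)] u := by
    intro R hR
    have hcomp : ∀ k : ℕ, ∀ᵐ x ∂(volume.restrict (extBall D R)),
        x ∈ extBall D (R₀ + k) → fnOf (U R) x = fnOf (U (R₀ + k)) x := by
      intro k
      rw [ae_restrict_iff' (isOpen_extBall D R).measurableSet]
      rcases le_total R (R₀ + k) with h | h
      · have h1 := ae_eq_of_tendsto_of_tendsto (extBall_mono D h) (hfn R) (hfn (R₀ + k))
          (hU R hR).1 (hU _ (hball k)).1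
        have h2 := (ae_restrict_iff' (isOpen_extBall D R).measurableSet).1 h1
        filter_upwards [h2] with x hx hxR _
        exact hx hxR
      · have h1 := ae_eq_of_tendsto_of_tendsto (extBall_mono D h) (hfn (R₀ + k)) (hfn R)
          (hU _ (hball k)).1 (hU R hR).1
        have h2 := (ae_restrict_iff' (isOpen_extBall D (R₀ + k)).measurableSet).1 h1
        filter_upwards [h2] with x hx _ hxk
        exact (hx hxk).symm
    filter_upwards [ae_all_iff.2 hcomp, ae_restrict_mem (isOpen_extBall D R).measurableSet]
      with x hx hxR
    refine hx _ ⟨?_, hxR.2⟩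
    rw [mem_ball_zero_iff]
    have := Nat.le_ceil (‖x‖ - R₀)
    push_cast
    linarith
  refine ⟨u, G, q, ?_, ?_, hen, fun R hR => ⟨U R, hu R hR, (hU R hR).2⟩, fun ψ hψ => ?_⟩
  · have h1 : Tendsto (fun n => hD.mean (hD.centered (hφ n).isC1Fun)) atTop (𝓝 (hD.mean q)) :=
      (hD.mean.continuous.tendsto q).comp hlimq
    refine tendsto_nhds_unique h1 ?_
    have h2 : ∀ n, hD.mean (hD.centered (hφ n).isC1Fun) = 0 := fun n => by
      unfold centered
      rw [map_sub, map_smul, hD.mean_one, smul_eq_mul, mul_one, sub_self]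
    simp only [h2]
    exact tendsto_const_nhds
  · refine hqle.trans (le_of_eq ?_)
    have : ‖(g : StrongDual ℝ (HHalf D))‖ = ‖g‖ := rfl
    rw [this]
    ring
  · have h1 := hsol (gradOf (H1.ofC1 (closure D)ᶜ hψ.isC1Fun), hD.centered hψ.isC1Fun)
      ⟨ψ, hψ, rfl, rfl⟩
    have h2 : (g : StrongDual ℝ (HHalf D)) (hD.centered hψ.isC1Fun)
        = (g : StrongDual ℝ (HHalf D)) (boundaryValue (H1.ofC1 D hψ.isC1Fun)) := by
      unfold centered
      rw [map_sub, map_smul, hD.apply_one_of_mem, smul_zero, sub_zero]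
    rw [← h2, ← h1, L2.inner_def]
    refine integral_congr_ae ?_
    filter_upwards [gradOf_ofC1 (closure D)ᶜ hψ.isC1Fun] with x hx
    rw [hx]

end IsHolderDomain

/-! ### Decay of holomorphic functions that are square integrable near infinity -/

/-- The mean value property on a circle, in the form of an upper bound. -/
theorem enorm_sq_le_lintegral_circle {f : ℂ → ℂ} {z : ℂ} {r ρ : ℝ} (hρ : 0 < ρ) (hr : ρ < r)
    (hf : DifferentiableOn ℂ f (Metric.ball z r)) :
    ENNReal.ofReal (2 * Real.pi) * ‖f z‖ₑ ^ 2 ≤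
      ∫⁻ θ in Ioo (-Real.pi) Real.pi, ‖f (circleMap z ρ θ)‖ₑ ^ 2 := by
  have hsub : Metric.closedBall z ρ ⊆ Metric.ball z r := Metric.closedBall_subset_ball hr
  have hd : DiffContOnCl ℂ (fun w => f w ^ 2) (Metric.ball z |ρ|) := by
    rw [abs_of_pos hρ]
    refine DifferentiableOn.diffContOnCl ?_
    rw [closure_ball z hρ.ne']
    exact (hf.mono hsub).pow 2
  have h1 := hd.circleAverage
  rw [Real.circleAverage_eq_integral_add (-Real.pi)] at h1
  rw [intervalIntegral.integral_comp_add_right (fun θ => f (circleMap z ρ θ) ^ 2)] at h1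
  rw [show (0 : ℝ) + -Real.pi = -Real.pi by ring,
    show 2 * Real.pi + -Real.pi = Real.pi by ring] at h1
  have h2 : ‖f z‖ₑ ^ 2 = ‖(2 * Real.pi)⁻¹‖ₑ *
      ‖∫ θ in (-Real.pi)..Real.pi, f (circleMap z ρ θ) ^ 2‖ₑ := by
    rw [← enorm_smul, h1, enorm_pow]
  have h3 : ENNReal.ofReal (2 * Real.pi) * ‖(2 * Real.pi)⁻¹‖ₑ = 1 := by
    rw [Real.enorm_of_nonneg (by positivity), ← ENNReal.ofReal_mul (by positivity),
      mul_inv_cancel₀ (by positivity), ENNReal.ofReal_one]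
  rw [h2, ← mul_assoc, h3, one_mul]
  rw [intervalIntegral.integral_of_le (by linarith [Real.pi_pos])]
  rw [integral_Ioc_eq_integral_Ioo]
  refine (enorm_integral_le_lintegral_enorm _).trans_eq ?_
  simp only [enorm_pow]

/-- The mean value inequality on a disc. -/
theorem ofReal_sq_mul_enorm_sq_le {f : ℂ → ℂ} {z : ℂ} {r : ℝ} (hr : 0 < r)
    (hf : DifferentiableOn ℂ f (Metric.ball z r)) :
    ENNReal.ofReal (r ^ 2) * ‖f z‖ₑ ^ 2 ≤ ∫⁻ w in Metric.ball z r, ‖f w‖ₑ ^ 2 := by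
  classical
  set g : ℂ → ℂ := (Metric.ball z r).indicator f with hg
  have hgm : Measurable g := by
    rw [hg, ← Set.piecewise_eq_indicator]
    exact hf.continuousOn.measurable_piecewise continuousOn_const Metric.isOpen_ball.measurableSet
  set F : ℂ → ℝ≥0∞ := fun w => ‖g (z + w)‖ₑ ^ 2 with hF
  have hFm : Measurable F := (hgm.comp (measurable_const_add z)).enorm.pow_const 2
  have h1 : ∫⁻ w in Metric.ball z r, ‖f w‖ₑ ^ 2 = ∫⁻ w, F w := by
    rw [hF, lintegral_add_left_eq_self (fun w => ‖g w‖ₑ ^ 2) z,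
      ← lintegral_indicator Metric.isOpen_ball.measurableSet]
    refine lintegral_congr fun w => ?_
    by_cases hw : w ∈ Metric.ball z r <;> simp [hg, hw]
  rw [h1, ← Complex.lintegral_comp_polarCoord_symm]
  have hP : Measurable fun p : ℝ × ℝ => ENNReal.ofReal p.1 • F (Complex.polarCoord.symm p) := by
    simp only [Complex.polarCoord_symm_apply, smul_eq_mul]
    refine (ENNReal.measurable_ofReal.comp measurable_fst).mul (hFm.comp ?_)
    fun_prop
  calc ENNReal.ofReal (r ^ 2) * ‖f z‖ₑ ^ 2
      ≤ ∫⁻ _ in Ioo (r / 2) r,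
          ENNReal.ofReal (r / 2) * (ENNReal.ofReal (2 * Real.pi) * ‖f z‖ₑ ^ 2) := by
        rw [setLIntegral_const, Real.volume_Ioo, mul_comm, ← mul_assoc, mul_right_comm,
          mul_comm (_ * _) (‖f z‖ₑ ^ 2), ← ENNReal.ofReal_mul (by positivity),
          ← ENNReal.ofReal_mul (by positivity)]
        gcongr
        nlinarith [Real.pi_gt_three, sq_nonneg r]
    _ ≤ ∫⁻ ρ in Ioo (r / 2) r, ∫⁻ θ in Ioo (-Real.pi) Real.pi,
          ENNReal.ofReal ρ • F (Complex.polarCoord.symm (ρ, θ)) := by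
        refine setLIntegral_mono' measurableSet_Ioo fun ρ hρ => ?_
        have hρ0 : 0 < ρ := by linarith [hρ.1]
        have e : ∀ θ : ℝ, z + Complex.polarCoord.symm (ρ, θ) = circleMap z ρ θ := by
          intro θ
          rw [Complex.polarCoord_symm_apply, circleMap, Complex.exp_mul_I]
          simp
        have hmem : ∀ θ : ℝ, circleMap z ρ θ ∈ Metric.ball z r := by
          intro θ
          rw [Metric.mem_ball, dist_eq_norm, circleMap_sub_center, norm_circleMap_zero,
            abs_of_pos hρ0]
          exact hρ.2
        have e2 : ∀ θ : ℝ, F (Complex.polarCoord.symm (ρ, θ)) = ‖f (circleMap z ρ θ)‖ₑ ^ 2 := by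
          intro θ
          rw [hF]
          simp only [e, hg, indicator_of_mem (hmem θ)]
        simp only [e2, smul_eq_mul]
        rw [lintegral_const_mul']
        · gcongr
          · exact hρ.1.le
          · exact enorm_sq_le_lintegral_circle hρ0 hρ.2 hf
        · exact ENNReal.ofReal_ne_top
    _ = ∫⁻ p in Ioo (r / 2) r ×ˢ Ioo (-Real.pi) Real.pi,
          ENNReal.ofReal p.1 • F (Complex.polarCoord.symm p) := by
        rw [Measure.volume_eq_prod, ← Measure.prod_restrict, lintegral_prod _ hP.aemeasurable]
    _ ≤ ∫⁻ p in polarCoord.target, ENNReal.ofReal p.1 • F (Complex.polarCoord.symm p) := by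
        refine lintegral_mono_set (prod_mono (fun ρ hρ => ?_) subset_rfl)
        exact lt_trans (by positivity) hρ.1

theorem mul_norm_le_of_lintegral_le {f : ℂ → ℂ} {z : ℂ} {M : ℝ≥0} 
    (hf : DifferentiableOn ℂ f (Metric.ball z (‖z‖ / 2)))
    (hM : ∫⁻ w in Metric.ball z (‖z‖ / 2), ‖f w‖ₑ ^ 2 ≤ (M : ℝ≥0∞) ^ 2) :
    ‖z‖ * ‖f z‖ ≤ 2 * M := by
  rcases (norm_nonneg z).eq_or_lt with h0 | h0
  · rw [← h0, zero_mul]; positivity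
  have h1 := (ofReal_sq_mul_enorm_sq_le (half_pos h0) hf).trans hM
  have h2 : ENNReal.ofReal ((‖z‖ / 2 * ‖f z‖) ^ 2) ≤ ENNReal.ofReal ((M : ℝ) ^ 2) := by
    rw [mul_pow, ENNReal.ofReal_mul (by positivity), ENNReal.ofReal_pow (norm_nonneg (f z)),
      ofReal_norm, ENNReal.ofReal_pow (NNReal.coe_nonneg M), ENNReal.ofReal_coe_nnreal]
    exact h1
  have h3 := (ENNReal.ofReal_le_ofReal_iff (by positivity)).1 h2
  have h4 := abs_le_of_sq_le_sq h3 (NNReal.coe_nonneg M)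
  rw [abs_of_nonneg (by positivity)] at h4
  linarith

/-- A holomorphic function that is square integrable near infinity is `O(|z|⁻²)`, with a constant
controlled by the integral: in terms of `w = 1/z`, the function `f(1/w)/w` has a removable
singularity at `0` and vanishes there, so that Schwarz's lemma applies. -/
theorem norm_le_div_sq_of_lintegral_le {f : ℂ → ℂ} {R : ℝ} (hR : 0 < R) {M : ℝ≥0}
    (hf : DifferentiableOn ℂ f {z | R < ‖z‖})
    (hM : ∫⁻ z in {z : ℂ | R < ‖z‖}, ‖f z‖ₑ ^ 2 ≤ (M : ℝ≥0∞) ^ 2) {z : ℂ} (hz : 2 * R < ‖z‖) :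
    ‖f z‖ ≤ 4 * M * R / ‖z‖ ^ 2 := by
  have hball : ∀ w : ℂ, 2 * R < ‖w‖ → Metric.ball w (‖w‖ / 2) ⊆ {z | ‖w‖ / 2 < ‖z‖} := by
    intro w _ y hy
    rw [Metric.mem_ball, dist_eq_norm] at hy
    have := norm_sub_norm_le w y
    rw [norm_sub_rev] at this
    change ‖w‖ / 2 < ‖y‖
    linarith
  have hball' : ∀ w : ℂ, 2 * R < ‖w‖ → {z : ℂ | ‖w‖ / 2 < ‖z‖} ⊆ {z : ℂ | R < ‖z‖} := by
    intro w hw y hy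
    have hy' : ‖w‖ / 2 < ‖y‖ := hy
    change R < ‖y‖
    linarith
  have hdf : ∀ w : ℂ, 2 * R < ‖w‖ → DifferentiableOn ℂ f (Metric.ball w (‖w‖ / 2)) := fun w hw =>
    hf.mono ((hball w hw).trans (hball' w hw))
  have hb : ∀ w : ℂ, 2 * R < ‖w‖ → ‖w‖ * ‖f w‖ ≤ 2 * M := fun w hw =>
    mul_norm_le_of_lintegral_le (hdf w hw)
      ((lintegral_mono_set ((hball w hw).trans (hball' w hw))).trans hM)
  -- the bound improves at infinity, since the integral over the exterior of large discs is small
  have hsmall : ∀ ε : ℝ≥0, 0 < ε → ∃ S : ℝ, ∀ w : ℂ, S < ‖w‖ → ‖w‖ * ‖f w‖ ≤ 2 * ε := by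
    intro ε hε
    have hms : ∀ n : ℕ, MeasurableSet {z : ℂ | (n : ℝ) < ‖z‖} := fun n =>
      (isOpen_lt continuous_const continuous_norm).measurableSet
    have hmR : MeasurableSet {z : ℂ | R < ‖z‖} :=
      (isOpen_lt continuous_const continuous_norm).measurableSet
    have hfm : AEMeasurable (fun z => ‖f z‖ₑ ^ 2) (volume.restrict {z : ℂ | R < ‖z‖}) :=
      (hf.continuousOn.aemeasurable hmR).enorm.pow_const 2
    have hlim := tendsto_lintegral_of_dominated_convergence' (μ := volume.restrict {z : ℂ | R < ‖z‖})
      (F := fun (n : ℕ) => {z : ℂ | (n : ℝ) < ‖z‖}.indicator fun z => ‖f z‖ₑ ^ 2) (f := fun _ => 0)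
      (fun z => ‖f z‖ₑ ^ 2) (fun n => hfm.indicator (hms n))
      (fun n => ae_of_all _ fun z => indicator_le_self _ _ z) (ne_top_of_le_ne_top (by simp) hM)
      (ae_of_all _ fun z => by
        obtain ⟨N, hN⟩ := exists_nat_ge ‖z‖
        refine tendsto_const_nhds.congr' ?_
        filter_upwards [eventually_ge_atTop N] with n hn
        have hn' : (N : ℝ) ≤ n := by exact_mod_cast hn
        have : z ∉ {z : ℂ | (n : ℝ) < ‖z‖} := fun h => by
          have h' : (n : ℝ) < ‖z‖ := h
          linarith
        rw [indicator_of_notMem this])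
    rw [lintegral_zero] at hlim
    obtain ⟨n, hn⟩ := (hlim.eventually_lt_const (show (0 : ℝ≥0∞) < (ε : ℝ≥0∞) ^ 2 by
      positivity)).exists
    refine ⟨max (2 * R) (2 * n), fun w hw => ?_⟩
    have hw1 : 2 * R < ‖w‖ := lt_of_le_of_lt (le_max_left _ _) hw
    have hw2 : 2 * (n : ℝ) < ‖w‖ := lt_of_le_of_lt (le_max_right _ _) hw
    refine mul_norm_le_of_lintegral_le (hdf w hw1) (le_trans ?_ hn.le)
    rw [lintegral_indicator (hms n), Measure.restrict_restrict (hms n)]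
    refine lintegral_mono_set fun y hy => ⟨?_, hball' w hw1 (hball w hw1 hy)⟩
    have h' : ‖w‖ / 2 < ‖y‖ := hball w hw1 hy
    change (n : ℝ) < ‖y‖
    linarith
  set Q : ℂ → ℂ := fun w => f w⁻¹ / w with hQ
  have hQ0 : Q 0 = 0 := by simp [hQ]
  have hQn : ∀ w, ‖Q w‖ = ‖w⁻¹‖ * ‖f w⁻¹‖ := fun w => by
    rw [hQ, norm_div, norm_inv, div_eq_inv_mul]
  have hinv : ∀ w ∈ Metric.ball (0 : ℂ) (2 * R)⁻¹, w ≠ 0 → 2 * R < ‖w⁻¹‖ := by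
    intro w hw hw0
    rw [mem_ball_zero_iff] at hw
    rw [norm_inv]
    exact (lt_inv_comm₀ (by positivity) (norm_pos_iff.2 hw0)).2 hw
  have hQM : ∀ w ∈ Metric.ball (0 : ℂ) (2 * R)⁻¹, ‖Q w‖ ≤ 2 * M := by
    intro w hw
    rcases eq_or_ne w 0 with rfl | hw0
    · rw [hQ0, norm_zero]; positivity
    · rw [hQn]
      exact hb _ (hinv w hw hw0)
  have hnhds : Metric.ball (0 : ℂ) (2 * R)⁻¹ ∈ 𝓝 (0 : ℂ) :=
    Metric.ball_mem_nhds _ (by positivity)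
  have hQd : DifferentiableOn ℂ Q (Metric.ball 0 (2 * R)⁻¹) := by
    refine (Complex.differentiableOn_compl_singleton_and_continuousAt_iff hnhds).1 ⟨?_, ?_⟩
    · intro w hw
      have hw0 : w ≠ 0 := hw.2
      have h1 : DifferentiableAt ℂ f w⁻¹ := by
        refine hf.differentiableAt ((isOpen_lt continuous_const continuous_norm).mem_nhds ?_)
        have := hinv w hw.1 hw0
        change R < ‖w⁻¹‖
        linarith
      exact ((h1.comp w (differentiableAt_inv hw0)).div differentiableAt_id
        hw0).differentiableWithinAt
    · rw [Metric.continuousAt_iff]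
      intro ε hε
      obtain ⟨S, hS⟩ := hsmall (Real.toNNReal (ε / 4)) (Real.toNNReal_pos.2 (by positivity))
      refine ⟨(|S| + 1)⁻¹, by positivity, fun {w} hw => ?_⟩
      rw [hQ0, dist_zero_right]
      rw [dist_zero_right] at hw
      rcases eq_or_ne w 0 with rfl | hw0
      · rw [hQ0, norm_zero]; exact hε
      · rw [hQn]
        have h1 : |S| + 1 < ‖w⁻¹‖ := by
          rw [norm_inv]
          exact (lt_inv_comm₀ (by positivity) (norm_pos_iff.2 hw0)).2 hw
        have h2 := hS w⁻¹ (by linarith [le_abs_self S])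
        rw [Real.coe_toNNReal _ (by positivity)] at h2
        linarith
  have hz0 : z ≠ 0 := norm_pos_iff.1 (by linarith)
  have hzb : z⁻¹ ∈ Metric.ball (0 : ℂ) (2 * R)⁻¹ := by
    rw [mem_ball_zero_iff, norm_inv]
    exact inv_strictAnti₀ (by positivity) hz
  have hS := Complex.dist_le_div_mul_dist_of_mapsTo_ball (R₂ := 2 * M) hQd (fun w hw => by
    rw [hQ0, mem_closedBall_zero_iff]
    exact hQM w hw) hzb
  rw [hQ0, dist_zero_right, dist_zero_right, hQn, inv_inv, norm_inv] at hS
  have hzp : 0 < ‖z‖ := norm_pos_iff.2 hz0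
  rw [le_div_iff₀ (by positivity)]
  calc ‖f z‖ * ‖z‖ ^ 2 = ‖z‖ * (‖z‖ * ‖f z‖) := by ring
    _ ≤ ‖z‖ * (2 * M / (2 * R)⁻¹ * ‖z‖⁻¹) := by gcongr
    _ = 4 * M * R := by field_simp; ring

/-! ### Harmonic functions with finite energy near infinity -/

/-- If the derivative of `h` is `O(|z|⁻²)`, then `ζ ↦ h (1/ζ)` is Lipschitz along segments that avoid
the origin: the bound for the derivative cancels the factor `|ζ|⁻²` of the inversion. -/
theorem abs_comp_inv_sub_le {h : ℂ → ℝ} {R A : ℝ} (hR : 0 < R)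
    (hd : ∀ z, R < ‖z‖ → DifferentiableAt ℝ h z)
    (hA : ∀ z, R < ‖z‖ → ‖fderiv ℝ h z‖ ≤ A / ‖z‖ ^ 2) {ζ ξ : ℂ} (hζ : ‖ζ‖ < R⁻¹) (hξ : ‖ξ‖ < R⁻¹)
    (h0 : (0 : ℂ) ∉ segment ℝ ζ ξ) : |h ζ⁻¹ - h ξ⁻¹| ≤ A * ‖ζ - ξ‖ := by
  have hmem : ∀ w ∈ segment ℝ ζ ξ, w ≠ 0 ∧ R < ‖w⁻¹‖ := by
    intro w hw
    have hw0 : w ≠ 0 := fun h => h0 (h ▸ hw)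
    have hw1 : w ∈ Metric.ball (0 : ℂ) R⁻¹ :=
      (convex_ball (0 : ℂ) R⁻¹).segment_subset (mem_ball_zero_iff.2 hζ) (mem_ball_zero_iff.2 hξ) hw
    refine ⟨hw0, ?_⟩
    rw [mem_ball_zero_iff] at hw1
    rw [norm_inv]
    exact (lt_inv_comm₀ hR (norm_pos_iff.2 hw0)).2 hw1
  have hder : ∀ w ∈ segment ℝ ζ ξ, HasFDerivWithinAt (fun w => h w⁻¹)
      ((fderiv ℝ h w⁻¹).comp
        ((ContinuousLinearMap.toSpanSingleton ℂ (-(w ^ 2)⁻¹)).restrictScalars ℝ))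
      (segment ℝ ζ ξ) w := by
    intro w hw
    have h1 : HasFDerivAt (fun w : ℂ => w⁻¹)
        ((ContinuousLinearMap.toSpanSingleton ℂ (-(w ^ 2)⁻¹)).restrictScalars ℝ) w :=
      (hasDerivAt_inv (hmem w hw).1).hasFDerivAt.restrictScalars ℝ
    exact ((hd _ (hmem w hw).2).hasFDerivAt.comp w h1).hasFDerivWithinAt
  have hbound : ∀ w ∈ segment ℝ ζ ξ, ‖(fderiv ℝ h w⁻¹).comp
      ((ContinuousLinearMap.toSpanSingleton ℂ (-(w ^ 2)⁻¹)).restrictScalars ℝ)‖ ≤ A := by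
    intro w hw
    have hwp : 0 < ‖w‖ := norm_pos_iff.2 (hmem w hw).1
    refine (ContinuousLinearMap.opNorm_comp_le _ _).trans ?_
    rw [ContinuousLinearMap.norm_restrictScalars, ContinuousLinearMap.norm_toSpanSingleton,
      norm_neg, norm_inv, norm_pow]
    have h2 := hA _ (hmem w hw).2
    rw [norm_inv] at h2
    calc _ ≤ A / ‖w‖⁻¹ ^ 2 * (‖w‖ ^ 2)⁻¹ := by gcongr
      _ = A := by field_simp
  have key := (convex_segment ζ ξ).norm_image_sub_le_of_norm_hasFDerivWithin_le hder hbound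
    (right_mem_segment ℝ ζ ξ) (left_mem_segment ℝ ζ ξ)
  exact key

/-- A function whose gradient is `O(|z|⁻²)` converges at infinity at the rate `|z|⁻¹`: as a function
of `1/z` it is Lipschitz. Opposite points are joined by a detour around the origin. -/
theorem abs_sub_le_of_norm_fderiv_le {h : ℂ → ℝ} {R A : ℝ} (hR : 0 < R) (hA0 : 0 ≤ A)
    (hd : ∀ z, R < ‖z‖ → DifferentiableAt ℝ h z)
    (hA : ∀ z, R < ‖z‖ → ‖fderiv ℝ h z‖ ≤ A / ‖z‖ ^ 2) {z w : ℂ} (hz : R < ‖z‖) (hw : R < ‖w‖) :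
    |h z - h w| ≤ A * (3 * ‖z‖⁻¹ + ‖w‖⁻¹) := by
  have hz0 : z ≠ 0 := norm_pos_iff.1 (hR.trans hz)
  have hw0 : w ≠ 0 := norm_pos_iff.1 (hR.trans hw)
  obtain ⟨ζ, rfl⟩ : ∃ ζ : ℂ, z = ζ⁻¹ := ⟨z⁻¹, (inv_inv z).symm⟩
  obtain ⟨ξ, rfl⟩ : ∃ ξ : ℂ, w = ξ⁻¹ := ⟨w⁻¹, (inv_inv w).symm⟩
  have hζ0 : ζ ≠ 0 := fun h => hz0 (by rw [h, inv_zero])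
  have hξ0 : ξ ≠ 0 := fun h => hw0 (by rw [h, inv_zero])
  have hζ : ‖ζ‖ < R⁻¹ := by
    rw [norm_inv] at hz
    exact (lt_inv_comm₀ hR (norm_pos_iff.2 hζ0)).1 hz
  have hξ : ‖ξ‖ < R⁻¹ := by
    rw [norm_inv] at hw
    exact (lt_inv_comm₀ hR (norm_pos_iff.2 hξ0)).1 hw
  rw [norm_inv, norm_inv, inv_inv, inv_inv]
  by_cases h0 : (0 : ℂ) ∈ segment ℝ ζ ξ
  · obtain ⟨a, b, ha, hb, hab, hs⟩ := h0
    have hI : ‖Complex.I * ζ‖ = ‖ζ‖ := by rw [norm_mul, Complex.norm_I, one_mul]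
    have h1 : (0 : ℂ) ∉ segment ℝ ζ (Complex.I * ζ) := by
      rintro ⟨c, d, -, -, hcd, hs'⟩
      have e : ((c : ℂ) + d * Complex.I) * ζ = 0 := by
        rw [← hs']; simp only [Complex.real_smul]; ring
      have e2 := (mul_eq_zero.1 e).resolve_right hζ0
      have er := congrArg Complex.re e2
      have ei := congrArg Complex.im e2
      simp at er ei
      rw [er, ei] at hcd
      norm_num at hcd
    have hb0 : b ≠ 0 := by
      rintro rfl
      have : a = 1 := by linarith
      rw [this] at hs
      simp at hs
      exact hζ0 hs
    have ha0 : a ≠ 0 := by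
      rintro rfl
      have : b = 1 := by linarith
      rw [this] at hs
      simp at hs
      exact hξ0 hs
    have h2 : (0 : ℂ) ∉ segment ℝ (Complex.I * ζ) ξ := by
      rintro ⟨c, d, -, -, hcd, hs'⟩
      have e : (((b * c : ℝ) : ℂ) * Complex.I - ((a * d : ℝ) : ℂ)) * ζ = 0 := by
        simp only [Complex.real_smul] at hs hs'
        push_cast
        linear_combination (b : ℂ) * hs' - (d : ℂ) * hs
      have e2 := (mul_eq_zero.1 e).resolve_right hζ0
      have er := congrArg Complex.re e2
      have ei := congrArg Complex.im e2
      simp at er ei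
      have hc : c = 0 := ei.resolve_left hb0
      have hd' : d = 0 := er.resolve_left ha0
      rw [hc, hd'] at hcd
      norm_num at hcd
    have k1 := abs_comp_inv_sub_le hR hd hA hζ (by rwa [hI]) h1
    have k2 := abs_comp_inv_sub_le hR hd hA (by rwa [hI]) hξ h2
    have n1 : ‖ζ - Complex.I * ζ‖ ≤ 2 * ‖ζ‖ := by
      refine (norm_sub_le _ _).trans ?_
      rw [hI]; linarith
    have n2 : ‖Complex.I * ζ - ξ‖ ≤ ‖ζ‖ + ‖ξ‖ := by
      refine (norm_sub_le _ _).trans ?_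
      rw [hI]
    calc |h ζ⁻¹ - h ξ⁻¹| ≤ |h ζ⁻¹ - h (Complex.I * ζ)⁻¹| + |h (Complex.I * ζ)⁻¹ - h ξ⁻¹| :=
          abs_sub_le _ _ _
      _ ≤ A * ‖ζ - Complex.I * ζ‖ + A * ‖Complex.I * ζ - ξ‖ := add_le_add k1 k2
      _ ≤ A * (2 * ‖ζ‖) + A * (‖ζ‖ + ‖ξ‖) := by gcongr
      _ = _ := by ring
  · refine (abs_comp_inv_sub_le hR hd hA hζ hξ h0).trans ?_
    gcongr
    refine (norm_sub_le _ _).trans ?_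
    linarith [norm_nonneg ζ]

theorem norm_le_norm_complex_partial (L : ℂ →L[ℝ] ℝ) :
    ‖L‖ ≤ ‖(L 1 : ℂ) - Complex.I * L Complex.I‖ := by
  refine ContinuousLinearMap.opNorm_le_bound _ (norm_nonneg _) fun z => ?_
  have h1 : L z = (((L 1 : ℂ) - Complex.I * L Complex.I) * z).re := by
    have : z = z.re • (1 : ℂ) + z.im • Complex.I := by
      simp [Complex.re_add_im]
    conv_lhs => rw [this]
    rw [map_add, map_smul, map_smul]
    simp
    ring
  rw [h1, ← norm_mul]
  exact Complex.abs_re_le_norm _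

/-- A harmonic function of finite energy near infinity converges at infinity, with a rate that is
controlled by the energy. -/
theorem abs_sub_le_of_harmonicAt {h : ℂ → ℝ} {R : ℝ} (hR : 0 < R) {M : ℝ≥0}
    (hh : ∀ z, R < ‖z‖ → InnerProductSpace.HarmonicAt h z)
    (hM : ∫⁻ z in {z : ℂ | R < ‖z‖},
      ‖(fderiv ℝ h z 1 : ℂ) - Complex.I * fderiv ℝ h z Complex.I‖ₑ ^ 2 ≤ (M : ℝ≥0∞) ^ 2)
    {z w : ℂ} (hz : 2 * R < ‖z‖) (hw : 2 * R < ‖w‖) :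
    |h z - h w| ≤ 4 * M * R * (3 * ‖z‖⁻¹ + ‖w‖⁻¹) := by
  refine abs_sub_le_of_norm_fderiv_le (R := 2 * R) (by positivity) (by positivity)
    (fun z hz => ?_) (fun z hz => ?_) hz hw
  · exact (hh z (by linarith)).1.differentiableAt (by simp)
  · refine (norm_le_norm_complex_partial _).trans ?_
    refine norm_le_div_sq_of_lintegral_le
      (f := fun z => (fderiv ℝ h z 1 : ℂ) - Complex.I * fderiv ℝ h z Complex.I) hR ?_ hM hz
    intro y hy
    exact (HarmonicAt.differentiableAt_complex_partial (hh y hy)).differentiableWithinAt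

/-! ### Decay at infinity -/

/-- The standard identification of `ℂ` with the plane. -/
def complexPlane : ℂ ≃ₗᵢ[ℝ] Plane := Complex.orthonormalBasisOneI.repr

theorem inner_complexPlane_one (x : Plane) : inner ℝ x (complexPlane 1) = x 0 := by
  simp [PiLp.inner_apply, complexPlane]

theorem inner_complexPlane_I (x : Plane) : inner ℝ x (complexPlane Complex.I) = x 1 := by
  simp [PiLp.inner_apply, complexPlane]

theorem IsMollifier.tsupport_comp_sub_left_subset {k : Plane → ℝ} {δ R : ℝ} (hk : IsMollifier k δ)
    {x : Plane} (hx : R + δ < ‖x‖) : tsupport (fun y => k (x - y)) ⊆ {y | R < ‖y‖} := by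
  have h1 : tsupport (fun y => k (x - y)) ⊆ {y | ‖x - y‖ ≤ δ} := by
    refine closure_minimal (fun y hy => ?_) (isClosed_le (by fun_prop) continuous_const)
    exact (hk.norm_lt _ hy).le
  intro y hy
  have h2 : ‖x - y‖ ≤ δ := h1 hy
  have h3 := norm_sub_norm_le x y
  change R < ‖y‖
  linarith

theorem fderiv_comp_complexPlane {H : Plane → ℝ} (z v : ℂ) :
    fderiv ℝ (fun z => H (complexPlane z)) z v = fderiv ℝ H (complexPlane z) (complexPlane v) := by
  have := complexPlane.toContinuousLinearEquiv.comp_right_fderiv (f := H) (x := z)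
  have h2 : (fun z => H (complexPlane z)) = H ∘ complexPlane.toContinuousLinearEquiv := rfl
  rw [h2, this]
  rfl

theorem IsTestFun.fderiv_apply {k : Plane → ℝ} (hk : IsTestFun k) (w : Plane) :
    IsTestFun fun z => fderiv ℝ k z w :=
  ⟨(hk.1.fderiv_right (by simp)).clm_apply contDiff_const, hk.2.fderiv_apply (𝕜 := ℝ) w⟩

theorem integral_indicator_mul {Ω : Set Plane} (hΩ : MeasurableSet Ω) (a b : Plane → ℝ) :
    ∫ y, Ω.indicator a y * b y = ∫ y in Ω, a y * b y := by
  rw [← integral_indicator hΩ]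
  refine integral_congr_ae (ae_of_all _ fun y => ?_)
  by_cases hy : y ∈ Ω <;> simp [hy]

theorem enorm_ofReal_sub_I_mul_sq (a b : ℝ) :
    ‖(a : ℂ) - Complex.I * b‖ₑ ^ 2 = ‖a‖ₑ ^ 2 + ‖b‖ₑ ^ 2 := by
  have h1 : ‖(a : ℂ) - Complex.I * b‖ ^ 2 = ‖a‖ ^ 2 + ‖b‖ ^ 2 := by
    rw [Complex.sq_norm, Complex.normSq_apply]
    simp
    ring
  simp only [← ofReal_norm, ← ENNReal.ofReal_pow (norm_nonneg _)]
  rw [h1, ENNReal.ofReal_add (by positivity) (by positivity)]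

/-- The energy near infinity of the sum of two functions on the plane, read in `ℂ`. -/
theorem setLIntegral_complexPlane_le {a b : Plane → ℝ≥0∞} (ha : Measurable a) (hb : Measurable b)
    (s : Set ℂ) : ∫⁻ z in s, (a (complexPlane z) + b (complexPlane z))
      ≤ (∫⁻ x, a x) + ∫⁻ x, b x := by
  refine (setLIntegral_le_lintegral _ _).trans (le_of_eq ?_)
  rw [← lintegral_add_left ha]
  exact complexPlane.measurePreserving.lintegral_comp (ha.add hb)

theorem measurable_enorm_moll_sq {k f : Plane → ℝ} (hk : IsTestFun k) (hf : MemLp f 2 volume) :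
    Measurable fun x => ‖moll k f x‖ₑ ^ 2 := by
  have h := (contDiff_moll hk (hf.locallyIntegrable one_le_two)).continuous
  exact h.enorm.measurable.pow_const 2

section Mollification

variable {R δ : ℝ} {u : Plane → ℝ} {G : Plane → Plane} {k : Plane → ℝ}

theorem isOpen_norm_gt (R : ℝ) : IsOpen {x : Plane | R < ‖x‖} :=
  isOpen_lt continuous_const continuous_norm

/-- The second derivatives of the mollification of a function with weak gradient `G`. -/
theorem fderiv_fderiv_moll_comp_complexPlane
    (hu : LocallyIntegrable ({x : Plane | R < ‖x‖}.indicator u) volume)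
    (hw : ∀ ψ : Plane → ℝ, IsTestFun ψ → tsupport ψ ⊆ {x : Plane | R < ‖x‖} → ∀ w,
      ∫ x in {x : Plane | R < ‖x‖}, u x * fderiv ℝ ψ x w
        = - ∫ x in {x : Plane | R < ‖x‖}, ψ x * inner ℝ (G x) w)
    (hk : IsMollifier k δ) {z : ℂ} (hz : R + δ < ‖z‖) (v : ℂ) :
    fderiv ℝ (fderiv ℝ fun z => moll k ({x : Plane | R < ‖x‖}.indicator u) (complexPlane z)) z v v
      = - ∫ y in {x : Plane | R < ‖x‖}, inner ℝ (G y) (complexPlane v)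
          * fderiv ℝ (fun y => k (complexPlane z - y)) y (complexPlane v) := by
  set Ω := {x : Plane | R < ‖x‖}
  have hΩ : MeasurableSet Ω := (isOpen_norm_gt R).measurableSet
  set h : ℂ → ℝ := fun z => moll k (Ω.indicator u) (complexPlane z)
  have hk' := hk.isTestFun.fderiv_apply (complexPlane v)
  have hsm : ContDiff ℝ ∞ h :=
    (contDiff_moll hk.isTestFun hu).comp complexPlane.contDiff
  have hd : DifferentiableAt ℝ (fderiv ℝ h) z :=
    ((hsm.fderiv_right (m := ∞) (by simp)).differentiable (by simp)) z
  have h1 : fderiv ℝ (fun y => fderiv ℝ h y v) z v = fderiv ℝ (fderiv ℝ h) z v v := by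
    rw [fderiv_clm_apply hd (differentiableAt_const v)]
    simp
  have h2 : (fun y => fderiv ℝ h y v) = fun y =>
      moll (fun z => fderiv ℝ k z (complexPlane v)) (Ω.indicator u) (complexPlane y) := by
    funext y
    rw [fderiv_comp_complexPlane, fderiv_moll hk.isTestFun hu]
  have hs : tsupport (fun y => fderiv ℝ k (complexPlane z - y) (complexPlane v)) ⊆ Ω := by
    refine Subset.trans ?_ (hk.tsupport_comp_sub_left_subset (x := complexPlane z)
      (by rwa [complexPlane.norm_map]))
    have e : (fun y => fderiv ℝ k (complexPlane z - y) (complexPlane v))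
        = fun y => - fderiv ℝ (fun y => k (complexPlane z - y)) y (complexPlane v) := by
      funext y
      rw [fderiv_comp_sub_left hk.isTestFun, neg_neg]
    rw [e]
    refine closure_minimal (fun y hy => ?_) (isClosed_tsupport _)
    refine support_fderiv_subset ℝ (f := fun y => k (complexPlane z - y)) fun h0 => hy ?_
    simp [h0]
  rw [← h1, h2, fderiv_comp_complexPlane,
    fderiv_moll_of_weak hΩ hk' hu (fun ψ hψ hψs => hw ψ hψ hψs _) hs, moll_apply,
    integral_indicator_mul hΩ, ← integral_neg]
  refine integral_congr_ae (ae_of_all _ fun y => ?_)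
  simp only [fderiv_comp_sub_left hk.isTestFun, mul_neg, neg_neg]

/-- The mollification of a function that is weakly harmonic for `R < ‖x‖`, by a kernel supported in
a ball of radius `δ`, is harmonic for `R + δ < ‖z‖`. -/
theorem harmonicAt_moll
    (hu : LocallyIntegrable ({x : Plane | R < ‖x‖}.indicator u) volume)
    (hG : MemLp G 2 (volume.restrict {x : Plane | R < ‖x‖}))
    (hw : ∀ ψ : Plane → ℝ, IsTestFun ψ → tsupport ψ ⊆ {x : Plane | R < ‖x‖} → ∀ w,
      ∫ x in {x : Plane | R < ‖x‖}, u x * fderiv ℝ ψ x w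
        = - ∫ x in {x : Plane | R < ‖x‖}, ψ x * inner ℝ (G x) w)
    (hharm : ∀ ψ : Plane → ℝ, IsTestFun ψ → tsupport ψ ⊆ {x : Plane | R < ‖x‖} →
      ∫ x in {x : Plane | R < ‖x‖}, inner ℝ (G x) (gradient ψ x) = 0)
    (hk : IsMollifier k δ) {z : ℂ} (hz : R + δ < ‖z‖) :
    InnerProductSpace.HarmonicAt
      (fun z => moll k ({x : Plane | R < ‖x‖}.indicator u) (complexPlane z)) z := by
  have hsm : ContDiff ℝ ∞ fun z => moll k ({x : Plane | R < ‖x‖}.indicator u) (complexPlane z) :=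
    (contDiff_moll hk.isTestFun hu).comp complexPlane.contDiff
  refine ⟨(contDiff_infty.1 hsm 2).contDiffAt, ?_⟩
  have hopen : IsOpen {z : ℂ | R + δ < ‖z‖} := isOpen_lt continuous_const continuous_norm
  filter_upwards [hopen.mem_nhds hz] with y hy
  have hψ := hk.isTestFun.comp_sub_left (complexPlane y)
  have hint : ∀ v : Plane, Integrable (fun x => inner ℝ (G x) v
      * fderiv ℝ (fun y' => k (complexPlane y - y')) x v)
      (volume.restrict {x : Plane | R < ‖x‖}) := fun v =>
    (hG.inner_const v).integrable_mul (hψ.memLp_fderiv v _)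
  rw [InnerProductSpace.laplacian_eq_iteratedFDeriv_complexPlane]
  simp only [iteratedFDeriv_two_apply, Matrix.cons_val_zero, Matrix.cons_val_one]
  rw [fderiv_fderiv_moll_comp_complexPlane hu hw hk hy,
    fderiv_fderiv_moll_comp_complexPlane hu hw hk hy, ← neg_add,
    ← integral_add (hint _) (hint _)]
  have h0 := hharm _ hψ (hk.tsupport_comp_sub_left_subset (x := complexPlane y)
      (by rwa [complexPlane.norm_map]))
  rw [Pi.zero_apply, neg_eq_zero, ← h0]
  refine integral_congr_ae (ae_of_all _ fun x => ?_)
  have hin := fun w => inner_gradient (fun y' => k (complexPlane y - y')) x w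
  simp only [inner_complexPlane_one, inner_complexPlane_I, ← hin]
  rw [PiLp.inner_apply, Fin.sum_univ_two]
  simp [mul_comm]

/-- Mollification does not increase the energy, written here with `∂₁ - i∂₂` for the gradient. -/
theorem lintegral_fderiv_moll_le
    (hu : LocallyIntegrable ({x : Plane | R < ‖x‖}.indicator u) volume)
    (hG : MemLp G 2 (volume.restrict {x : Plane | R < ‖x‖}))
    (hw : ∀ ψ : Plane → ℝ, IsTestFun ψ → tsupport ψ ⊆ {x : Plane | R < ‖x‖} → ∀ w,
      ∫ x in {x : Plane | R < ‖x‖}, u x * fderiv ℝ ψ x w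
        = - ∫ x in {x : Plane | R < ‖x‖}, ψ x * inner ℝ (G x) w)
    (hk : IsMollifier k δ) :
    ∫⁻ z in {z : ℂ | R + δ < ‖z‖},
      ‖(fderiv ℝ (fun z => moll k ({x : Plane | R < ‖x‖}.indicator u) (complexPlane z)) z 1 : ℂ)
        - Complex.I * fderiv ℝ (fun z => moll k ({x : Plane | R < ‖x‖}.indicator u)
          (complexPlane z)) z Complex.I‖ₑ ^ 2
      ≤ ∫⁻ x in {x : Plane | R < ‖x‖}, ‖G x‖ₑ ^ 2 := by
  set Ω := {x : Plane | R < ‖x‖}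
  have hΩ : MeasurableSet Ω := (isOpen_norm_gt R).measurableSet
  set g : ℂ → Plane → ℝ := fun v => Ω.indicator fun x => inner ℝ (G x) (complexPlane v)
  have hgm : ∀ v, AEMeasurable (g v) volume := fun v =>
    (aemeasurable_indicator_iff hΩ).2 (hG.inner_const (complexPlane v)).1.aemeasurable
  have hd : ∀ z : ℂ, R + δ < ‖z‖ → ∀ v,
      fderiv ℝ (fun z => moll k (Ω.indicator u) (complexPlane z)) z v
        = moll k (g v) (complexPlane z) := by
    intro z hz v
    rw [fderiv_comp_complexPlane]
    exact fderiv_moll_of_weak hΩ hk.isTestFun hu (fun ψ hψ hψs => hw ψ hψ hψs _)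
      (hk.tsupport_comp_sub_left_subset (by rwa [complexPlane.norm_map]))
  have hmeas : MeasurableSet {z : ℂ | R + δ < ‖z‖} :=
    measurableSet_lt measurable_const measurable_norm
  have hae : ∀ v, Measurable fun x => ‖moll k (g v) x‖ₑ ^ 2 := fun v =>
    measurable_enorm_moll_sq hk.isTestFun ((memLp_indicator_iff_restrict hΩ).2
      (hG.inner_const (complexPlane v)))
  calc _ = ∫⁻ z in {z : ℂ | R + δ < ‖z‖}, (‖moll k (g 1) (complexPlane z)‖ₑ ^ 2
        + ‖moll k (g Complex.I) (complexPlane z)‖ₑ ^ 2) := by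
        refine setLIntegral_congr_fun hmeas fun z hz => ?_
        simp only [hd z hz, enorm_ofReal_sub_I_mul_sq]
    _ ≤ (∫⁻ x, ‖moll k (g 1) x‖ₑ ^ 2) + ∫⁻ x, ‖moll k (g Complex.I) x‖ₑ ^ 2 :=
        setLIntegral_complexPlane_le (hae 1) (hae Complex.I) _
    _ ≤ (∫⁻ x, ‖g 1 x‖ₑ ^ 2) + ∫⁻ x, ‖g Complex.I x‖ₑ ^ 2 :=
        add_le_add (hk.lintegral_moll_sq_le (hgm _)) (hk.lintegral_moll_sq_le (hgm _))
    _ = ∫⁻ x, Ω.indicator (fun x => ‖G x‖ₑ ^ 2) x := by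
        rw [← lintegral_add_left' ((hgm 1).enorm.pow_const 2)]
        refine lintegral_congr fun x => ?_
        by_cases hx : x ∈ Ω
        · simp only [g, indicator_of_mem hx, inner_complexPlane_one, inner_complexPlane_I,
            enorm_sq_eq_coords]
        · simp [g, hx]
    _ = _ := lintegral_indicator hΩ _

end Mollification

/-- Mollifiers that approximate every locally integrable function almost everywhere. -/
theorem exists_isMollifier_tendsto_ae : ∃ k : ℕ → Plane → ℝ, (∀ n, IsMollifier (k n) 1) ∧
    ∀ f : Plane → ℝ, LocallyIntegrable f volume →
      ∀ᵐ x, Tendsto (fun n => moll (k n) f x) atTop (𝓝 (f x)) := by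
  let b : ℕ → ContDiffBump (0 : Plane) := fun n =>
    ⟨1 / ((n : ℝ) + 2), 2 / ((n : ℝ) + 2), by positivity, by
      have : (0 : ℝ) < (n : ℝ) + 2 := by positivity
      gcongr; norm_num⟩
  have hb1 : ∀ n, (b n).rOut ≤ 1 := fun n => by
    change 2 / ((n : ℝ) + 2) ≤ 1
    rw [div_le_one (by positivity)]
    linarith [Nat.cast_nonneg (α := ℝ) n]
  refine ⟨fun n => (b n).normed volume, fun n => ⟨⟨(b n).contDiff_normed,
    (b n).hasCompactSupport_normed⟩, (b n).nonneg_normed, (b n).integral_normed,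
    fun z hz => ?_⟩, fun f hf => ?_⟩
  · have : z ∈ Function.support ((b n).normed volume) := hz
    rw [(b n).support_normed_eq, mem_ball_zero_iff] at this
    exact this.trans_le (hb1 n)
  · have hlim : Tendsto (fun n => (b n).rOut) atTop (𝓝 0) := by
      change Tendsto (fun n : ℕ => 2 / ((n : ℝ) + 2)) atTop (𝓝 0)
      exact tendsto_const_nhds.div_atTop
        (tendsto_atTop_add_const_right _ _ tendsto_natCast_atTop_atTop)
    have h := ContDiffBump.ae_convolution_tendsto_right_of_locallyIntegrable (μ := volume)
      (K := 2) hlim (Eventually.of_forall fun n => by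
        change 2 / ((n : ℝ) + 2) ≤ 2 * (1 / ((n : ℝ) + 2))
        rw [mul_one_div]) hf
    filter_upwards [h] with x hx
    refine hx.congr fun n => ?_
    rw [convolution_eq_swap, moll_apply]
    refine integral_congr_ae (ae_of_all _ fun y => ?_)
    simp [mul_comm]

/-- A function of finite energy that is weakly harmonic near infinity differs from a constant by
`O(|x|⁻¹)`. -/
theorem exists_abs_sub_le_mul_inv_norm {R : ℝ} (hR : 0 ≤ R) {u : Plane → ℝ} {G : Plane → Plane}
    (hu : LocallyIntegrable ({x : Plane | R < ‖x‖}.indicator u) volume)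
    (hG : MemLp G 2 (volume.restrict {x : Plane | R < ‖x‖}))
    (hw : ∀ ψ : Plane → ℝ, IsTestFun ψ → tsupport ψ ⊆ {x : Plane | R < ‖x‖} → ∀ w,
      ∫ x in {x : Plane | R < ‖x‖}, u x * fderiv ℝ ψ x w
        = - ∫ x in {x : Plane | R < ‖x‖}, ψ x * inner ℝ (G x) w)
    (hharm : ∀ ψ : Plane → ℝ, IsTestFun ψ → tsupport ψ ⊆ {x : Plane | R < ‖x‖} →
      ∫ x in {x : Plane | R < ‖x‖}, inner ℝ (G x) (gradient ψ x) = 0) :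
    ∃ A c : ℝ, ∀ᵐ x : Plane, 2 * (R + 1) < ‖x‖ → |u x - c| ≤ A * ‖x‖⁻¹ := by
  obtain ⟨k, hk, hlim⟩ := exists_isMollifier_tendsto_ae
  set u₀ := {x : Plane | R < ‖x‖}.indicator u with hu₀
  set I := ∫⁻ x in {x : Plane | R < ‖x‖}, ‖G x‖ₑ ^ 2 with hI
  have hIt : I ≠ ⊤ := (MemLp.lintegral_sq_lt_top hG).ne
  set M : ℝ≥0 := NNReal.sqrt I.toNNReal with hM
  have hMI : (M : ℝ≥0∞) ^ 2 = I := by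
    rw [← ENNReal.coe_pow, hM, NNReal.sq_sqrt, ENNReal.coe_toNNReal hIt]
  set A : ℝ := 4 * M * (R + 1) with hA
  have hA0 : 0 ≤ A := by positivity
  have hbound : ∀ n, ∀ x y : Plane, 2 * (R + 1) < ‖x‖ → 2 * (R + 1) < ‖y‖ →
      |moll (k n) u₀ x - moll (k n) u₀ y| ≤ A * (3 * ‖x‖⁻¹ + ‖y‖⁻¹) := by
    intro n x y hx hy
    have hn : ∀ x : Plane, ‖complexPlane.symm x‖ = ‖x‖ := fun x => complexPlane.symm.norm_map x
    have h := abs_sub_le_of_harmonicAt (h := fun z => moll (k n) u₀ (complexPlane z))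
      (R := R + 1) (M := M) (by positivity) (fun z hz => harmonicAt_moll hu hG hw hharm (hk n) hz)
      ((lintegral_fderiv_moll_le hu hG hw (hk n)).trans_eq hMI.symm)
      (z := complexPlane.symm x) (w := complexPlane.symm y) (by rwa [hn]) (by rwa [hn])
    simpa only [LinearIsometryEquiv.apply_symm_apply, hn] using h
  set S : Set Plane := {x | Tendsto (fun n => moll (k n) u₀ x) atTop (𝓝 (u₀ x))} with hS
  have hSae : ∀ᵐ x, x ∈ S := hlim u₀ hu
  have hlimit : ∀ x ∈ S, ∀ y ∈ S, 2 * (R + 1) < ‖x‖ → 2 * (R + 1) < ‖y‖ →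
      |u x - u y| ≤ A * (3 * ‖x‖⁻¹ + ‖y‖⁻¹) := by
    intro x hx y hy hxR hyR
    have e : ∀ z : Plane, 2 * (R + 1) < ‖z‖ → u₀ z = u z := fun z hz => by
      have hzR : z ∈ {x : Plane | R < ‖x‖} := lt_of_le_of_lt (by linarith) hz
      exact indicator_of_mem hzR u
    have h := le_of_tendsto ((Tendsto.sub hx hy).abs)
      (Eventually.of_forall fun n => hbound n x y hxR hyR)
    rwa [e x hxR, e y hyR] at h
  -- points of `S` that tend to infinity
  have hex : ∀ n : ℕ, ∃ y ∈ S, 2 * (R + 1) + n + 1 < ‖y‖ := by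
    intro n
    have hd : Dense S := Measure.dense_of_ae hSae
    obtain ⟨y, hy⟩ := NormedSpace.exists_lt_norm ℝ Plane (2 * (R + 1) + n + 1)
    obtain ⟨z, hz, hzS⟩ := hd.exists_mem_open
      (isOpen_norm_gt (2 * (R + 1) + n + 1)) ⟨y, hy⟩
    exact ⟨z, hz, hzS⟩
  choose y hyS hyn using hex
  have hinv : ∀ N n : ℕ, N ≤ n → ‖y n‖⁻¹ ≤ ((N : ℝ) + 1)⁻¹ := by
    intro N n h
    have h1 := hyn n
    have h2 : (N : ℝ) ≤ n := Nat.cast_le.2 h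
    gcongr
    linarith
  have hyR : ∀ n, 2 * (R + 1) < ‖y n‖ := fun n => by
    have h1 := hyn n
    have h2 : (0 : ℝ) ≤ n := Nat.cast_nonneg n
    linarith
  have hinv0 : Tendsto (fun N : ℕ => ((N : ℝ) + 1)⁻¹) atTop (𝓝 0) := by
    simpa only [one_div] using tendsto_one_div_add_atTop_nhds_zero_nat (𝕜 := ℝ)
  have hcau : CauchySeq fun n => u (y n) := by
    refine cauchySeq_of_le_tendsto_0 (fun N : ℕ => A * (3 * ((N : ℝ) + 1)⁻¹ + ((N : ℝ) + 1)⁻¹))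
      (fun n m N hn hm => ?_) ?_
    · rw [Real.dist_eq]
      refine (hlimit _ (hyS n) _ (hyS m) (hyR n) (hyR m)).trans ?_
      have := hinv N n hn
      have := hinv N m hm
      gcongr
    · simpa using ((hinv0.const_mul 3).add hinv0).const_mul A
  obtain ⟨c, hc⟩ := cauchySeq_tendsto_of_complete hcau
  refine ⟨A * 3, c, ?_⟩
  filter_upwards [hSae] with x hx hxR
  have hy0 : Tendsto (fun n => ‖y n‖⁻¹) atTop (𝓝 0) :=
    squeeze_zero (fun n => by positivity) (fun n => hinv n n le_rfl) hinv0
  have h := le_of_tendsto_of_tendsto' ((hc.const_sub (u x)).abs)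
    ((hy0.const_add (3 * ‖x‖⁻¹)).const_mul A) fun n => hlimit x hx _ (hyS n) hxR (hyR n)
  linarith

theorem setIntegral_eq_setIntegral_of_support {A B : Set Plane} {f : Plane → ℝ}
    (hA : ∀ x ∉ A, f x = 0) (hB : ∀ x ∉ B, f x = 0) : ∫ x in A, f x = ∫ x in B, f x := by
  rw [setIntegral_eq_integral_of_forall_compl_eq_zero hA,
    setIntegral_eq_integral_of_forall_compl_eq_zero hB]

theorem gradient_eq_zero_of_notMem_tsupport {ψ : Plane → ℝ} {x : Plane} (hx : x ∉ tsupport ψ) :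
    gradient ψ x = 0 := by
  have h : fderiv ℝ ψ x = 0 := by
    by_contra h
    exact hx (support_fderiv_subset ℝ h)
  simp [gradient, h]

theorem Submodule.prodMk_sub_smul_mem {E F : Type*} [AddCommGroup E] [AddCommGroup F] [Module ℝ E]
    [Module ℝ F] (S : Submodule ℝ (E × F)) (a : ℝ) {U V : E} {f g : F} (h : (U, f) ∈ S)
    (h' : (V, g) ∈ S) : (U - a • V, f - a • g) ∈ S :=
  S.sub_mem h (S.smul_mem a h')

theorem Lp.sub_smul_ae_eq {α : Type*} [MeasurableSpace α] {μ : Measure α} {f g : Lp ℝ 2 μ}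
    (hg : g =ᵐ[μ] fun _ => (1 : ℝ)) (c : ℝ) : (f - c • g : Lp ℝ 2 μ) =ᵐ[μ] fun x => f x - c := by
  filter_upwards [Lp.coeFn_sub f (c • g), Lp.coeFn_smul c g, hg] with x h1 h2 h3
  rw [h1, Pi.sub_apply, h2, Pi.smul_apply, h3, smul_eq_mul, mul_one]

theorem average_sub_const {α : Type*} [MeasurableSpace α] {μ : Measure α} [IsFiniteMeasure μ]
    [NeZero μ] {f : α → ℝ} (hf : Integrable f μ) (c : ℝ) :
    ⨍ x, (f x - c) ∂μ = (⨍ x, f x ∂μ) - c := by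
  have h := average_const μ c
  rw [average_eq] at h ⊢
  rw [integral_sub hf (integrable_const c), smul_sub, h, average_eq]

/-- Removing a constant and redefining on a null set turns an essential bound near infinity into a
bound that holds everywhere. -/
theorem exists_isBigO_of_ae {u : Plane → ℝ} {A c R : ℝ}
    (h : ∀ᵐ x : Plane, R < ‖x‖ → |u x - c| ≤ A * ‖x‖⁻¹) :
    ∃ v : Plane → ℝ, (∀ᵐ x, v x = u x - c) ∧ v =O[cobounded Plane] fun x => ‖x‖⁻¹ := by
  classical
  refine ⟨fun x => if R < ‖x‖ → |u x - c| ≤ A * ‖x‖⁻¹ then u x - c else 0, ?_, ?_⟩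
  · filter_upwards [h] with x hx
    exact if_pos hx
  · refine Asymptotics.IsBigO.of_bound |A| ?_
    filter_upwards [tendsto_norm_cobounded_atTop.eventually_gt_atTop R] with x hx
    rw [norm_inv, norm_norm]
    split_ifs with h1
    · exact (h1 hx).trans (by gcongr; exact le_abs_self A)
    · rw [norm_zero]
      positivity

namespace IsHolderDomain

variable {η : ℝ≥0} {D : Set Plane}

theorem mem_traceGraph_extOne (hD : IsHolderDomain η D) {R : ℝ}
    (hR : closure D ⊆ Metric.ball 0 R) :
    (extOne D R, hD.trace hD.one) ∈ traceGraph (extBall D R) (frontier D) := by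
  refine subset_closure ⟨cutoff R, isTestFun_cutoff R, ?_, ?_⟩
  · exact fnOf_ofC1 (extBall D R) (isTestFun_cutoff R).isC1Fun
  · have h : ∀ᵐ x ∂(arcLength (frontier D)), x ∈ frontier D :=
      ae_restrict_mem isClosed_frontier.measurableSet
    filter_upwards [hD.trace_one, h] with x hx hxD
    exact hx.trans
      (cutoff_eq_one (mem_ball_zero_iff.1 (hR (frontier_subset_closure hxD))).le).symm

/-- The data of a function of finite energy on the exterior satisfy the hypotheses of the
estimate at infinity. -/
theorem exists_decay (hD : IsHolderDomain η D) {u : Plane → ℝ}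
    {G : Lp Plane 2 (volume.restrict (closure D)ᶜ)}
    (hU : ∀ R : ℝ, closure D ⊆ Metric.ball 0 R → ∃ U : H1 (extBall D R),
      fnOf U =ᵐ[volume.restrict (extBall D R)] u ∧ gradOf U =ᵐ[volume.restrict (extBall D R)] G)
    (hG : ∀ φ, IsTestFun φ → (∀ x ∈ D, φ x = 0) →
      ∫ x in (closure D)ᶜ, inner ℝ (G x) (gradient φ x) = 0) :
    ∃ A c R : ℝ, ∀ᵐ x : Plane, R < ‖x‖ → |u x - c| ≤ A * ‖x‖⁻¹ := by
  obtain ⟨R, hR⟩ := hD.isBounded.closure.subset_ball (0 : Plane)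
  have hR0 : 0 ≤ R := by
    obtain ⟨x, hx⟩ := hD.isConnected.nonempty
    exact (norm_nonneg x).trans (mem_ball_zero_iff.1 (hR (subset_closure hx))).le
  set Ω := {x : Plane | R < ‖x‖} with hΩdef
  have hΩ : MeasurableSet Ω := (isOpen_norm_gt R).measurableSet
  have hΩD : Ω ⊆ (closure D)ᶜ := fun x hx hxD =>
    lt_asymm (mem_ball_zero_iff.1 (hR hxD)) hx
  have hball : ∀ S, R ≤ S → closure D ⊆ Metric.ball 0 S := fun S hS =>
    hR.trans (Metric.ball_subset_ball hS)
  have hsub : ∀ S, Metric.ball 0 S ∩ Ω ⊆ extBall D S := fun S x hx => ⟨hx.1, hΩD hx.2⟩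
  suffices h : ∃ A c : ℝ, ∀ᵐ x : Plane, 2 * (R + 1) < ‖x‖ → |u x - c| ≤ A * ‖x‖⁻¹ by
    obtain ⟨A, c, h⟩ := h
    exact ⟨A, c, _, h⟩
  have hzero : ∀ {ψ : Plane → ℝ}, tsupport ψ ⊆ Ω → ∀ x ∉ Ω, x ∉ tsupport ψ :=
    fun h x hx hx' => hx (h hx')
  refine exists_abs_sub_le_mul_inv_norm hR0 (G := G) ?_ ?_ ?_ ?_
  · intro x
    set S := max R (‖x‖ + 1) with hS
    obtain ⟨U, hUu, -⟩ := hU S (hball S (le_max_left _ _))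
    have hx : x ∈ Metric.ball (0 : Plane) S := by
      rw [mem_ball_zero_iff]
      exact (lt_add_one _).trans_le (le_max_right _ _)
    refine ⟨Metric.ball 0 S, Metric.isOpen_ball.mem_nhds hx, ?_⟩
    have hfin : IsFiniteMeasure (volume.restrict (extBall D S)) :=
      ⟨by
        rw [Measure.restrict_apply_univ]
        exact (measure_mono sdiff_subset).trans_lt measure_ball_lt_top⟩
    have h1 : IntegrableOn u (extBall D S) :=
      ((Lp.memLp (fnOf U)).integrable one_le_two).congr hUu
    rw [IntegrableOn, integrable_indicator_iff hΩ, IntegrableOn, Measure.restrict_restrict hΩ]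
    exact h1.mono_set (by rw [inter_comm]; exact hsub S)
  · exact (Lp.memLp G).mono_measure (Measure.restrict_mono hΩD le_rfl)
  · intro ψ hψ hψs w
    obtain ⟨S₀, hS₀⟩ := hψ.2.isBounded.subset_ball (0 : Plane)
    set S := max R S₀ with hS
    obtain ⟨U, hUu, hUG⟩ := hU S (hball S (le_max_left _ _))
    have hψS : tsupport ψ ⊆ extBall D S := fun x hx =>
      hsub S ⟨Metric.ball_subset_ball (le_max_right _ _) (hS₀ hx), hψs hx⟩
    have h := U.2 ψ hψ hψS w
    have h1 : ∫ x in Ω, u x * fderiv ℝ ψ x w = ∫ x in extBall D S, u x * fderiv ℝ ψ x w := by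
      have h0 : ∀ x, x ∉ tsupport ψ → u x * fderiv ℝ ψ x w = 0 := fun x hx => by
        rw [← inner_gradient, gradient_eq_zero_of_notMem_tsupport hx, inner_zero_left, mul_zero]
      exact setIntegral_eq_setIntegral_of_support (fun x hx => h0 x fun h => hx (hψs h))
        fun x hx => h0 x fun h => hx (hψS h)
    have h2 : ∫ x in Ω, ψ x * inner ℝ (G x) w = ∫ x in extBall D S, ψ x * inner ℝ (G x) w := by
      have h0 : ∀ x, x ∉ tsupport ψ → ψ x * inner ℝ (G x) w = 0 := fun x hx => by
        rw [image_eq_zero_of_notMem_tsupport hx, zero_mul]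
      exact setIntegral_eq_setIntegral_of_support (fun x hx => h0 x fun h => hx (hψs h))
        fun x hx => h0 x fun h => hx (hψS h)
    rw [h1, h2]
    refine Eq.trans (integral_congr_ae ?_) (h.trans (congrArg Neg.neg (integral_congr_ae ?_)))
    · filter_upwards [hUu] with x hx
      rw [← hx]
      rfl
    · filter_upwards [hUG] with x hx
      rw [← hx]
      rfl
  · intro ψ hψ hψs
    rw [← hG ψ hψ fun x hx => image_eq_zero_of_notMem_tsupport fun h =>
      hΩD (hψs h) (subset_closure hx)]
    have h0 : ∀ x, x ∉ tsupport ψ → inner ℝ (G x) (gradient ψ x) = 0 := fun x hx => by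
      rw [gradient_eq_zero_of_notMem_tsupport hx, inner_zero_right]
    exact setIntegral_eq_setIntegral_of_support (fun x hx => h0 x fun h => hx (hψs h))
        fun x hx => h0 x fun h => hx (hΩD (hψs h))

set_option maxHeartbeats 1000000 in
/-- Subtracting a constant from a function in a bounded part of the exterior. -/
theorem exists_sub_const (hD : IsHolderDomain η D) {R c : ℝ} (hR : closure D ⊆ Metric.ball 0 R)
    {u v : Plane → ℝ} (hvu : ∀ᵐ x, v x = u x - c) {G : Plane → Plane} {U : H1 (extBall D R)}
    {f : Lp ℝ 2 (arcLength (frontier D))} (hUu : fnOf U =ᵐ[volume.restrict (extBall D R)] u)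
    (hUG : gradOf U =ᵐ[volume.restrict (extBall D R)] G)
    (hUt : (U, f) ∈ traceGraph (extBall D R) (frontier D)) :
    ∃ W : H1 (extBall D R), fnOf W =ᵐ[volume.restrict (extBall D R)] v ∧
      gradOf W =ᵐ[volume.restrict (extBall D R)] G ∧
      (W, f - c • hD.trace hD.one) ∈ traceGraph (extBall D R) (frontier D) := by
  have h1 : fnOf (U - c • extOne D R) =ᵐ[volume.restrict (extBall D R)] fun x => fnOf U x - c :=
    Lp.sub_smul_ae_eq (fnOf_extOne D R) c
  have h2 : gradOf (U - c • extOne D R) = gradOf U - c • gradOf (extOne D R) := rfl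
  rw [gradOf_extOne, smul_zero, sub_zero] at h2
  have h3 := Submodule.prodMk_sub_smul_mem _ c hUt (hD.mem_traceGraph_extOne hR)
  refine ⟨_, ?_, h2 ▸ hUG, h3⟩
  filter_upwards [h1, hUu, ae_restrict_of_ae hvu] with x h1 h2 h3
  rw [h1, h2, h3]

set_option maxHeartbeats 1000000 in
/-- Existence for the exterior problem: the solution of finite energy, less its limit at infinity.
The function `V` lifts the centered trace of `u` to `D`, where it has a norm in `H^{1/2}(∂D)`; its
pairing with the datum is minus the energy, so nonpositive. -/
theorem exists_isExteriorSolution (hD : IsHolderDomain η D) (hext : IsConnected (closure D)ᶜ) :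
    ∃ C : ℝ, 0 ≤ C ∧ ∀ g : HNegHalf0 D,
      ∃ (u : Plane → ℝ) (G : Plane → Plane) (f f₀ : Lp ℝ 2 (arcLength (frontier D))) (V : H1 D),
        IsExteriorSolution D g u G f ∧
        f₀ =ᵐ[arcLength (frontier D)] (fun x => f x - ⨍ y, f y ∂(arcLength (frontier D))) ∧
        (V, f₀) ∈ traceGraph D (frontier D) ∧ hD.mean (boundaryValue V) = 0 ∧
        ‖boundaryValue V‖ ≤ C * ‖g‖ ∧ (g : StrongDual ℝ (HHalf D)) (boundaryValue V) ≤ 0 := by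
  obtain ⟨C, hC0, hC⟩ := hD.exists_finite_energy_solution hext
  refine ⟨C, hC0, fun g => ?_⟩
  obtain ⟨u, G, q, hmean, hq, hen, hU, hweak⟩ := hC g
  obtain ⟨A, c, R, hdec⟩ := hD.exists_decay (u := u) (G := G)
    (fun R hR => by
      obtain ⟨U, h1, h2, -⟩ := hU R hR
      exact ⟨U, h1, h2⟩)
    (fun φ hφ h0 => by
      have h : H1.ofC1 D hφ.isC1Fun = 0 := by
        refine (H1.eq_ofC1 hD.isOpen hφ.isC1Fun ?_).symm
        have h1 : fnOf (0 : H1 D) =ᵐ[volume.restrict D] (0 : Plane → ℝ) := Lp.coeFn_zero _ _ _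
        filter_upwards [h1, ae_restrict_mem hD.isOpen.measurableSet] with x hx hxD
        exact hx.trans (h0 x hxD).symm
      rw [hweak φ hφ, h, map_zero, map_zero, neg_zero])
  obtain ⟨v, hvu, hvO⟩ := exists_isBigO_of_ae hdec
  obtain ⟨V, rfl, -⟩ := exists_boundaryValue_eq q one_pos
  have hfin := hD.arcLength_finite
  have hne : NeZero (arcLength (frontier D)) := ⟨fun h => by
    have := hD.arcLength_pos
    simp [h] at this⟩
  have hsub := Lp.sub_smul_ae_eq (f := hD.trace V) hD.trace_one c
  have havg : ⨍ y, (hD.trace V - c • hD.trace hD.one : Lp ℝ 2 (arcLength (frontier D))) y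
      ∂(arcLength (frontier D)) = - c := by
    rw [average_congr hsub, average_sub_const ((Lp.memLp _).integrable one_le_two),
      ← hD.mean_boundaryValue, hmean, zero_sub]
  refine ⟨v, G, hD.trace V - c • hD.trace hD.one, hD.trace V, V, ⟨fun R hR => ?_, ?_, hvO⟩, ?_,
    hD.mem_traceGraph V, hmean, hq, ?_⟩
  · obtain ⟨U, hUu, hUG, hUt⟩ := hU R hR
    rw [hD.traceQ_boundaryValue] at hUt
    exact hD.exists_sub_const hR hvu hUu hUG hUt
  · intro φ hφ W hW
    rw [H1.eq_ofC1 hD.isOpen hφ.isC1Fun hW]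
    exact hweak φ hφ
  · filter_upwards [hsub] with x hx
    rw [havg, hx, sub_neg_eq_add, sub_add_cancel]
  · rw [hen]
    exact neg_nonpos.2 (sq_nonneg _)

end IsHolderDomain

/-! ### Uniqueness for the exterior problem -/

theorem gradient_mul {χ φ : Plane → ℝ} {x : Plane} (hχ : DifferentiableAt ℝ χ x)
    (hφ : DifferentiableAt ℝ φ x) :
    gradient (fun x => χ x * φ x) x = χ x • gradient φ x + φ x • gradient χ x := by
  simp only [gradient, fderiv_fun_mul hχ hφ, map_add, map_smul]

theorem exists_gradSmul {χ : Plane → ℝ} (hχ : IsTestFun χ) (Ω : Set Plane) :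
    ∃ T : H1 Ω →L[ℝ] Lp Plane 2 (volume.restrict Ω), ∀ U, T U =ᵐ[volume.restrict Ω]
      fun x => χ x • gradOf U x + fnOf U x • gradient χ x := by
  let B : ℝ →L[ℝ] Plane →L[ℝ] Plane := ContinuousLinearMap.lsmul ℝ ℝ
  let a := (hχ.memLp_top (volume.restrict Ω)).toLp χ
  let b := (hχ.memLp_top_gradient (volume.restrict Ω)).toLp (gradient χ)
  refine ⟨(B.holderL (volume.restrict Ω) ⊤ 2 2 a).comp (gradOfL Ω)
    + (B.flip.holderL (volume.restrict Ω) ⊤ 2 2 b).comp (fnOfL Ω), fun U => ?_⟩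
  have h1 := B.coeFn_holder (r := 2) a (gradOf U)
  have h2 := B.flip.coeFn_holder (r := 2) b (fnOf U)
  filter_upwards [h1, h2, (hχ.memLp_top (volume.restrict Ω)).coeFn_toLp,
    (hχ.memLp_top_gradient (volume.restrict Ω)).coeFn_toLp,
    Lp.coeFn_add (B.holder 2 a (gradOf U)) (B.flip.holder 2 b (fnOf U))] with x h1 h2 h3 h4 h5
  refine h5.trans ?_
  rw [Pi.add_apply, h1, h2, h3, h4]
  rfl

/-- The map `U ↦ ∇(χU)`, for a test function `χ`. -/
def gradSmul {χ : Plane → ℝ} (hχ : IsTestFun χ) (Ω : Set Plane) :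
    H1 Ω →L[ℝ] Lp Plane 2 (volume.restrict Ω) := (exists_gradSmul hχ Ω).choose

theorem coeFn_gradSmul {χ : Plane → ℝ} (hχ : IsTestFun χ) {Ω : Set Plane} (U : H1 Ω) :
    gradSmul hχ Ω U =ᵐ[volume.restrict Ω]
      fun x => χ x • gradOf U x + fnOf U x • gradient χ x := (exists_gradSmul hχ Ω).choose_spec U

theorem gradSmul_eq_gradOf {χ φ : Plane → ℝ} (hχ : IsTestFun χ) (hφ : IsTestFun φ)
    {Ω : Set Plane} (hΩ : IsOpen Ω) {U : H1 Ω} (hU : fnOf U =ᵐ[volume.restrict Ω] φ) :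
    gradSmul hχ Ω U = gradOf (H1.ofC1 Ω (hχ.mul hφ).isC1Fun) := by
  refine Lp.ext ?_
  rw [H1.eq_ofC1 hΩ hφ.isC1Fun hU]
  filter_upwards [coeFn_gradSmul hχ (H1.ofC1 Ω hφ.isC1Fun), fnOf_ofC1 Ω hφ.isC1Fun,
    gradOf_ofC1 Ω hφ.isC1Fun, gradOf_ofC1 Ω (hχ.mul hφ).isC1Fun] with x h1 h2 h3 h4
  rw [h1, h2, h3, h4, gradient_mul ((hχ.1.differentiable (by simp)) x)
    ((hφ.1.differentiable (by simp)) x)]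

theorem extEnergy_eq_norm_gradOf {D : Set Plane} {φ : Plane → ℝ} (hφ : IsC1Fun φ) {R : ℝ}
    (hR : tsupport φ ⊆ Metric.ball 0 R) :
    extEnergy D hφ = ‖gradOf (H1.ofC1 (extBall D R) hφ)‖ := by
  have h : ‖gradOf (H1.ofC1 (closure D)ᶜ hφ)‖ₑ ^ 2 = ‖gradOf (H1.ofC1 (extBall D R) hφ)‖ₑ ^ 2 := by
    rw [enorm_gradOf_ofC1_sq, enorm_gradOf_ofC1_sq]
    have e : extBall D R = Metric.ball 0 R ∩ (closure D)ᶜ := rfl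
    rw [e, ← Measure.restrict_restrict Metric.isOpen_ball.measurableSet,
      ← lintegral_indicator Metric.isOpen_ball.measurableSet]
    refine lintegral_congr fun x => ?_
    by_cases hx : x ∈ Metric.ball (0 : Plane) R
    · rw [indicator_of_mem hx]
    · have h0 : fderiv ℝ φ x = 0 := by
        by_contra h0
        exact hx (hR (support_fderiv_subset ℝ h0))
      rw [indicator_of_notMem hx, h0, enorm_zero, zero_pow two_ne_zero]
  have h2 := congrArg ENNReal.toReal h
  rw [ENNReal.toReal_pow, ENNReal.toReal_pow, toReal_enorm, toReal_enorm] at h2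
  exact (pow_left_inj₀ (norm_nonneg _) (norm_nonneg _) two_ne_zero).1 h2

/-- The pointwise identity behind the energy estimate for `χu`. -/
theorem norm_smul_add_smul_sq (a b : ℝ) (v w : Plane) :
    ‖a • v + b • w‖ ^ 2 = inner ℝ v ((a * a) • v + b • ((2 * a) • w)) + b ^ 2 * ‖w‖ ^ 2 := by
  rw [norm_add_sq_real, norm_smul, norm_smul, mul_pow, mul_pow, inner_add_right,
    real_inner_smul_right, real_inner_smul_left, real_inner_smul_right, real_inner_smul_right,
    real_inner_smul_right, real_inner_self_eq_norm_sq, Real.norm_eq_abs, Real.norm_eq_abs, sq_abs,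
    sq_abs]
  ring

theorem norm_gradSmul_sq {χ : Plane → ℝ} (hχ : IsTestFun χ) {Ω : Set Plane} (U : H1 Ω) :
    ‖gradSmul hχ Ω U‖ ^ 2 = inner ℝ (gradOf U) (gradSmul (hχ.mul hχ) Ω U)
      + ∫ x in Ω, fnOf U x ^ 2 * ‖gradient χ x‖ ^ 2 := by
  have h1 := L2.integrable_inner (𝕜 := ℝ) (gradSmul hχ Ω U) (gradSmul hχ Ω U)
  have h2 := L2.integrable_inner (𝕜 := ℝ) (gradOf U) (gradSmul (hχ.mul hχ) Ω U)
  rw [← real_inner_self_eq_norm_sq, ← sub_eq_iff_eq_add', L2.inner_def, L2.inner_def,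
    ← integral_sub h1 h2]
  refine integral_congr_ae ?_
  filter_upwards [coeFn_gradSmul hχ U, coeFn_gradSmul (hχ.mul hχ) U] with x h3 h4
  have hd := (hχ.1.differentiable (by simp)) x
  rw [h3, h4, real_inner_self_eq_norm_sq, norm_smul_add_smul_sq, gradient_mul hd hd, ← add_smul,
    ← two_mul, add_sub_cancel_left]

/-- Cutoff functions at scale `n`. -/
theorem exists_scaled_cutoff : ∃ K B : ℝ, 0 < K ∧ 0 ≤ B ∧ ∀ n : ℕ, 0 < n → ∃ χ : Plane → ℝ,
    IsTestFun χ ∧ tsupport χ ⊆ Metric.ball 0 (K * n) ∧ (∀ x, ‖x‖ ≤ n → χ x = 1) ∧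
    ∀ x, ‖gradient χ x‖ ≤ B / n := by
  obtain ⟨K₀, hK₀⟩ := (show IsCompact (tsupport (cutoff 1)) from
    (isTestFun_cutoff 1).2).isBounded.subset_closedBall (0 : Plane)
  obtain ⟨B, hB⟩ := (isTestFun_cutoff 1).isC1Fun.hasCompactSupport_gradient.exists_bound_of_continuous
    (isTestFun_cutoff 1).isC1Fun.continuous_gradient
  refine ⟨|K₀| + 1, B, by positivity, (norm_nonneg _).trans (hB 0), fun n hn => ?_⟩
  have hn' : (0 : ℝ) < n := Nat.cast_pos.2 hn
  refine ⟨fun x => cutoff 1 ((n : ℝ)⁻¹ • x), ⟨(isTestFun_cutoff 1).1.comp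
    (contDiff_const_smul _), (isTestFun_cutoff 1).2.comp_homeomorph
      (Homeomorph.smulOfNeZero (n : ℝ)⁻¹ (inv_ne_zero hn'.ne'))⟩, ?_, fun x hx => ?_, fun x => ?_⟩
  · have h : tsupport (fun x => cutoff 1 ((n : ℝ)⁻¹ • x)) ⊆ Metric.closedBall 0 (|K₀| * n) := by
      refine closure_minimal (fun x hx => ?_) Metric.isClosed_closedBall
      have h1 := hK₀ (subset_tsupport _ hx)
      rw [mem_closedBall_zero_iff, norm_smul, norm_inv, Real.norm_of_nonneg hn'.le,
        inv_mul_le_iff₀ hn'] at h1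
      rw [mem_closedBall_zero_iff, mul_comm]
      exact h1.trans (mul_le_mul_of_nonneg_left (le_abs_self _) hn'.le)
    refine h.trans (Metric.closedBall_subset_ball ?_)
    linarith
  · refine cutoff_eq_one ?_
    rw [norm_smul, norm_inv, Real.norm_of_nonneg hn'.le, inv_mul_le_iff₀ hn', mul_one]
    exact hx
  · have h : gradient (fun x => cutoff 1 ((n : ℝ)⁻¹ • x)) x
        = (n : ℝ)⁻¹ • gradient (cutoff 1) ((n : ℝ)⁻¹ • x) := by
      have e := fderiv_comp_smul (𝕜 := ℝ) (f := cutoff 1) (x := x) (n : ℝ)⁻¹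
      simp only [gradient, e, map_smul]
    rw [h, norm_smul, norm_inv, Real.norm_of_nonneg hn'.le, inv_mul_eq_div]
    gcongr
    exact hB _

theorem ContinuousLinearMap.apply_sub_smul {E F : Type*} [NormedAddCommGroup E]
    [NormedAddCommGroup F] [NormedSpace ℝ E] [NormedSpace ℝ F] (T : E →L[ℝ] F) (x y : E) (a : ℝ) :
    T (x - a • y) = T x - a • T y := by
  rw [map_sub, map_smul]

namespace IsHolderDomain

variable {η : ℝ≥0} {D : Set Plane}

theorem traceQ_centered (hD : IsHolderDomain η D) {φ : Plane → ℝ} (hφ : IsC1Fun φ) :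
    hD.traceQ (hD.centered hφ) = hD.trace (H1.ofC1 D hφ)
      - (⨍ y, hD.trace (H1.ofC1 D hφ) y ∂(arcLength (frontier D))) • hD.trace hD.one := by
  rw [← hD.mean_boundaryValue, ← hD.traceQ_boundaryValue, ← hD.traceQ_boundaryValue]
  exact hD.traceQ.apply_sub_smul _ _ _

theorem exists_norm_traceQ_centered_le (hD : IsHolderDomain η D)
    (hext : IsConnected (closure D)ᶜ) : ∃ C : ℝ, 0 ≤ C ∧ ∀ φ (hφ : IsC1Fun φ),
      ‖hD.traceQ (hD.centered hφ)‖ ≤ C * extEnergy D hφ := by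
  obtain ⟨C, hC0, hC⟩ := hD.exists_exterior_poincare hext 0
  refine ⟨‖hD.traceQ‖ * C, by positivity, fun φ hφ => ?_⟩
  have h : ‖hD.centered hφ‖ ≤ C * extEnergy D hφ := (hC φ hφ).1
  rw [mul_assoc]
  exact (hD.traceQ.le_opNorm _).trans (mul_le_mul_of_nonneg_left h (norm_nonneg _))

/-- The trace, up to constants, is controlled by the energy of a compactly supported extension. -/
theorem exists_norm_sub_average_le (hD : IsHolderDomain η D) (hext : IsConnected (closure D)ᶜ) :
    ∃ C : ℝ, 0 ≤ C ∧ ∀ (R : ℝ) (χ : Plane → ℝ) (hχ : IsTestFun χ),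
      tsupport χ ⊆ Metric.ball 0 R → (∀ x ∈ frontier D, χ x = 1) →
      ∀ (U : H1 (extBall D R)) (f : Lp ℝ 2 (arcLength (frontier D))),
        (U, f) ∈ traceGraph (extBall D R) (frontier D) →
        ‖f - (⨍ y, f y ∂(arcLength (frontier D))) • hD.trace hD.one‖
          ≤ C * ‖gradSmul hχ (extBall D R) U‖ := by
  obtain ⟨C, hC0, hC⟩ := hD.exists_norm_traceQ_centered_le hext
  obtain ⟨A, hA⟩ := hD.exists_average
  refine ⟨C, hC0, fun R χ hχ hχR hχ1 => ?_⟩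
  set S : Set (H1 (extBall D R) × Lp ℝ 2 (arcLength (frontier D))) :=
    {p | ‖p.2 - A p.2 • hD.trace hD.one‖ ≤ C * ‖gradSmul hχ (extBall D R) p.1‖}
    with hS
  have hclosed : IsClosed S := by
    refine isClosed_le ?_ ?_
    · exact (continuous_snd.sub ((A.continuous.comp continuous_snd).smul continuous_const)).norm
    · exact continuous_const.mul ((gradSmul hχ (extBall D R)).continuous.comp continuous_fst).norm
  have hsub : (smoothTracePairs (extBall D R) (frontier D) : Set _) ⊆ S := by
    rintro ⟨U, f⟩ ⟨φ, hφ, hU, hf⟩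
    have hΓ : ∀ᵐ x ∂(arcLength (frontier D)), x ∈ frontier D :=
      ae_restrict_mem isClosed_frontier.measurableSet
    have h1 : hD.trace (H1.ofC1 D (hχ.mul hφ).isC1Fun) = f := by
      refine Lp.ext ?_
      filter_upwards [hD.trace_ofC1 (hχ.mul hφ).isC1Fun, hf, hΓ] with x h1 h2 h3
      rw [h1, h2, hχ1 x h3, one_mul]
    have h2 : hD.traceQ (hD.centered (hχ.mul hφ).isC1Fun) = f - A f • hD.trace hD.one := by
      rw [hD.traceQ_centered, h1, hA]
    have h3 : tsupport (fun x => χ x * φ x) ⊆ Metric.ball 0 R :=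
      (closure_mono (Function.support_mul_subset_left χ φ)).trans hχR
    have h4 : ‖gradSmul hχ (extBall D R) U‖ = extEnergy D (hχ.mul hφ).isC1Fun := by
      rw [gradSmul_eq_gradOf hχ hφ (isOpen_extBall D R) hU,
        extEnergy_eq_norm_gradOf (hχ.mul hφ).isC1Fun h3]
    change ‖f - A f • hD.trace hD.one‖ ≤ C * ‖gradSmul hχ (extBall D R) U‖
    rw [h4, ← h2]
    exact hC _ _
  intro U f h
  have h' := closure_minimal hsub hclosed h
  rw [← hA]
  exact h'

end IsHolderDomain

/-- The weak equation may be tested with the products of `H¹` functions and cutoff functions. -/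
theorem inner_gradOf_gradSmul_eq_zero {D Γ : Set Plane} {G : Plane → Plane}
    (hG : ∀ φ, IsTestFun φ → ∫ x in (closure D)ᶜ, inner ℝ (G x) (gradient φ x) = 0) {R : ℝ}
    {U : H1 (extBall D R)} (hU : gradOf U =ᵐ[volume.restrict (extBall D R)] G) {χ : Plane → ℝ}
    (hχ : IsTestFun χ) (hχR : tsupport χ ⊆ Metric.ball 0 R) {W : H1 (extBall D R)}
    {f : Lp ℝ 2 (arcLength Γ)} (hW : (W, f) ∈ traceGraph (extBall D R) Γ) :
    inner ℝ (gradOf U) (gradSmul hχ (extBall D R) W) = 0 := by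
  set S : Set (H1 (extBall D R) × Lp ℝ 2 (arcLength Γ)) :=
    {p | innerSL ℝ (gradOf U) (gradSmul hχ (extBall D R) p.1) = 0} with hS
  have hclosed : IsClosed S := by
    refine isClosed_eq ?_ continuous_const
    exact (innerSL ℝ (gradOf U)).continuous.comp
      ((gradSmul hχ (extBall D R)).continuous.comp continuous_fst)
  refine closure_minimal (t := S) ?_ hclosed hW
  rintro ⟨V, g⟩ ⟨φ, hφ, hV, -⟩
  change inner ℝ (gradOf U) (gradSmul hχ (extBall D R) V) = 0
  rw [gradSmul_eq_gradOf hχ hφ (isOpen_extBall D R) hV, L2.inner_def]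
  have h3 : tsupport (fun x => χ x * φ x) ⊆ Metric.ball 0 R :=
    (closure_mono (Function.support_mul_subset_left χ φ)).trans hχR
  have h4 : ∫ x in extBall D R, inner ℝ (gradOf U x) (gradOf (H1.ofC1 (extBall D R)
      (hχ.mul hφ).isC1Fun) x) = ∫ x in extBall D R,
        inner ℝ (G x) (gradient (fun x => χ x * φ x) x) := by
    refine integral_congr_ae ?_
    filter_upwards [hU, gradOf_ofC1 (extBall D R) (hχ.mul hφ).isC1Fun] with x h1 h2
    rw [h1, h2]
  rw [h4, ← hG _ (hχ.mul hφ)]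
  have e : extBall D R = (closure D)ᶜ ∩ Metric.ball 0 R := inter_comm _ _
  rw [e]
  refine (setIntegral_eq_of_subset_of_forall_sdiff_eq_zero (isOpen_exterior D).measurableSet
    inter_subset_left fun x hx => ?_).symm
  have hx' : x ∉ tsupport fun x => χ x * φ x := fun h => hx.2 ⟨hx.1, h3 h⟩
  rw [gradient_eq_zero_of_notMem_tsupport hx', inner_zero_right]

namespace IsHolderDomain

variable {η : ℝ≥0} {D : Set Plane}

/-- A solution of the homogeneous exterior problem has a constant trace. -/
theorem trace_eq_of_isExteriorSolution_zero (hD : IsHolderDomain η D)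
    (hext : IsConnected (closure D)ᶜ) {u : Plane → ℝ} {G : Plane → Plane}
    {f : Lp ℝ 2 (arcLength (frontier D))} (h : IsExteriorSolution D 0 u G f) :
    f = (⨍ y, f y ∂(arcLength (frontier D))) • hD.trace hD.one := by
  obtain ⟨C, hC0, hC⟩ := hD.exists_norm_sub_average_le hext
  obtain ⟨K, B, hK, hB, hχ⟩ := exists_scaled_cutoff
  obtain ⟨R₀, hR₀⟩ := hD.isBounded.closure.subset_ball (0 : Plane)
  have hG : ∀ φ, IsTestFun φ → ∫ x in (closure D)ᶜ, inner ℝ (G x) (gradient φ x) = 0 := by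
    intro φ hφ
    rw [h.weak φ hφ _ (fnOf_ofC1 D hφ.isC1Fun), zero_apply, neg_zero]
  obtain ⟨A, hA⟩ := h.decay.bound
  obtain ⟨R₁, hR₁⟩ := (hasBasis_cobounded_norm.eventually_iff).1 hA
  have hA' : ∀ x : Plane, R₁ ≤ ‖x‖ → |u x| ≤ A * ‖x‖⁻¹ := fun x hx => by
    have := hR₁.2 (show x ∈ {x : Plane | R₁ ≤ ‖x‖} from hx)
    rwa [norm_inv, norm_norm] at this
  have hbound : ∀ᶠ n : ℕ in atTop,
      ‖f - (⨍ y, f y ∂(arcLength (frontier D))) • hD.trace hD.one‖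
        ≤ C * (|A| * B * K * √Real.pi / n) := by
    filter_upwards [eventually_gt_atTop 0, eventually_ge_atTop ⌈R₀⌉₊, eventually_ge_atTop ⌈R₁⌉₊,
      eventually_ge_atTop ⌈R₀ / K⌉₊] with n hn hn0 hn1 hn2
    have hn' : (0 : ℝ) < n := Nat.cast_pos.2 hn
    have hR₀n : R₀ ≤ n := Nat.ceil_le.1 hn0
    have hR₁n : R₁ ≤ n := Nat.ceil_le.1 hn1
    have hR₀K : R₀ ≤ K * n := by
      rw [mul_comm]
      exact (div_le_iff₀ hK).1 (Nat.ceil_le.1 hn2)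
    obtain ⟨χ, hχt, hχs, hχ1, hχg⟩ := hχ n hn
    obtain ⟨U, hUu, hUG, hUf⟩ : ∃ U : H1 (extBall D (K * n)),
        fnOf U =ᵐ[volume.restrict (extBall D (K * n))] u ∧
        gradOf U =ᵐ[volume.restrict (extBall D (K * n))] G ∧
        (U, f) ∈ traceGraph (extBall D (K * n)) (frontier D) :=
      h.locallyH1 (K * n) (hR₀.trans (Metric.ball_subset_ball hR₀K))
    have hχΓ : ∀ x ∈ frontier D, χ x = 1 := fun x hx =>
      hχ1 x ((mem_ball_zero_iff.1 (hR₀ (frontier_subset_closure hx))).le.trans hR₀n)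
    refine (hC _ χ hχt hχs hχΓ U f hUf).trans (mul_le_mul_of_nonneg_left ?_ hC0)
    have hχ2 : tsupport (fun x => χ x * χ x) ⊆ Metric.ball 0 (K * n) :=
      (closure_mono (Function.support_mul_subset_left χ χ)).trans hχs
    have hsq := norm_gradSmul_sq hχt U
    -- testing the equation with `χ²u` leaves only `∫ u²|∇χ|²` in the energy of `χu`
    have hzero := inner_gradOf_gradSmul_eq_zero hG hUG (hχt.mul hχt) hχ2 hUf
    have hint : ∫ x in extBall D (K * n), fnOf U x ^ 2 * ‖gradient χ x‖ ^ 2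
        ≤ (|A| * B / n ^ 2) ^ 2 * ((K * n) ^ 2 * Real.pi) := by
      have e : ∫ x in extBall D (K * n), fnOf U x ^ 2 * ‖gradient χ x‖ ^ 2
          = ∫ x in extBall D (K * n), u x ^ 2 * ‖gradient χ x‖ ^ 2 := by
        refine integral_congr_ae ?_
        filter_upwards [hUu] with x hx
        rw [hx]
      have hle : volume (extBall D (K * n)) ≤ volume (Metric.ball (0 : Plane) (K * n)) :=
        measure_mono sdiff_subset
      have hpt : ∀ x, ‖u x ^ 2 * ‖gradient χ x‖ ^ 2‖ ≤ (|A| * B / n ^ 2) ^ 2 := by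
        intro x
        rw [← mul_pow, norm_pow, norm_mul, norm_norm, Real.norm_eq_abs]
        refine pow_le_pow_left₀ (by positivity) ?_ 2
        -- `∇χ` vanishes for `‖x‖ < n`, and elsewhere `u` is of order `1 / n`
        rcases lt_or_ge ‖x‖ n with hx | hx
        · have h1 : χ =ᶠ[𝓝 x] fun _ => (1 : ℝ) := by
            filter_upwards [Metric.isOpen_ball.mem_nhds (mem_ball_zero_iff.2 hx)] with y hy
            exact hχ1 y (mem_ball_zero_iff.1 hy).le
          have h2 : gradient χ x = 0 := by simp [gradient, h1.fderiv_eq]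
          rw [h2, norm_zero, mul_zero]
          positivity
        · have h1 : |u x| ≤ |A| / n := by
            refine (hA' x (hR₁n.trans hx)).trans ?_
            rw [div_eq_mul_inv]
            gcongr
            exact le_abs_self A
          calc |u x| * ‖gradient χ x‖ ≤ (|A| / n) * (B / n) := by
                gcongr
                exact hχg x
            _ = |A| * B / n ^ 2 := by field_simp
      rw [e]
      refine (le_abs_self _).trans ((norm_setIntegral_le_of_norm_le_const
        (hle.trans_lt measure_ball_lt_top) fun x _ => hpt x).trans ?_)
      refine mul_le_mul_of_nonneg_left ?_ (by positivity)
      refine (measureReal_mono sdiff_subset measure_ball_lt_top.ne).trans (le_of_eq ?_)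
      rw [measureReal_def, EuclideanSpace.volume_ball_fin_two, ENNReal.toReal_mul,
        ENNReal.toReal_pow, ENNReal.toReal_ofReal (by positivity),
        ENNReal.toReal_ofReal Real.pi_pos.le]
    rw [hzero, zero_add] at hsq
    refine (pow_le_pow_iff_left₀ (norm_nonneg _) (by positivity) two_ne_zero).1 ?_
    rw [hsq]
    refine hint.trans (le_of_eq ?_)
    calc (|A| * B / n ^ 2) ^ 2 * ((K * n) ^ 2 * Real.pi)
        = (|A| * B / n ^ 2 * (K * n) * √Real.pi) ^ 2 := by
          rw [mul_pow _ (√Real.pi), mul_pow _ (K * (n : ℝ)), Real.sq_sqrt Real.pi_pos.le, mul_assoc]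
      _ = _ := by
          congr 1
          field_simp
  have hlim : Tendsto (fun n : ℕ => C * (|A| * B * K * √Real.pi / n)) atTop (𝓝 0) := by
    simpa using (tendsto_const_nhds.div_atTop tendsto_natCast_atTop_atTop).const_mul C
  have h0 := ge_of_tendsto hlim hbound
  exact sub_eq_zero.1 (norm_le_zero_iff.1 h0)

end IsHolderDomain

/-! ### The exterior Neumann-to-Dirichlet map -/

theorem Lp.smul_add_smul_ae_eq {α E : Type*} [MeasurableSpace α] {μ : Measure α}
    [NormedAddCommGroup E] [NormedSpace ℝ E] {f g : Lp E 2 μ} {u v : α → E} (hf : f =ᵐ[μ] u)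
    (hg : g =ᵐ[μ] v) (a b : ℝ) : (a • f + b • g : Lp E 2 μ) =ᵐ[μ] fun x => a • u x + b • v x := by
  filter_upwards [Lp.coeFn_add (a • f) (b • g), Lp.coeFn_smul a f, Lp.coeFn_smul b g, hf, hg]
    with x h1 h2 h3 h4 h5
  rw [h1, Pi.add_apply, h2, h3, Pi.smul_apply, Pi.smul_apply, h4, h5]

theorem Submodule.prodMk_smul_add_smul_mem {E F : Type*} [AddCommGroup E] [AddCommGroup F]
    [Module ℝ E] [Module ℝ F] (S : Submodule ℝ (E × F)) {U V : E} {f g : F} (h : (U, f) ∈ S)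
    (h' : (V, g) ∈ S) (a b : ℝ) : (a • U + b • V, a • f + b • g) ∈ S :=
  S.add_mem (S.smul_mem a h) (S.smul_mem b h')

theorem LinearMap.apply_smul_add_smul {E F : Type*} [AddCommGroup E] [AddCommGroup F] [Module ℝ E]
    [Module ℝ F] (T : E →ₗ[ℝ] F) (x y : E) (a b : ℝ) :
    T (a • x + b • y) = a • T x + b • T y := by
  rw [map_add, map_smul, map_smul]

theorem IsExteriorSolution.integrableOn_inner {D : Set Plane} (hD : IsBounded D)
    {g : StrongDual ℝ (HHalf D)} {u : Plane → ℝ} {G : Plane → Plane}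
    {f : Lp ℝ 2 (arcLength (frontier D))} (h : IsExteriorSolution D g u G f) {φ : Plane → ℝ}
    (hφ : IsTestFun φ) : IntegrableOn (fun x => inner ℝ (G x) (gradient φ x)) (closure D)ᶜ := by
  obtain ⟨R₀, hR₀⟩ := hD.closure.subset_ball (0 : Plane)
  obtain ⟨R₁, hR₁⟩ := (show IsCompact (tsupport φ) from hφ.2).isBounded.subset_ball (0 : Plane)
  obtain ⟨U, hG⟩ : ∃ U : H1 (extBall D (max R₀ R₁)),
      gradOf U =ᵐ[volume.restrict (extBall D (max R₀ R₁))] G := by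
    obtain ⟨U, -, hG, -⟩ := h.locallyH1 (max R₀ R₁)
      (hR₀.trans (Metric.ball_subset_ball (le_max_left _ _)))
    exact ⟨U, hG⟩
  have h1 : IntegrableOn (fun x => inner ℝ (G x) (gradient φ x)) (extBall D (max R₀ R₁)) := by
    have h2 := L2.integrable_inner (𝕜 := ℝ) (gradOf U)
      (gradOf (H1.ofC1 (extBall D (max R₀ R₁)) hφ.isC1Fun))
    refine h2.congr ?_
    filter_upwards [hG, gradOf_ofC1 (extBall D (max R₀ R₁)) hφ.isC1Fun] with x h3 h4
    rw [h3, h4]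
  refine IntegrableOn.of_forall_sdiff_eq_zero h1 (isOpen_exterior D).measurableSet fun x hx => ?_
  have hx' : x ∉ tsupport φ := fun hxφ =>
    hx.2 ⟨Metric.ball_subset_ball (le_max_right _ _) (hR₁ hxφ), hx.1⟩
  rw [gradient_eq_zero_of_notMem_tsupport hx', inner_zero_right]

set_option maxHeartbeats 1000000 in
theorem IsExteriorSolution.smul_add_smul {D : Set Plane} (hD : IsBounded D)
    {g g' : StrongDual ℝ (HHalf D)} {u u' : Plane → ℝ} {G G' : Plane → Plane}
    {f f' : Lp ℝ 2 (arcLength (frontier D))} (h : IsExteriorSolution D g u G f)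
    (h' : IsExteriorSolution D g' u' G' f') (a b : ℝ) :
    IsExteriorSolution D (a • g + b • g') (fun x => a • u x + b • u' x)
      (fun x => a • G x + b • G' x) (a • f + b • f') where
  locallyH1 := by
    intro R hR
    obtain ⟨U, h1, h2, h3⟩ := h.locallyH1 R hR
    obtain ⟨U', h1', h2', h3'⟩ := h'.locallyH1 R hR
    have h4 : fnOf (a • U + b • U') = a • fnOf U + b • fnOf U' := rfl
    have h5 : gradOf (a • U + b • U') = a • gradOf U + b • gradOf U' := rfl
    refine ⟨a • U + b • U', ?_, ?_, Submodule.prodMk_smul_add_smul_mem _ h3 h3' a b⟩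
    · rw [h4]
      exact Lp.smul_add_smul_ae_eq h1 h1' a b
    · rw [h5]
      exact Lp.smul_add_smul_ae_eq h2 h2' a b
  weak := by
    intro φ hφ V hV
    have e : ∀ x, inner ℝ (a • G x + b • G' x) (gradient φ x)
        = a * inner ℝ (G x) (gradient φ x) + b * inner ℝ (G' x) (gradient φ x) := fun x => by
      rw [inner_add_left, real_inner_smul_left, real_inner_smul_left]
    simp only [e]
    rw [integral_add ((h.integrableOn_inner hD hφ).const_mul a)
      ((h'.integrableOn_inner hD hφ).const_mul b), integral_const_mul, integral_const_mul,
      h.weak φ hφ V hV, h'.weak φ hφ V hV, add_apply, smul_apply, smul_apply, smul_eq_mul,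
      smul_eq_mul]
    ring
  decay := (h.decay.const_smul_left a).add (h'.decay.const_smul_left b)

namespace IsHolderDomain

variable {η : ℝ≥0} {D : Set Plane}

/-- The relation between data and centered boundary values of solutions of the exterior problem. -/
def ExteriorRel (D : Set Plane) (g : HNegHalf0 D) (q : HHalf0 D) : Prop :=
  ∃ (u : Plane → ℝ) (G : Plane → Plane) (f f₀ : Lp ℝ 2 (arcLength (frontier D))) (V : H1 D),
    IsExteriorSolution D g u G f ∧
    f₀ =ᵐ[arcLength (frontier D)] (fun x => f x - ⨍ y, f y ∂(arcLength (frontier D))) ∧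
    (V, f₀) ∈ traceGraph D (frontier D) ∧ boundaryValue V = q

set_option maxHeartbeats 1000000 in
theorem ExteriorRel.smul_add_smul (hD : IsHolderDomain η D) {g g' : HNegHalf0 D}
    {q q' : HHalf0 D} (h : ExteriorRel D g q) (h' : ExteriorRel D g' q') (a b : ℝ) :
    ExteriorRel D (a • g + b • g') (a • q + b • q') := by
  obtain ⟨A, hA⟩ := hD.exists_average
  obtain ⟨u, G, f, f₀, V, hsol, hf₀, hV, hq⟩ := h
  obtain ⟨u', G', f', f₀', V', hsol', hf₀', hV', hq'⟩ := h'
  refine ⟨_, _, a • f + b • f', a • f₀ + b • f₀', a • V + b • V',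
    hsol.smul_add_smul hD.isBounded hsol' a b, ?_,
    Submodule.prodMk_smul_add_smul_mem _ hV hV' a b, ?_⟩
  · have hAv : ⨍ y, (a • f + b • f' : Lp ℝ 2 (arcLength (frontier D))) y ∂(arcLength (frontier D))
        = a • A f + b • A f' := by
      rw [← hA, map_add, map_smul, map_smul]
    rw [hAv]
    filter_upwards [Lp.smul_add_smul_ae_eq hf₀ hf₀' a b,
      Lp.smul_add_smul_ae_eq (EventuallyEq.refl _ (f : Plane → ℝ)) (EventuallyEq.refl _ (f' : Plane → ℝ)) a b]
      with x h1 h2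
    rw [h1, h2, ← hA, ← hA]
    simp only [smul_eq_mul]
    ring
  · rw [LinearMap.apply_smul_add_smul (boundaryValue (D := D)) V V' a b, hq, hq']
    rfl

theorem ExteriorRel.eq_zero (hD : IsHolderDomain η D) (hext : IsConnected (closure D)ᶜ)
    {q : HHalf0 D} (h : ExteriorRel D 0 q) : q = 0 := by
  obtain ⟨u, G, f, f₀, V, hsol, hf₀, hV, hq⟩ := h
  have hf := hD.trace_eq_of_isExteriorSolution_zero hext hsol
  have h0 : f₀ = 0 := by
    refine (Lp.eq_zero_iff_ae_eq_zero).2 ?_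
    have h1 := Lp.coeFn_smul (⨍ y, f y ∂(arcLength (frontier D))) (hD.trace hD.one)
    rw [← hf] at h1
    filter_upwards [hf₀, h1, hD.trace_one] with x h2 h3 h4
    rw [h2, h3, Pi.smul_apply, h4, smul_eq_mul, mul_one, sub_self]
    rfl
  have h1 : boundaryValue V = 0 := by
    rw [← map_zero (boundaryValue (D := D)), hD.boundaryValue_eq_iff, map_zero,
      (hD.trace_eq_iff V f₀).2 hV, h0]
  exact Subtype.ext (hq.symm.trans h1)

theorem exists_isExteriorNtD (hD : IsHolderDomain η D) (hext : IsConnected (closure D)ᶜ) :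
    ∃ Λ, IsExteriorNtD D Λ := by
  obtain ⟨C, hC0, hC⟩ := hD.exists_isExteriorSolution hext
  obtain ⟨Λ, hΛ, -⟩ := exists_clm_of_relation (R := ExteriorRel D) (C := C)
    (fun g h y z hg hh => by
      have := ExteriorRel.smul_add_smul hD hg hh 1 1
      rwa [one_smul, one_smul, one_smul, one_smul] at this)
    (fun a g y hg => by
      have := ExteriorRel.smul_add_smul hD hg hg a 0
      rwa [zero_smul, zero_smul, add_zero, add_zero] at this)
    (fun g => by
      obtain ⟨u, G, f, f₀, V, h1, h2, h3, h4, h5, -⟩ := hC g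
      exact ⟨⟨boundaryValue V, (hD.mem_HHalf0_iff _).2 h4⟩, ⟨u, G, f, f₀, V, h1, h2, h3, rfl⟩, h5⟩)
    (fun y hy => ExteriorRel.eq_zero hD hext hy) hC0
  exact ⟨Λ, hΛ⟩

/-- The exterior Neumann-to-Dirichlet map is negative: `-⟨g, Λᵉ g⟩` is the energy of the
solution. -/
theorem apply_exteriorNtD_nonpos (hD : IsHolderDomain η D) (hext : IsConnected (closure D)ᶜ)
    {Λ : HNegHalf0 D →L[ℝ] HHalf0 D} (hΛ : IsExteriorNtD D Λ) (g : HNegHalf0 D) :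
    (g : StrongDual ℝ (HHalf D)) (Λ g : HHalf D) ≤ 0 := by
  obtain ⟨C, -, hC⟩ := hD.exists_isExteriorSolution hext
  obtain ⟨u, G, f, f₀, V, h1, h2, h3, h4, -, h6⟩ := hC g
  have h := (hΛ g ⟨boundaryValue V, (hD.mem_HHalf0_iff _).2 h4⟩).2 ⟨u, G, f, f₀, V, h1, h2, h3, rfl⟩
  rw [h]
  exact h6

end IsHolderDomain

/-! ### Coercive operators and the algebra of their inverses -/

section Abstract

variable {X Y : Type*} [NormedAddCommGroup X] [NormedSpace ℝ X] [NormedAddCommGroup Y]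
  [NormedSpace ℝ Y]

/-- A form of the Lax–Milgram lemma: an operator that is coercive with respect to a pairing that
represents every functional on the target is invertible. -/
theorem exists_equiv_of_coercive [CompleteSpace X] [CompleteSpace Y] (P : X → StrongDual ℝ Y)
    (hP : ∀ g y, P g y ≤ ‖g‖ * ‖y‖) (hsurj : ∀ ℓ, ∃ g, P g = ℓ) (A : X →L[ℝ] Y) {κ : ℝ}
    (hκ : 0 < κ) (hA : ∀ g, κ * ‖g‖ ^ 2 ≤ P g (A g)) :
    ∃ e : X ≃L[ℝ] Y, (e : X →L[ℝ] Y) = A ∧ ‖(e.symm : Y →L[ℝ] X)‖ ≤ κ⁻¹ := by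
  have hbelow : ∀ g, κ * ‖g‖ ≤ ‖A g‖ := by
    intro g
    rcases eq_or_ne g 0 with rfl | hg
    · simp
    · have h1 := (hA g).trans (hP g (A g))
      have h2 : 0 < ‖g‖ := norm_pos_iff.2 hg
      nlinarith
  have hanti : AntilipschitzWith (Real.toNNReal κ⁻¹) A := by
    refine A.antilipschitz_of_bound fun g => ?_
    rw [Real.coe_toNNReal _ (by positivity), ← div_eq_inv_mul, le_div_iff₀ hκ, mul_comm]
    exact hbelow g
  have hker : A.ker = ⊥ := LinearMap.ker_eq_bot.2 hanti.injective
  have hclosed : IsClosed (A.range : Set Y) := hanti.isClosed_range A.uniformContinuous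
  have hrange : A.range = ⊤ := by
    by_contra hne
    obtain ⟨y, hy⟩ : ∃ y, y ∉ A.range := by
      by_contra h
      push Not at h
      exact hne (Submodule.eq_top_iff'.2 h)
    obtain ⟨ℓ, u, hℓ, hu⟩ := geometric_hahn_banach_closed_point
      (Submodule.convex A.range) hclosed hy
    have hu0 : 0 < u := by simpa using hℓ 0 (zero_mem A.range)
    obtain ⟨g, rfl⟩ := hsurj ℓ
    -- a functional that is bounded above on a subspace vanishes there
    have h0 : P g (A g) = 0 := by
      by_contra h0
      have h1 := hℓ (A ((u / P g (A g)) • g)) ⟨_, rfl⟩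
      rw [map_smul, map_smul, smul_eq_mul, div_mul_cancel₀ _ h0] at h1
      exact lt_irrefl _ h1
    have hg : ‖g‖ = 0 := by
      have h1 := hA g
      rw [h0] at h1
      by_contra hg
      have : 0 < ‖g‖ := lt_of_le_of_ne (norm_nonneg g) (Ne.symm hg)
      have : 0 < κ * ‖g‖ ^ 2 := by positivity
      linarith
    have h2 := hP g y
    rw [hg, zero_mul] at h2
    linarith
  let e := ContinuousLinearEquiv.ofBijective A hker hrange
  have he : ∀ x, e x = A x := fun x => rfl
  refine ⟨e, rfl, ContinuousLinearMap.opNorm_le_bound _ (by positivity) fun y => ?_⟩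
  have h := hbelow (e.symm y)
  rw [← he, e.apply_symm_apply] at h
  rw [← div_eq_inv_mul, le_div_iff₀ hκ, mul_comm]
  exact h

/-- With `Aᵢ = Sᵢ - E`, the operator `L⁻¹ (L - Sᵢ) Aᵢ⁻¹ (L - E)` is `L⁻¹ (L - E) Aᵢ⁻¹ (L - E)` up to
a term that does not depend on `i`, and the resolvent identity applies. -/
theorem inverse_comp_sub_eq (L E S₁ S₂ : X →L[ℝ] Y) (h₁ : (S₁ - E).IsInvertible)
    (h₂ : (S₂ - E).IsInvertible) :
    L.inverse ∘L (L - S₁) ∘L (S₁ - E).inverse ∘L (L - E)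
      - L.inverse ∘L (L - S₂) ∘L (S₂ - E).inverse ∘L (L - E)
      = -((L.inverse ∘L (L - E)) ∘L (S₁ - E).inverse ∘L (S₁ - S₂) ∘L (S₂ - E).inverse ∘L
        (L - E)) := by
  ext x
  have e₁ := h₁.self_apply_inverse ((L - E) x)
  have e₂ := h₂.self_apply_inverse ((L - E) x)
  have e₃ := h₁.inverse_apply_self ((S₂ - E).inverse ((L - E) x))
  generalize hy : (L - E) x = y at *
  generalize hz₁ : (S₁ - E).inverse y = z₁ at *
  generalize hz₂ : (S₂ - E).inverse y = z₂ at *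
  have e₄ : (S₁ - S₂) z₂ = (S₁ - E) z₂ - y := by
    rw [← e₂]
    simp
  have e₅ : (L - S₁) z₁ = (L - E) z₁ - y := by
    rw [← e₁]
    simp
  have e₆ : (L - S₂) z₂ = (L - E) z₂ - y := by
    rw [← e₂]
    simp
  simp only [sub_apply, neg_apply, ContinuousLinearMap.comp_apply] at e₄ e₅ e₆ hy hz₁ hz₂ ⊢
  rw [hy, hz₁, hz₂, e₄, e₅, e₆]
  have e₇ : (S₁ - E).inverse (S₁ z₂ - E z₂ - y) = z₂ - z₁ := by
    rw [map_sub, hz₁]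
    exact congrArg (· - z₁) e₃
  rw [e₇]
  simp only [map_sub]
  abel

theorem sub_eq_comp_comp (L E S₁ S₂ : X →L[ℝ] Y) (hL : L.IsInvertible)
    (hQ : (L - E).IsInvertible) (h₁ : (S₁ - E).IsInvertible) (h₂ : (S₂ - E).IsInvertible) :
    S₁ - S₂ = -((S₁ - E) ∘L ((L - E).inverse ∘L L) ∘L
      (L.inverse ∘L (L - S₁) ∘L (S₁ - E).inverse ∘L (L - E)
        - L.inverse ∘L (L - S₂) ∘L (S₂ - E).inverse ∘L (L - E)) ∘L (L - E).inverse ∘L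
        (S₂ - E)) := by
  rw [inverse_comp_sub_eq L E S₁ S₂ h₁ h₂]
  ext x
  have e : ∀ T : X →L[ℝ] Y, ((-T) : X →L[ℝ] Y) x = -(T x) := fun T => rfl
  have e' : ∀ (T : X →L[ℝ] X) (z : X), ((-T) : X →L[ℝ] X) z = -(T z) := fun T z => rfl
  rw [e]
  simp only [ContinuousLinearMap.comp_apply, e', map_neg, neg_neg]
  rw [hQ.self_apply_inverse, h₂.inverse_apply_self, hL.self_apply_inverse, hQ.inverse_apply_self,
    h₁.self_apply_inverse]

theorem norm_comp_five_le {E₁ E₂ E₃ E₄ E₅ E₆ : Type*} [NormedAddCommGroup E₁] [NormedSpace ℝ E₁]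
    [NormedAddCommGroup E₂] [NormedSpace ℝ E₂] [NormedAddCommGroup E₃] [NormedSpace ℝ E₃]
    [NormedAddCommGroup E₄] [NormedSpace ℝ E₄] [NormedAddCommGroup E₅] [NormedSpace ℝ E₅]
    [NormedAddCommGroup E₆] [NormedSpace ℝ E₆] (T₁ : E₂ →L[ℝ] E₁) (T₂ : E₃ →L[ℝ] E₂)
    (T₃ : E₄ →L[ℝ] E₃) (T₄ : E₅ →L[ℝ] E₄) (T₅ : E₆ →L[ℝ] E₅) :
    ‖T₁ ∘L T₂ ∘L T₃ ∘L T₄ ∘L T₅‖ ≤ ‖T₁‖ * ‖T₂‖ * ‖T₃‖ * ‖T₄‖ * ‖T₅‖ := by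
  refine (T₁.opNorm_comp_le _).trans ?_
  rw [mul_assoc, mul_assoc, mul_assoc]
  refine mul_le_mul_of_nonneg_left ((T₂.opNorm_comp_le _).trans ?_) (norm_nonneg _)
  refine mul_le_mul_of_nonneg_left ((T₃.opNorm_comp_le _).trans ?_) (norm_nonneg _)
  exact mul_le_mul_of_nonneg_left (T₄.opNorm_comp_le _) (norm_nonneg _)

end Abstract

/-! ### The Neumann-to-Dirichlet maps and the polarization operators -/

theorem isNtD_ntd {D : Set Plane} {σ : Plane → ℝ} (h : ∃ Λ, IsNtD D σ Λ) :
    IsNtD D σ (ntd D σ) := by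
  unfold ntd
  rw [dif_pos h]
  exact h.choose_spec

theorem IsNtD.unique {D : Set Plane} {σ : Plane → ℝ} {Λ Λ' : HNegHalf0 D →L[ℝ] HHalf0 D}
    (h : IsNtD D σ Λ) (h' : IsNtD D σ Λ') : Λ = Λ' :=
  ContinuousLinearMap.ext fun g => (h g (Λ' g)).2 ((h' g _).1 rfl)

theorem isExteriorNtD_exteriorNtd {D : Set Plane} (h : ∃ Λ, IsExteriorNtD D Λ) :
    IsExteriorNtD D (exteriorNtd D) := by
  unfold exteriorNtd
  rw [dif_pos h]
  exact h.choose_spec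

theorem isConductivity_one {c : ℝ} (hc : 1 < c) (D : Set Plane) :
    IsConductivity c D fun _ => 1 :=
  ⟨aemeasurable_const, ae_of_all _ fun _ => ⟨inv_le_one_of_one_le₀ hc.le, hc.le⟩⟩

/-- The pairing of `H^{-1/2}_0(∂D)` with `H^{1/2}_0(∂D)`. -/
def pairing (D : Set Plane) (g : HNegHalf0 D) : StrongDual ℝ (HHalf0 D) :=
  (g : StrongDual ℝ (HHalf D)).comp (HHalf0 D).subtypeL

theorem pairing_le {D : Set Plane} (g : HNegHalf0 D) (q : HHalf0 D) :
    pairing D g q ≤ ‖g‖ * ‖q‖ :=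
  (le_abs_self _).trans ((g : StrongDual ℝ (HHalf D)).le_opNorm (q : HHalf D))

namespace IsHolderDomain

variable {η : ℝ≥0} {D : Set Plane} {c : ℝ}

theorem completeSpace_HHalf0 (hD : IsHolderDomain η D) : CompleteSpace (HHalf0 D) :=
  hD.isClosed_HHalf0.completeSpace_coe

theorem completeSpace_HNegHalf0 (hD : IsHolderDomain η D) : CompleteSpace (HNegHalf0 D) := by
  have h : (HNegHalf0 D : Set (StrongDual ℝ (HHalf D))) = {g | g (boundaryValue hD.one) = 0} := by
    ext g
    exact hD.mem_HNegHalf0_iff g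
  have hc : IsClosed (HNegHalf0 D : Set (StrongDual ℝ (HHalf D))) := by
    rw [h]
    exact isClosed_eq (ContinuousLinearMap.apply ℝ ℝ (boundaryValue hD.one)).continuous
      continuous_const
  exact hc.completeSpace_coe

/-- The dual of `H^{1/2}_0(∂D)` is `H^{-1/2}_0(∂D)`: a functional is extended by zero on the
constants. -/
theorem exists_pairing_eq (hD : IsHolderDomain η D) (ℓ : StrongDual ℝ (HHalf0 D)) :
    ∃ g, pairing D g = ℓ := by
  let T : HHalf D →L[ℝ] HHalf D :=
    ContinuousLinearMap.id ℝ (HHalf D) - hD.mean.smulRight (boundaryValue hD.one)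
  have hT : ∀ q, T q = q - hD.mean q • boundaryValue hD.one := fun q => rfl
  have hT0 : ∀ q, T q ∈ HHalf0 D := fun q => by
    rw [hD.mem_HHalf0_iff, hT, map_sub, map_smul, hD.mean_one, smul_eq_mul, mul_one, sub_self]
  let g : StrongDual ℝ (HHalf D) := ℓ.comp (T.codRestrict (HHalf0 D) hT0)
  have hg : g ∈ HNegHalf0 D := by
    rw [hD.mem_HNegHalf0_iff]
    have h : T.codRestrict (HHalf0 D) hT0 (boundaryValue hD.one) = 0 := by
      refine Subtype.ext ?_
      change T (boundaryValue hD.one) = 0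
      rw [hT, hD.mean_one, one_smul, sub_self]
    change ℓ (T.codRestrict (HHalf0 D) hT0 (boundaryValue hD.one)) = 0
    rw [h, map_zero]
  refine ⟨⟨g, hg⟩, ContinuousLinearMap.ext fun q => ?_⟩
  have h : T.codRestrict (HHalf0 D) hT0 (q : HHalf D) = q := by
    refine Subtype.ext ?_
    change T (q : HHalf D) = q
    rw [hT, (hD.mem_HHalf0_iff _).1 q.2, zero_smul, sub_zero]
  change ℓ (T.codRestrict (HHalf0 D) hT0 (q : HHalf D)) = ℓ q
  rw [h]

theorem exists_equiv_of_le_pairing (hD : IsHolderDomain η D) (A : HNegHalf0 D →L[ℝ] HHalf0 D)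
    {κ : ℝ} (hκ : 0 < κ) (hA : ∀ g, κ * ‖g‖ ^ 2 ≤ pairing D g (A g)) :
    A.IsInvertible ∧ ‖A.inverse‖ ≤ κ⁻¹ := by
  have := hD.completeSpace_HHalf0
  have := hD.completeSpace_HNegHalf0
  obtain ⟨e, rfl, he⟩ := exists_equiv_of_coercive (pairing D) pairing_le hD.exists_pairing_eq A hκ hA
  refine ⟨ContinuousLinearMap.isInvertible_equiv, ?_⟩
  rw [ContinuousLinearMap.inverse_equiv]
  exact he

end IsHolderDomain

end

theorem lemma3p6 (η : ℝ≥0) (hη0 : 0 < η) (hη1 : η < 1) (c : ℝ) (hc : 1 < c)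
    (D : Set Plane) (hD : IsHolderDomain η D) (hext : IsConnected (closure D)ᶜ) :
    -- the operators exist, so that none of the definitions takes its default value
    IsExteriorNtD D (exteriorNtd D) ∧
    (∀ σ, IsConductivity c D σ → IsNtD D σ (ntd D σ)) ∧
    (ntd D fun _ => 1).IsInvertible ∧
    -- bounded invertibility
    (∀ σ, IsConductivity c D σ → (ntd D σ - exteriorNtd D).IsInvertible) ∧
    -- equivalence of the differences in the operator norms
    ∃ C₁ > 0, ∃ C₂ > 0, ∀ σ₁ σ₂, IsConductivity c D σ₁ → IsConductivity c D σ₂ →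
      C₂ * ‖gptOp D σ₁ - gptOp D σ₂‖ ≤ ‖ntd D σ₁ - ntd D σ₂‖ ∧
      ‖ntd D σ₁ - ntd D σ₂‖ ≤ C₁ * ‖gptOp D σ₁ - gptOp D σ₂‖ := by
  have hc0 : 0 < c := one_pos.trans hc
  have hE := isExteriorNtD_exteriorNtd (hD.exists_isExteriorNtD hext)
  obtain ⟨C, hC0, hC⟩ := hD.exists_isNtD hc0
  have hN : ∀ σ, IsConductivity c D σ → IsNtD D σ (ntd D σ) := fun σ hσ => by
    obtain ⟨Λ, hΛ, -⟩ := hC σ hσ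
    exact isNtD_ntd ⟨Λ, hΛ⟩
  have hNC : ∀ σ, IsConductivity c D σ → ‖ntd D σ‖ ≤ C := fun σ hσ => by
    obtain ⟨Λ, hΛ, hΛC⟩ := hC σ hσ
    rwa [(hN σ hσ).unique hΛ]
  have h1 := isConductivity_one hc D
  set κ := (c ^ 3)⁻¹ with hκ
  have hκ0 : 0 < κ := by positivity
  have hcoer : ∀ σ, IsConductivity c D σ → ∀ g, κ * ‖g‖ ^ 2 ≤ pairing D g (ntd D σ g) :=
    fun σ hσ g => IsHolderDomain.norm_sq_le_ntd hσ hc0 (hN σ hσ) g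
  have hdiff : ∀ σ, IsConductivity c D σ →
      (ntd D σ - exteriorNtd D).IsInvertible ∧ ‖(ntd D σ - exteriorNtd D).inverse‖ ≤ κ⁻¹ := by
    intro σ hσ
    refine hD.exists_equiv_of_le_pairing _ hκ0 fun g => ?_
    have h2 : pairing D g (exteriorNtd D g) ≤ 0 := hD.apply_exteriorNtD_nonpos hext hE g
    rw [sub_apply, map_sub]
    linarith [hcoer σ hσ g]
  have hL := (hD.exists_equiv_of_le_pairing _ hκ0 (hcoer _ h1)).1
  refine ⟨hE, hN, hL, fun σ hσ => (hdiff σ hσ).1, ?_⟩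
  generalize hE' : exteriorNtd D = E at *
  generalize hL' : (ntd D fun _ => 1) = L at *
  have hQ := (hdiff _ h1).1
  rw [hL'] at hQ
  have hgpt : ∀ σ, gptOp D σ = L.inverse ∘L (L - ntd D σ) ∘L (ntd D σ - E).inverse ∘L (L - E) := by
    intro σ
    rw [← hL', ← hE']
    rfl
  have ha : ∀ σ, IsConductivity c D σ → ‖ntd D σ - E‖ ≤ C + ‖E‖ := fun σ hσ =>
    (norm_sub_le _ _).trans (by linarith [hNC σ hσ])
  set K₁ := ‖L.inverse ∘L (L - E)‖ * κ⁻¹ * κ⁻¹ * ‖L - E‖ with hK₁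
  set K₂ := (C + ‖E‖) * ‖(L - E).inverse ∘L L‖ * ‖(L - E).inverse‖ * (C + ‖E‖) with hK₂
  have hK₁0 : 0 ≤ K₁ := by positivity
  have hK₂0 : 0 ≤ K₂ := by positivity
  refine ⟨K₂ + 1, by positivity, (K₁ + 1)⁻¹, by positivity, fun σ₁ σ₂ hσ₁ hσ₂ => ?_⟩
  obtain ⟨i₁, b₁⟩ := hdiff σ₁ hσ₁
  obtain ⟨i₂, b₂⟩ := hdiff σ₂ hσ₂
  constructor
  · rw [inv_mul_le_iff₀ (by positivity)]
    have h : ‖gptOp D σ₁ - gptOp D σ₂‖ ≤ K₁ * ‖ntd D σ₁ - ntd D σ₂‖ := by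
      rw [hgpt, hgpt, inverse_comp_sub_eq L E _ _ i₁ i₂, norm_neg]
      refine (norm_comp_five_le _ _ _ _ _).trans ?_
      calc ‖L.inverse ∘L (L - E)‖ * ‖(ntd D σ₁ - E).inverse‖ * ‖ntd D σ₁ - ntd D σ₂‖
            * ‖(ntd D σ₂ - E).inverse‖ * ‖L - E‖
          ≤ ‖L.inverse ∘L (L - E)‖ * κ⁻¹ * ‖ntd D σ₁ - ntd D σ₂‖ * κ⁻¹ * ‖L - E‖ := by gcongr
        _ = K₁ * ‖ntd D σ₁ - ntd D σ₂‖ := by rw [hK₁]; ring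
    nlinarith [norm_nonneg (ntd D σ₁ - ntd D σ₂)]
  · have h : ‖ntd D σ₁ - ntd D σ₂‖ ≤ K₂ * ‖gptOp D σ₁ - gptOp D σ₂‖ := by
      rw [hgpt, hgpt]
      conv_lhs => rw [sub_eq_comp_comp L E _ _ hL hQ i₁ i₂, norm_neg]
      refine (norm_comp_five_le _ _ _ _ _).trans ?_
      rw [← hgpt, ← hgpt]
      calc ‖ntd D σ₁ - E‖ * ‖(L - E).inverse ∘L L‖ * ‖gptOp D σ₁ - gptOp D σ₂‖
            * ‖(L - E).inverse‖ * ‖ntd D σ₂ - E‖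
          ≤ (C + ‖E‖) * ‖(L - E).inverse ∘L L‖ * ‖gptOp D σ₁ - gptOp D σ₂‖
            * ‖(L - E).inverse‖ * (C + ‖E‖) := by
            gcongr
            · exact ha σ₁ hσ₁
            · exact ha σ₂ hσ₂
        _ = K₂ * ‖gptOp D σ₁ - gptOp D σ₂‖ := by rw [hK₂]; ring
    nlinarith [norm_nonneg (gptOp D σ₁ - gptOp D σ₂)]
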